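/- **Setting.** Let $u,v:\mathbb R^2\to\mathbb C$, put $\mathbf q(x,t)=(u,v^*)^T$, and let $\mathbf q$ be a $C^3$ solution on $\mathbb R^2$ of the coupled mKdV equation $$\mathbf q_t+\mathbf q_{xxx}+3(\mathbf q^\dagger\mathbf q)\mathbf q_x+3(\mathbf q^\dagger\mathbf q_x)\mathbf q=0$$ (for real $u,v$: $u_t+u_{xxx}+6u^2u_x+3v^2u_x+3uvv_x=0$ and the same with $u,v$ exchanged). Assume that, for every $t$, $\mathbf q(x,t)\to\mathbf q_\pm=\mathbf c\,e^{i\theta^\pm}$ and $\mathbf q_x,\mathbf q_{xx}\to0$ as $x\to\pm\infty$, where $\mathbf c\in\mathbb C^2$ and $\theta^\pm\in\mathbb R$ are constants and $q_0=\|\mathbf c\|>0$; that $\mathbf q,\mathbf q_x,\mathbf q_{xx}$ are bounded on $\mathbb R\times[-T,T]$ for every $T$; and that $\mathbf q(\cdot,t)-\mathbf q_+\in L^1(a,\infty)$, $\mathbf q(\cdot,t)-\mathbf q_-\in L^1(-\infty,a)$ for all $t,a$. For $z\neq0$ put $k=\frac12(z-q_0^2/z)$, $\lambda=\frac12(z+q_0^2/z)$,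 $\theta_1=\lambda[x+2(2k^2-q_0^2)t]$, $\theta_2=k(x+4k^2t)$, $\Theta=\mathrm{diag}(\theta_1,\theta_2,-\theta_1)$, $\sigma_3=\mathrm{diag}(1,1,-1)$, $Q=\begin{pmatrix}0&\mathbf q\\-\mathbf q^\dagger&0\end{pmatrix}$, $U=ik\sigma_3+Q$, $V=4ik^3\sigma_3+4k^2Q-2ik\sigma_3(Q_x-Q^2)+2Q^3-Q_{xx}+[Q_x,Q]$, and $$\Gamma_\pm=\begin{pmatrix}\mathbf q_\pm/q_0&\mathbf q_\pm^\perp/q_0&i\mathbf q_\pm/z\\ iq_0/z&0&1\end{pmatrix},\qquad \mathbf w^\perp=(w_2^*,-w_1^*)^T.$$ Let $D_1,D_2$ be the parts of $\{|z|>q_0\}$ with $\Im z>0$, $\Im z<0$, and $D_3,D_4$ the parts of $\{|z|<q_0\}$ with $\Im z<0$, $\Im z>0$. The Jost columns $\Phi_{\pm,j}(x,t,z)$ are the simultaneous solutions of $\Phi_x=U\Phi$, $\Phi_t=V\Phi$ with $\mu_{\pm,j}:=\Phi_{\pm,j}e^{-i\Theta_{jj}}\to\Gamma_{\pm,j}$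 as $x\to\pm\infty$. They are considered for real $z\ne0$ and for $z$ in the regions of analyticity: $D_3$, $\Im z>0$, $D_2$ for $\Phi_{+,1},\Phi_{+,2},\Phi_{+,3}$, and $D_4$, $\Im z<0$, $D_1$ for $\Phi_{-,1},\Phi_{-,2},\Phi_{-,3}$. With $\widetilde\Phi_{\pm,j}(z)=\overline{\Phi_{\pm,j}(z^*)}$ put $$\chi_1=e^{i\theta_2}\widetilde\Phi_{-,2}\times\widetilde\Phi_{+,3},\quad \chi_2=e^{i\theta_2}\widetilde\Phi_{+,2}\times\widetilde\Phi_{-,3},\quad \chi_3=e^{i\theta_2}\widetilde\Phi_{-,1}\times\widetilde\Phi_{+,2},\quad \chi_4=e^{i\theta_2}\widetilde\Phi_{+,1}\times\widetilde\Phi_{-,2}$$ on $D_1,\dots,D_4$ respectively, $m_j=e^{-i\theta_1}\chi_j$ for $j=1,2$ and $m_j=e^{i\theta_1}\chi_j$ for $j=3,4$. For real $z\neq0$ let $\Phi_-=\Phi_+A$ and $B=A^{-1}$. Continue the diagonal entries analytically from the adjacent real intervals: $a_{11},a_{22},a_{33}$ to $D_4$, $\{\Im z<0\}$, $D_1$,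 and $b_{11},b_{22},b_{33}$ to $D_3$, $\{\Im z>0\}$, $D_2$. Let $$M^+=\Big(\tfrac{m_1}{b_{22}},\mu_{+,2},\tfrac{\mu_{-,3}}{a_{33}}\Big)\text{ on }D_1,\qquad M^+=\Big(\mu_{+,1},\tfrac{\mu_{-,2}}{a_{22}},\tfrac{m_3}{b_{11}}\Big)\text{ on }D_3,$$ $$M^-=\Big(\tfrac{m_2}{b_{33}},\tfrac{\mu_{-,2}}{a_{22}},\mu_{+,3}\Big)\text{ on }D_2,\qquad M^-=\Big(\tfrac{\mu_{-,1}}{a_{11}},\mu_{+,2},\tfrac{m_4}{b_{22}}\Big)\text{ on }D_4,$$ and denote the columns of $M^\pm$ by $m_1^\pm,m_2^\pm,m_3^\pm$ and its residue at $\tau$ by $M^\pm_{-1,\tau}$. Put $\hat z=-q_0^2/z$ and $\hat z^*=-q_0^2/z^*$. A point of $D_1$ is a (simple) eigenvalue * of the first type if $a_{33}=0\ne a_{33}'$ and $b_{22}\neq0$ there; * of the second type if $a_{33}\ne0$ and $b_{22}=0\neq b_{22}'$ there; * of the third type if $a_{33}=b_{22}=0$ with $a_{33}'\ne0\ne b_{22}'$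 there and, in addition, $\chi_1$ vanishes at the point and $\chi_2$ at its complex conjugate, for all $x,t$. **Theorem.** For every eigenvalue of each type there are norming constants, independent of $x$ and $t$, such that the following holds for all $x,t$. At each of the four listed points $M^\pm$ has a simple pole, with the listed nonzero residue. (1) First type, $z$: $\Phi_{-,3}(z)=e\chi_1(z)$, $\chi_2(z^*)=\hat e\,\Phi_{+,3}(z^*)$, $\chi_3(\hat z^*)=\check e\,\Phi_{+,1}(\hat z^*)$, $\Phi_{-,1}(\hat z)=\tilde e\,\chi_4(\hat z)$, and $$M^+_{-1,z}=\big(0,0,E\,m_1^+(z)e^{2i\theta_1(z)}\big),\qquad M^-_{-1,z^*}=\big(\hat E\,m_3^-(z^*)e^{-2i\theta_1(z^*)},0,0\big),$$ $$M^+_{-1,\hat z^*}=\big(0,0,\tfrac{z^*}{iq_0}\check E\,m_3^-(z^*)e^{2i\theta_1(\hat z^*)}\big),\qquad M^-_{-1,\hat z}=\big(\tfrac{z}{iq_0}\tilde E\,m_1^+(z)e^{-2i\theta_1(\hat z)},0,0\big),$$ with $E=\frac{e\,b_{22}(z)}{a_{33}'(z)}$, $\hat E=\frac{\hat e}{b_{33}'(z^*)}$,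 $\check E=\frac{\check e}{b_{11}'(\hat z^*)}$, $\tilde E=\frac{\tilde e\,b_{22}(z)}{a_{11}'(\hat z)}$. (2) Second type, $\zeta$: $\chi_1(\zeta)=f\Phi_{+,2}(\zeta)$, $\Phi_{-,2}(\zeta^*)=\hat f\chi_2(\zeta^*)$, $\Phi_{-,2}(\hat\zeta^*)=\check f\chi_3(\hat\zeta^*)$, $\chi_4(\hat\zeta)=\tilde f\,\Phi_{+,2}(\hat\zeta)$, and $$M^+_{-1,\zeta}=\big(F\,m_2^+(\zeta)e^{i(\theta_2-\theta_1)(\zeta)},0,0\big),\qquad M^-_{-1,\zeta^*}=\big(0,\hat F\,m_1^-(\zeta^*)e^{i(\theta_1-\theta_2)(\zeta^*)},0\big),$$ $$M^+_{-1,\hat\zeta^*}=\big(0,\tfrac{\zeta^*}{iq_0}\check F\,m_1^-(\zeta^*)e^{-i(\theta_1+\theta_2)(\hat\zeta^*)},0\big),\qquad M^-_{-1,\hat\zeta}=\big(0,0,\tilde F\,m_2^+(\zeta)e^{i(\theta_1+\theta_2)(\hat\zeta)}\big),$$ with $F=\frac{f}{b_{22}'(\zeta)}$, $\hat F=\frac{\hat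 f\,b_{33}(\zeta^*)}{a_{22}'(\zeta^*)}$, $\check F=\frac{\check f\,b_{33}(\zeta^*)}{a_{22}'(\hat\zeta^*)}$, $\tilde F=\frac{\tilde f}{b_{22}'(\hat\zeta)}$. (3) Third type, $\omega$: $\Phi_{-,3}(\omega)=g\Phi_{+,2}(\omega)$, $\Phi_{-,2}(\omega^*)=\hat g\,\Phi_{+,3}(\omega^*)$, $\Phi_{-,2}(\hat\omega^*)=\check g\,\Phi_{+,1}(\hat\omega^*)$, $\Phi_{-,1}(\hat\omega)=\tilde g\,\Phi_{+,2}(\hat\omega)$, and $$M^+_{-1,\omega}=\big(0,0,G\,m_2^+(\omega)e^{i(\theta_1+\theta_2)(\omega)}\big),\qquad M^-_{-1,\omega^*}=\big(0,\hat G\,m_3^-(\omega^*)e^{-i(\theta_1+\theta_2)(\omega^*)},0\big),$$ $$M^+_{-1,\hat\omega^*}=\big(0,\tfrac{\omega^*}{iq_0}\check G\,m_3^-(\omega^*)e^{i(\theta_1-\theta_2)(\hat\omega^*)},0\big),\qquad M^-_{-1,\hat\omega}=\big(\tilde G\,m_2^+(\omega)e^{i(\theta_2-\theta_1)(\hat\omega)},0,0\big),$$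 with $G=\frac{g}{a_{33}'(\omega)}$, $\hat G=\frac{\hat g}{a_{22}'(\omega^*)}$, $\check G=\frac{\check g}{a_{22}'(\hat\omega^*)}$, $\tilde G=\frac{\tilde g}{a_{11}'(\hat\omega)}$. -/

import Mathlib

open Filter Topology Matrix
open scoped ComplexConjugate

noncomputable section

/-- The raw data: two complex potentials `u`, `v` on the `(x,t)`-plane, the constant background
vector `c` and the two real phases of the boundary values at `x → +∞` and `x → -∞`. -/
structure Potential where
  u : ℝ → ℝ → ℂ
  v : ℝ → ℝ → ℂ
  c : Fin 2 → ℂ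
  phasePlus : ℝ
  phaseMinus : ℝ

/-- The matrix with columns `a`, `b`, `d`. -/
def colMatrix (a b d : Fin 3 → ℂ) : Matrix (Fin 3) (Fin 3) ℂ := (Matrix.of ![a, b, d])ᵀ

/-- The Pauli-type matrix `diag(1, 1, -1)`. -/
def sigmaThree : Matrix (Fin 3) (Fin 3) ℂ := Matrix.diagonal ![1, 1, -1]

/-- The block matrix with off-diagonal blocks `w` and `-w†`, and zero diagonal blocks. -/
def blockQ (w : Fin 2 → ℂ) : Matrix (Fin 3) (Fin 3) ℂ :=
  !![0, 0, w 0; 0, 0, w 1; -conj (w 0), -conj (w 1), 0]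

open Classical in
/-- The analytic continuation to the open set `D` of boundary values `g` given on `B ⊆ ∂D`: a
function which is holomorphic on `D`, continuous on `D ∪ B`, and equal to `g` on `B`
(zero if there is none). It is used only where `B` consists of real intervals that meet the boundary
of every component of `D`, so that the continuation is unique on `D ∪ B`. -/
def analyticContinuation (D B : Set ℂ) (g : ℂ → ℂ) : ℂ → ℂ :=
  if h : ∃ f : ℂ → ℂ, DifferentiableOn ℂ f D ∧ ContinuousOn f (D ∪ B) ∧ Set.EqOn f g B
  then h.choose else 0

/-- `F` has a simple pole at `τ` with residue `R`: the principal part of `F` at `τ` is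
`R / (z - τ)`, with `R ≠ 0`. -/
def HasSimplePole (F : ℂ → Matrix (Fin 3) (Fin 3) ℂ) (τ : ℂ) (R : Matrix (Fin 3) (Fin 3) ℂ) :
    Prop :=
  R ≠ 0 ∧ ∃ G : ℂ → Matrix (Fin 3) (Fin 3) ℂ, (∀ i j, AnalyticAt ℂ (fun z => G z i j) τ) ∧
    ∀ᶠ z in 𝓝[≠] τ, F z = (z - τ)⁻¹ • R + G z

namespace Potential

variable (S : Potential)

/-- The vector potential `q = (u, v^*)ᵀ`. -/
def q (x t : ℝ) : Fin 2 → ℂ := ![S.u x t, conj (S.v x t)]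

def qx (x t : ℝ) : Fin 2 → ℂ := deriv (fun y => S.q y t) x

def qxx (x t : ℝ) : Fin 2 → ℂ := iteratedDeriv 2 (fun y => S.q y t) x

def qxxx (x t : ℝ) : Fin 2 → ℂ := iteratedDeriv 3 (fun y => S.q y t) x

def qt (x t : ℝ) : Fin 2 → ℂ := deriv (fun r => S.q x r) t

/-- The boundary value at `x → +∞`. -/
def qPlus : Fin 2 → ℂ := Complex.exp (Complex.I * S.phasePlus) • S.c

/-- The boundary value at `x → -∞`. -/
def qMinus : Fin 2 → ℂ := Complex.exp (Complex.I * S.phaseMinus) • S.c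

/-- The Euclidean norm `q₀` of the background vector. -/
def q0 : ℝ := Real.sqrt (‖S.c 0‖ ^ 2 + ‖S.c 1‖ ^ 2)

/-- `S` is a classical solution of the coupled mKdV equation
`q_t + q_xxx + 3 (q†q) q_x + 3 (q†q_x) q = 0` with nonzero boundary conditions. For real `u`, `v` the
first component of the equation reads `u_t + u_xxx + 6u²u_x + 3v²u_x + 3uvv_x = 0`, and the second
is the same with `u` and `v` exchanged. -/
structure IsSolution : Prop where
  smooth : ContDiff ℝ 3 (fun p : ℝ × ℝ => S.q p.1 p.2)
  equation : ∀ x t, S.qt x t + S.qxxx x t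
      + (3 * (star (S.q x t) ⬝ᵥ S.q x t)) • S.qx x t
      + (3 * (star (S.q x t) ⬝ᵥ S.qx x t)) • S.q x t = 0
  q0_pos : 0 < S.q0
  tendsto_plus : ∀ t, Tendsto (fun x => S.q x t) atTop (𝓝 S.qPlus)
  tendsto_minus : ∀ t, Tendsto (fun x => S.q x t) atBot (𝓝 S.qMinus)
  tendsto_qx_plus : ∀ t, Tendsto (fun x => S.qx x t) atTop (𝓝 0)
  tendsto_qx_minus : ∀ t, Tendsto (fun x => S.qx x t) atBot (𝓝 0)
  tendsto_qxx_plus : ∀ t, Tendsto (fun x => S.qxx x t) atTop (𝓝 0)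
  tendsto_qxx_minus : ∀ t, Tendsto (fun x => S.qxx x t) atBot (𝓝 0)
  bounded : ∀ T : ℝ, ∃ C : ℝ, ∀ x t : ℝ, |t| ≤ T →
    ‖S.q x t‖ ≤ C ∧ ‖S.qx x t‖ ≤ C ∧ ‖S.qxx x t‖ ≤ C
  integrable_plus : ∀ t a : ℝ,
    MeasureTheory.IntegrableOn (fun x => S.q x t - S.qPlus) (Set.Ioi a)
  integrable_minus : ∀ t a : ℝ,
    MeasureTheory.IntegrableOn (fun x => S.q x t - S.qMinus) (Set.Iio a)

/-! Uniformization, phases and regions. -/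

def k (z : ℂ) : ℂ := (z - (S.q0 : ℂ) ^ 2 / z) / 2

def lam (z : ℂ) : ℂ := (z + (S.q0 : ℂ) ^ 2 / z) / 2

def theta1 (x t : ℝ) (z : ℂ) : ℂ :=
  S.lam z * (x + 2 * (2 * S.k z ^ 2 - (S.q0 : ℂ) ^ 2) * t)

def theta2 (x t : ℝ) (z : ℂ) : ℂ := S.k z * (x + 4 * S.k z ^ 2 * t)

/-- The diagonal entries `θ₁, θ₂, -θ₁` of the phase matrix. -/
def theta (j : Fin 3) (x t : ℝ) (z : ℂ) : ℂ :=
  ![S.theta1 x t z, S.theta2 x t z, -S.theta1 x t z] j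

def D1 : Set ℂ := {z | S.q0 < ‖z‖ ∧ 0 < z.im}
def D2 : Set ℂ := {z | S.q0 < ‖z‖ ∧ z.im < 0}
def D3 : Set ℂ := {z | ‖z‖ < S.q0 ∧ z.im < 0}
def D4 : Set ℂ := {z | ‖z‖ < S.q0 ∧ 0 < z.im}

/-- The reflected point `-q₀²/z`. -/
def refl (z : ℂ) : ℂ := -(S.q0 : ℂ) ^ 2 / z

/-! The Lax pair `Φ_x = U Φ`, `Φ_t = V Φ`. -/

def U (x t : ℝ) (z : ℂ) : Matrix (Fin 3) (Fin 3) ℂ :=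
  (Complex.I * S.k z) • sigmaThree + blockQ (S.q x t)

def V (x t : ℝ) (z : ℂ) : Matrix (Fin 3) (Fin 3) ℂ :=
  (4 * Complex.I * S.k z ^ 3) • sigmaThree + (4 * S.k z ^ 2) • blockQ (S.q x t)
    - (2 * Complex.I * S.k z) • (sigmaThree * (blockQ (S.qx x t) - blockQ (S.q x t) ^ 2))
    + (2 : ℂ) • blockQ (S.q x t) ^ 3 - blockQ (S.qxx x t)
    + (blockQ (S.qx x t) * blockQ (S.q x t) - blockQ (S.q x t) * blockQ (S.qx x t))

/-- The eigenvector matrix `Γ(z)` for the boundary value `w`; its middle column is built from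
`w^⊥ = (w₂^*, -w₁^*)ᵀ`. -/
def Gam (w : Fin 2 → ℂ) (z : ℂ) : Matrix (Fin 3) (Fin 3) ℂ :=
  !![w 0 / S.q0, conj (w 1) / S.q0, Complex.I * w 0 / z;
     w 1 / S.q0, -conj (w 0) / S.q0, Complex.I * w 1 / z;
     Complex.I * S.q0 / z, 0, 1]

/-- `φ(x,t)` is the `j`-th Jost solution at `z` for the end `l` of the line with boundary value `w`:
a simultaneous solution of the Lax pair with `φ e^{-iθ_j} → Γ_j(z)` as `x → l`. -/
def IsJost (l : Filter ℝ) (w : Fin 2 → ℂ) (j : Fin 3) (z : ℂ) (φ : ℝ → ℝ → Fin 3 → ℂ) : Prop :=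
  (∀ x t, HasDerivAt (fun y => φ y t) (S.U x t z *ᵥ φ x t) x) ∧
  (∀ x t, HasDerivAt (fun r => φ x r) (S.V x t z *ᵥ φ x t) t) ∧
  ∀ t, Tendsto (fun x => Complex.exp (-Complex.I * S.theta j x t z) • φ x t) l
    (𝓝 (fun i => S.Gam w z i j))

open Classical in
/-- The Jost solution (zero if there is none). It is unique, and it is used, only for real
`z ≠ 0` and in the region of analyticity of the column in question. -/
def jost (l : Filter ℝ) (w : Fin 2 → ℂ) (j : Fin 3) (z : ℂ) : ℝ → ℝ → Fin 3 → ℂ :=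
  if h : ∃ φ, S.IsJost l w j z φ then h.choose else 0

/-- The column `Φ_{+,j+1}(x,t,z)` (columns are indexed from `0`). Analytic in `z` for `j = 0` on
`D₃`, for `j = 1` on `Im z > 0`, for `j = 2` on `D₂`. -/
def PhiP (j : Fin 3) (x t : ℝ) (z : ℂ) : Fin 3 → ℂ := S.jost atTop S.qPlus j z x t

/-- The column `Φ_{-,j+1}(x,t,z)` (columns are indexed from `0`). Analytic in `z` for `j = 0` on
`D₄`, for `j = 1` on `Im z < 0`, for `j = 2` on `D₁`. -/
def PhiM (j : Fin 3) (x t : ℝ) (z : ℂ) : Fin 3 → ℂ := S.jost atBot S.qMinus j z x t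

/-- The modified columns `μ_{±,j+1} = Φ_{±,j+1} e^{-iθ_j}`. -/
def muP (j : Fin 3) (x t : ℝ) (z : ℂ) : Fin 3 → ℂ :=
  Complex.exp (-Complex.I * S.theta j x t z) • S.PhiP j x t z

def muM (j : Fin 3) (x t : ℝ) (z : ℂ) : Fin 3 → ℂ :=
  Complex.exp (-Complex.I * S.theta j x t z) • S.PhiM j x t z

/-- The Jost solutions of the adjoint Lax pair, whose coefficient matrices are the complex
conjugates of `U` and `V` at `z^*`, normalized by `conj Γ_±(z^*) e^{-iΘ}`. -/
def adjP (j : Fin 3) (x t : ℝ) (z : ℂ) : Fin 3 → ℂ := star (S.PhiP j x t (conj z))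

def adjM (j : Fin 3) (x t : ℝ) (z : ℂ) : Fin 3 → ℂ := star (S.PhiM j x t (conj z))

/-! The auxiliary eigenfunctions `χ₁, …, χ₄` (on `D₁, …, D₄`) and their modifications. -/

def chi1 (x t : ℝ) (z : ℂ) : Fin 3 → ℂ :=
  Complex.exp (Complex.I * S.theta2 x t z) • crossProduct (S.adjM 1 x t z) (S.adjP 2 x t z)
def chi2 (x t : ℝ) (z : ℂ) : Fin 3 → ℂ :=
  Complex.exp (Complex.I * S.theta2 x t z) • crossProduct (S.adjP 1 x t z) (S.adjM 2 x t z)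
def chi3 (x t : ℝ) (z : ℂ) : Fin 3 → ℂ :=
  Complex.exp (Complex.I * S.theta2 x t z) • crossProduct (S.adjM 0 x t z) (S.adjP 1 x t z)
def chi4 (x t : ℝ) (z : ℂ) : Fin 3 → ℂ :=
  Complex.exp (Complex.I * S.theta2 x t z) • crossProduct (S.adjP 0 x t z) (S.adjM 1 x t z)

def m1 (x t : ℝ) (z : ℂ) : Fin 3 → ℂ :=
  Complex.exp (-Complex.I * S.theta1 x t z) • S.chi1 x t z
def m2 (x t : ℝ) (z : ℂ) : Fin 3 → ℂ :=
  Complex.exp (-Complex.I * S.theta1 x t z) • S.chi2 x t z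
def m3 (x t : ℝ) (z : ℂ) : Fin 3 → ℂ :=
  Complex.exp (Complex.I * S.theta1 x t z) • S.chi3 x t z
def m4 (x t : ℝ) (z : ℂ) : Fin 3 → ℂ :=
  Complex.exp (Complex.I * S.theta1 x t z) • S.chi4 x t z

/-! Scattering data. -/

/-- The scattering matrix at real `z ≠ 0`, given by `Φ_-(x,t,z) = Φ_+(x,t,z) A(z)`; as `A` depends
neither on `x` nor on `t`, it is read off at `x = t = 0`. -/
def A (z : ℂ) : Matrix (Fin 3) (Fin 3) ℂ :=
  (colMatrix (S.PhiP 0 0 0 z) (S.PhiP 1 0 0 z) (S.PhiP 2 0 0 z))⁻¹ *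
    colMatrix (S.PhiM 0 0 0 z) (S.PhiM 1 0 0 z) (S.PhiM 2 0 0 z)

def B (z : ℂ) : Matrix (Fin 3) (Fin 3) ℂ := (S.A z)⁻¹

/-- The parts of the real axis outside and inside the circle of radius `q₀`, and both together. -/
def realOut : Set ℂ := {z | z.im = 0 ∧ S.q0 < ‖z‖}
def realIn : Set ℂ := {z | z.im = 0 ∧ 0 < ‖z‖ ∧ ‖z‖ < S.q0}
def realPunctured : Set ℂ := {z | z.im = 0 ∧ z ≠ 0}

/-! The diagonal scattering coefficients, continued analytically off the real axis. -/

def a11 : ℂ → ℂ := analyticContinuation S.D4 S.realIn (fun z => S.A z 0 0)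
def a22 : ℂ → ℂ := analyticContinuation {z | z.im < 0} realPunctured (fun z => S.A z 1 1)
def a33 : ℂ → ℂ := analyticContinuation S.D1 S.realOut (fun z => S.A z 2 2)
def b11 : ℂ → ℂ := analyticContinuation S.D3 S.realIn (fun z => S.B z 0 0)
def b22 : ℂ → ℂ := analyticContinuation {z | 0 < z.im} realPunctured (fun z => S.B z 1 1)
def b33 : ℂ → ℂ := analyticContinuation S.D2 S.realOut (fun z => S.B z 2 2)

/-! The sectionally meromorphic matrices `M^+` (on `D₁ ∪ D₃`) and `M^-` (on `D₂ ∪ D₄`). -/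

open Classical in
def Mplus (x t : ℝ) (z : ℂ) : Matrix (Fin 3) (Fin 3) ℂ :=
  if z ∈ S.D1 then
    colMatrix ((S.b22 z)⁻¹ • S.m1 x t z) (S.muP 1 x t z) ((S.a33 z)⁻¹ • S.muM 2 x t z)
  else if z ∈ S.D3 then
    colMatrix (S.muP 0 x t z) ((S.a22 z)⁻¹ • S.muM 1 x t z) ((S.b11 z)⁻¹ • S.m3 x t z)
  else 0

open Classical in
def Mminus (x t : ℝ) (z : ℂ) : Matrix (Fin 3) (Fin 3) ℂ :=
  if z ∈ S.D2 then
    colMatrix ((S.b33 z)⁻¹ • S.m2 x t z) ((S.a22 z)⁻¹ • S.muM 1 x t z) (S.muP 2 x t z)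
  else if z ∈ S.D4 then
    colMatrix ((S.a11 z)⁻¹ • S.muM 0 x t z) (S.muP 1 x t z) ((S.b22 z)⁻¹ • S.m4 x t z)
  else 0

/-- The columns of `M^±`. -/
def colPlus (j : Fin 3) (x t : ℝ) (z : ℂ) : Fin 3 → ℂ := fun i => S.Mplus x t z i j
def colMinus (j : Fin 3) (x t : ℝ) (z : ℂ) : Fin 3 → ℂ := fun i => S.Mminus x t z i j

/-! The three types of (simple) discrete eigenvalues. -/

structure IsFirstType (z : ℂ) : Prop where
  mem : z ∈ S.D1
  a33_zero : S.a33 z = 0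
  a33_simple : deriv S.a33 z ≠ 0
  b22_ne : S.b22 z ≠ 0

structure IsSecondType (z : ℂ) : Prop where
  mem : z ∈ S.D1
  a33_ne : S.a33 z ≠ 0
  b22_zero : S.b22 z = 0
  b22_simple : deriv S.b22 z ≠ 0

/-- At a common zero of `a33` and `b22`, the auxiliary eigenfunctions `χ₁(z)` and `χ₂(z^*)` are also
required to vanish: without this the columns `Φ_{-,3}(z)` and `Φ_{+,2}(z)`, or `Φ_{-,2}(z^*)` and
`Φ_{+,3}(z^*)`, may be linearly independent, so that the norming constants do not exist. -/
structure IsThirdType (z : ℂ) : Prop where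
  mem : z ∈ S.D1
  a33_zero : S.a33 z = 0
  a33_simple : deriv S.a33 z ≠ 0
  b22_zero : S.b22 z = 0
  b22_simple : deriv S.b22 z ≠ 0
  chi1_zero : ∀ x t, S.chi1 x t z = 0
  chi2_zero : ∀ x t, S.chi2 x t (conj z) = 0

end Potential

end

/-! The core is linear algebra in ℂ³ at a point `z` of `D₁`, carried to `z^*`, `-q₀²/z^*` and
`-q₀²/z` by symmetry. The analysis supplies the vectors and the scattering coefficients, with the
analyticity that residues need.

Lax pair. Its compatibility condition is the mKdV equation, so there is a fundamental matrix
`F(x,t,k)`, equal to `1` at the origin, entire in `k`, with `F(k^*)† F(k) = 1`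
(`exists_isFundamental`). Every simultaneous solution is `F` times a constant vector
(`eq_fundamental_mulVec`). A linear relation between solutions at the same `k` is therefore a
relation between vectors at `x = t = 0`, and its coefficients do not depend on `x` and `t`.

Jost solutions. The initial vector of `Φ_{±,j}` is a limit: `Γ_j` is placed far out on the line,
propagated back to the origin, and stripped of its exponential. This converges because `q - q_±` is
integrable and normalized backward propagation is bounded (`BackwardStable`); the convergence is
locally uniform in `z`, which gives continuity up to the real axis and holomorphy inside
(`exists_jostVector`). The bound is an energy estimate, proved for the second and third columns. The
first column is the reflection of the third under `z ↦ -q₀²/z`, which keeps `k` and changes the sign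
of `λ`. The asymptotics at other times follow from the `t`-equation (`tendsto_time`).

Scattering data. The pairing of a solution at `z^*`, conjugated, with a solution at `z` is constant
in `x` and `t`, and can be evaluated at the end of the line. For real `z` it shows that the columns
of `Φ_±` are orthogonal, so the diagonal entries of `A` and `B` are pairings of `Φ_{+,j}` and
`Φ_{-,j}` divided by `γ_j` (`coeff`). These formulas are holomorphic in the required regions, hence
are the continuations (`analyticContinuation_coeff`). Conjugation and reflection then relate `a₃₃,
b₃₃, a₁₁, b₁₁` at the four points, and likewise `b₂₂` and `a₂₂`, so that simple zeros are shared.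

Eigenvalues. At `z ∈ D₁` and `x = t = 0`, let `a` and `b` be the conjugates of `Φ_{-,2}(z^*)` and
`Φ_{+,3}(z^*)`, and let `p = Φ_{+,2}(z)`, `n = Φ_{-,3}(z)`. Always `a·n = b·p = 0`; up to nonzero
factors `a₃₃` is `b·n` and `b₂₂` is `a·p`; `χ₁(z)` comes from `a × b` and `χ₂(z^*)` from the
conjugate of `p × n`. In the first type `n ⊥ a, b` and `b ⊥ p, n`; in the second `p ⊥ a, b` and `a ⊥
p, n`; the coefficient that does not vanish makes both cross products nonzero, so the orthogonal
vectors are multiples of them. In the third type both cross products vanish by assumption, that is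
`a ∥ b` and `p ∥ n`. At a simple zero of the denominator the residue of a column is its numerator
divided by the derivative, and the proportionalities rewrite it in the stated form. -/

noncomputable section

/-! ### Linear differential equations in a Banach algebra, and dependence on a parameter. -/

section LinearODE

open Set

variable {𝔸 : Type*} [NormedRing 𝔸] [NormedAlgebra ℝ 𝔸]

/-- The terms of the Dyson series of the linear equation `Y' = N Y`, `Y 0 = 1`. -/
def dysonTerm (N : ℝ → 𝔸) : ℕ → ℝ → 𝔸
  | 0 => fun _ => 1
  | n + 1 => fun s => ∫ r in (0 : ℝ)..s, N r * dysonTerm N n r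

lemma continuous_dysonTerm {N : ℝ → 𝔸} (hN : Continuous N) (n : ℕ) :
    Continuous (dysonTerm N n) := by
  induction n with
  | zero => exact continuous_const
  | succ n ih =>
    exact intervalIntegral.continuous_primitive (μ := MeasureTheory.volume)
      (fun a b => (hN.mul ih).intervalIntegrable a b) 0

lemma hasDerivAt_dysonTerm_succ [CompleteSpace 𝔸] {N : ℝ → 𝔸} (hN : Continuous N) (n : ℕ) (s : ℝ) :
    HasDerivAt (dysonTerm N (n + 1)) (N s * dysonTerm N n s) s :=
  (hN.mul (continuous_dysonTerm hN n)).integral_hasStrictDerivAt 0 s |>.hasDerivAt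

/-- Integrating `C (C|r|)ⁿ / n!` from `0` to `s` raises the power and supplies the next factorial,
so the Dyson series is dominated by an exponential series. -/
lemma norm_dysonTerm_le {N : ℝ → 𝔸} {C L : ℝ} (hC : ∀ s, |s| ≤ L → ‖N s‖ ≤ C) (n : ℕ) (s : ℝ)
    (hs : |s| ≤ L) : ‖dysonTerm N n s‖ ≤ ‖(1 : 𝔸)‖ * ((C * |s|) ^ n / n.factorial) := by
  have hC0 : 0 ≤ C := (norm_nonneg _).trans (hC s hs)
  induction n generalizing s with
  | zero => simp [dysonTerm]
  | succ n ih =>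
    calc ‖dysonTerm N (n + 1) s‖
        ≤ ∫ r in uIoc 0 s, C * (‖(1 : 𝔸)‖ * ((C * |r|) ^ n / n.factorial)) := by
          rw [dysonTerm, intervalIntegral.norm_intervalIntegral_eq]
          apply MeasureTheory.norm_integral_le_of_norm_le
            (Continuous.integrableOn_uIoc (by fun_prop))
          filter_upwards [MeasureTheory.ae_restrict_mem measurableSet_uIoc] with r hr
          have hr' : |r| ≤ |s| := by
            have := abs_sub_left_of_mem_uIcc (uIoc_subset_uIcc hr)
            simpa using this
          exact (norm_mul_le _ _).trans (mul_le_mul (hC r (hr'.trans hs)) (ih r (hr'.trans hs))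
            (norm_nonneg _) hC0)
      _ = ∫ r in uIoc 0 s, (C ^ (n + 1) * ‖(1 : 𝔸)‖ / n.factorial) * |r - 0| ^ n := by
          congr 1; ext r; rw [sub_zero, mul_pow]; ring
      _ = ‖(1 : 𝔸)‖ * ((C * |s|) ^ (n + 1) / (n + 1).factorial) := by
          rw [MeasureTheory.integral_const_mul, integral_pow_abs_sub_uIoc, sub_zero,
            Nat.factorial_succ, mul_pow]
          push_cast
          field_simp

lemma exists_norm_le_of_continuous {E : Type*} [SeminormedAddCommGroup E] {f : ℝ → E}
    (hf : Continuous f) (L : ℝ) : ∃ C, 0 ≤ C ∧ ∀ s, |s| ≤ L → ‖f s‖ ≤ C := by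
  obtain ⟨C, hC⟩ := (isCompact_Icc (a := -L) (b := L)).exists_bound_of_continuousOn hf.continuousOn
  exact ⟨max C 0, le_max_right _ _, fun s hs => (hC s (abs_le.1 hs)).trans (le_max_left _ _)⟩

/-- A linear equation with continuous coefficients has a global fundamental solution. -/
theorem exists_fundamental [CompleteSpace 𝔸] {N : ℝ → 𝔸} (hN : Continuous N) :
    ∃ Y : ℝ → 𝔸, Y 0 = 1 ∧ ∀ s, HasDerivAt Y (N s * Y s) s := by
  have hsum : ∀ s, Summable fun n => dysonTerm N n s := fun s => by
    obtain ⟨C, -, hC⟩ := exists_norm_le_of_continuous hN |s|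
    exact Summable.of_norm_bounded ((Real.summable_pow_div_factorial _).mul_left _)
      fun n => norm_dysonTerm_le hC n s le_rfl
  have h0 : ∀ n, dysonTerm N (n + 1) 0 = 0 := fun n => by simp [dysonTerm]
  refine ⟨fun s => 1 + ∑' n, dysonTerm N (n + 1) s, by simp [h0], fun s => ?_⟩
  obtain ⟨C, hC0, hC⟩ := exists_norm_le_of_continuous hN (|s| + 1)
  have hmem : ∀ {y : ℝ}, y ∈ Ioo (-(|s| + 1)) (|s| + 1) → |y| ≤ |s| + 1 := fun hy =>
    (abs_lt.2 hy).le
  have key := hasDerivAt_tsum_of_isPreconnected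
    (g := fun n => dysonTerm N (n + 1)) (g' := fun n y => N y * dysonTerm N n y)
    (u := fun n => C * (‖(1 : 𝔸)‖ * ((C * (|s| + 1)) ^ n / n.factorial))) (y₀ := 0) (y := s)
    (((Real.summable_pow_div_factorial _).mul_left _).mul_left _) isOpen_Ioo
    (isPreconnected_Ioo (a := -(|s| + 1)) (b := |s| + 1))
    (fun n y _ => hasDerivAt_dysonTerm_succ hN n y)
    (fun n y hy => ?_) ⟨by linarith [abs_nonneg s], by linarith [abs_nonneg s]⟩ (by simp [h0])
    ⟨by linarith [neg_abs_le s], by linarith [le_abs_self s]⟩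
  · have e : N s * (1 + ∑' n, dysonTerm N (n + 1) s) = ∑' n, N s * dysonTerm N n s := by
      rw [(hsum s).tsum_mul_left, (hsum s).tsum_eq_zero_add]; rfl
    rw [e]
    exact key.const_add 1
  · refine (norm_mul_le _ _).trans (mul_le_mul (hC y (hmem hy)) ?_ (norm_nonneg _) hC0)
    refine (norm_dysonTerm_le hC n y (hmem hy)).trans ?_
    gcongr
    exact hmem hy

/-- Differentiability of the solution of a linear equation in a parameter, at later times. -/
lemma isLittleO_param_of_nonneg {𝕜 : Type*} [RCLike 𝕜] [NormedAlgebra 𝕜 𝔸] {N : 𝕜 → ℝ → 𝔸}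
    {N' : ℝ → 𝔸} {y : 𝕜 → ℝ → 𝔸} {η : ℝ → 𝔸} {p₀ : 𝕜} {t : ℝ} (ht : 0 ≤ t)
    (hN : Continuous (N p₀)) (hN' : Continuous N')
    (hd : ∀ ε > 0, ∀ᶠ p in 𝓝 p₀, ∀ s ∈ Icc 0 t, ‖N p s - N p₀ s - (p - p₀) • N' s‖ ≤ ε * ‖p - p₀‖)
    (hy : ∀ p s, HasDerivAt (y p) (N p s * y p s) s)
    (hη : ∀ s, HasDerivAt η (N p₀ s * η s + N' s * y p₀ s) s)
    (h0 : HasDerivAt (fun p => y p 0) (η 0) p₀) :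
    HasDerivAt (fun p => y p t) (η t) p₀ := by
  have hyc : Continuous (y p₀) := continuous_iff_continuousAt.2 fun s => (hy p₀ s).continuousAt
  have hηc : Continuous η := continuous_iff_continuousAt.2 fun s => (hη s).continuousAt
  obtain ⟨A, hA0, hA⟩ := exists_norm_le_of_continuous hN t
  obtain ⟨A', hA'0, hA'⟩ := exists_norm_le_of_continuous hN' t
  obtain ⟨M, hM0, hM⟩ := exists_norm_le_of_continuous hyc t
  obtain ⟨M', hM'0, hM'⟩ := exists_norm_le_of_continuous hηc t
  rw [hasDerivAt_iff_isLittleO, Asymptotics.isLittleO_iff] at h0 ⊢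
  intro c hc
  -- Once `‖p - p₀‖ ≤ ε ≤ 1`, the increment `N p - N p₀` is at most `K ‖p - p₀‖`, and `N p` is at
  -- most `K + K`. The bound on `ε` below is `c` divided by the factor that Gronwall's inequality
  -- produces from these constants.
  set K := A + A' + 2 with hK
  have hK1 : 1 ≤ K := by linarith
  set ε := min 1 (c / ((1 + M + K * M') * Real.exp ((K + K) * t))) with hε
  have hD : 0 < (1 + M + K * M') * Real.exp ((K + K) * t) := by positivity
  have hε0 : 0 < ε := lt_min one_pos (div_pos hc hD)
  have hε1 : ε ≤ 1 := min_le_left _ _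
  have hεc : ε * ((1 + M + K * M') * Real.exp ((K + K) * t)) ≤ c :=
    (le_div_iff₀ hD).1 (min_le_right _ _)
  filter_upwards [h0 hε0, hd ε hε0, Metric.ball_mem_nhds p₀ hε0] with p hp0 hp hpb
  have hpε : ‖p - p₀‖ ≤ ε := by rw [← dist_eq_norm]; exact (Metric.mem_ball.1 hpb).le
  set h := ‖p - p₀‖ with hh
  have hhn : 0 ≤ h := norm_nonneg _
  -- The remainder of the first-order expansion solves the same linear equation with a forcing of
  -- size `ε ‖p - p₀‖`, so Gronwall's inequality makes it `o(‖p - p₀‖)`.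
  set r : ℝ → 𝔸 := fun s => y p s - y p₀ s - (p - p₀) • η s with hr
  have hrd : ∀ s, HasDerivAt r (N p s * r s + ((N p s - N p₀ s - (p - p₀) • N' s) * y p₀ s
      + (p - p₀) • ((N p s - N p₀ s) * η s))) s := fun s => by
    refine (((hy p s).sub (hy p₀ s)).sub ((hη s).const_smul (p - p₀))).congr_deriv ?_
    simp only [hr, mul_sub, sub_mul, smul_add, smul_sub, mul_smul_comm, smul_mul_assoc]
    abel
  have habs : ∀ {s : ℝ}, s ∈ Icc 0 t → |s| ≤ t := fun hs => by rw [abs_of_nonneg hs.1]; exact hs.2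
  have hdiff : ∀ s ∈ Icc 0 t, ‖N p s - N p₀ s‖ ≤ K * h := fun s hs => by
    have h1 : N p s - N p₀ s = (N p s - N p₀ s - (p - p₀) • N' s) + (p - p₀) • N' s := by abel
    rw [h1]
    refine (norm_add_le _ _).trans ?_
    rw [norm_smul]
    nlinarith [hp s hs, hA' s (habs hs), mul_le_mul_of_nonneg_left (hA' s (habs hs)) hhn,
      mul_le_mul_of_nonneg_right hε1 hhn, mul_nonneg hA0 hhn]
  have hNp : ∀ s ∈ Icc 0 t, ‖N p s‖ ≤ K + K := fun s hs => by
    have h1 : N p s = (N p s - N p₀ s) + N p₀ s := by abel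
    rw [h1]
    refine (norm_add_le _ _).trans (add_le_add ((hdiff s hs).trans ?_) ?_)
    · nlinarith
    · exact (hA s (habs hs)).trans (by linarith)
  have hf : ∀ s ∈ Icc 0 t, ‖(N p s - N p₀ s - (p - p₀) • N' s) * y p₀ s
      + (p - p₀) • ((N p s - N p₀ s) * η s)‖ ≤ ε * h * (M + K * M') := fun s hs => by
    refine (norm_add_le _ _).trans ?_
    rw [mul_add]
    refine add_le_add ?_ ?_
    · exact (norm_mul_le _ _).trans (mul_le_mul (hp s hs) (hM s (habs hs)) (norm_nonneg _)
        (by positivity))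
    · rw [norm_smul]
      calc h * ‖(N p s - N p₀ s) * η s‖ ≤ h * ((K * h) * M') := by
            gcongr
            exact (norm_mul_le _ _).trans (mul_le_mul (hdiff s hs) (hM' s (habs hs))
              (norm_nonneg _) (by positivity))
        _ ≤ h * ((K * ε) * M') := by gcongr
        _ = ε * h * (K * M') := by ring
  have hgr := norm_le_gronwallBound_of_norm_deriv_right_le (f := r) (a := 0) (b := t)
    (δ := ε * h) (K := K + K) (ε := ε * h * (M + K * M'))
    (fun s _ => (hrd s).continuousAt.continuousWithinAt) (fun s _ => (hrd s).hasDerivWithinAt)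
    (by simpa [hr] using hp0)
    (fun s hs => by
      have hs' : s ∈ Icc 0 t := ⟨hs.1, hs.2.le⟩
      refine (norm_add_le _ _).trans (add_le_add ((norm_mul_le _ _).trans ?_) (hf s hs'))
      exact mul_le_mul_of_nonneg_right (hNp s hs') (norm_nonneg _)) t ⟨ht, le_rfl⟩
  rw [gronwallBound_of_K_ne_0 (by positivity), sub_zero] at hgr
  refine hgr.trans ?_
  have hE : 1 ≤ Real.exp ((K + K) * t) := Real.one_le_exp (by positivity)
  have hdiv : ε * h * (M + K * M') / (K + K) ≤ ε * h * (M + K * M') :=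
    div_le_self (by positivity) (by linarith)
  calc ε * h * Real.exp ((K + K) * t)
        + ε * h * (M + K * M') / (K + K) * (Real.exp ((K + K) * t) - 1)
      ≤ ε * h * Real.exp ((K + K) * t)
        + ε * h * (M + K * M') * (Real.exp ((K + K) * t)) := by
        gcongr
        linarith
    _ = (ε * ((1 + M + K * M') * Real.exp ((K + K) * t))) * h := by ring
    _ ≤ c * h := by gcongr

/-- Differentiability of the solution of a linear equation in a parameter. -/
theorem hasDerivAt_param {𝕜 : Type*} [RCLike 𝕜] [NormedAlgebra 𝕜 𝔸] {N N' : 𝕜 → ℝ → 𝔸}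
    {y : 𝕜 → ℝ → 𝔸} {η : ℝ → 𝔸} {p₀ : 𝕜}
    (hN : Continuous (N p₀)) (hN' : Continuous (Function.uncurry N'))
    (hd : ∀ p s, HasDerivAt (fun p => N p s) (N' p s) p)
    (hy : ∀ p s, HasDerivAt (y p) (N p s * y p s) s)
    (hη : ∀ s, HasDerivAt η (N p₀ s * η s + N' p₀ s * y p₀ s) s)
    (h0 : HasDerivAt (fun p => y p 0) (η 0) p₀) (t : ℝ) :
    HasDerivAt (fun p => y p t) (η t) p₀ := by
  -- Differentiability in `p` is uniform in `s` on compact intervals: by compactness `N' p s` is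
  -- close to `N' p₀ s` for all such `s` at once, and the mean value inequality applies to `p ↦ N p
  -- s - p • N' p₀ s`.
  have hunif : ∀ a b : ℝ, ∀ ε > 0, ∀ᶠ p in 𝓝 p₀, ∀ s ∈ Icc a b,
      ‖N p s - N p₀ s - (p - p₀) • N' p₀ s‖ ≤ ε * ‖p - p₀‖ := fun a b ε hε => by
    have h1 : ∀ᶠ p in 𝓝 p₀, ∀ s ∈ Icc a b, ‖N' p s - N' p₀ s‖ < ε := by
      refine isCompact_Icc.eventually_forall_of_forall_eventually fun s _ => ?_
      have hc : Continuous fun z : 𝕜 × ℝ => ‖N' z.1 z.2 - N' p₀ z.2‖ :=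
        (hN'.sub (hN'.comp (continuous_const.prodMk continuous_snd))).norm
      exact hc.tendsto (p₀, s) |>.eventually_lt_const (by simpa using hε)
    obtain ⟨δ, hδ, hb⟩ := Metric.eventually_nhds_iff_ball.1 h1
    filter_upwards [Metric.ball_mem_nhds p₀ hδ] with p hp s hs
    have hg : ∀ x ∈ Metric.ball p₀ δ, HasDerivWithinAt (fun p => N p s - p • N' p₀ s)
        (N' x s - N' p₀ s) (Metric.ball p₀ δ) x := fun x _ => by
      have := ((hd x s).sub ((hasDerivAt_id x).smul_const (N' p₀ s))).hasDerivWithinAt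
        (s := Metric.ball p₀ δ)
      rwa [one_smul] at this
    have := (convex_ball p₀ δ).norm_image_sub_le_of_norm_hasDerivWithin_le hg
      (fun x hx => (hb x hx s hs).le) (Metric.mem_ball_self hδ) hp
    have e : N p s - N p₀ s - (p - p₀) • N' p₀ s
        = N p s - p • N' p₀ s - (N p₀ s - p₀ • N' p₀ s) := by rw [sub_smul]; abel
    rwa [e]
  have hN'c : Continuous (N' p₀) := hN'.comp (continuous_const.prodMk continuous_id)
  rcases le_total 0 t with ht | ht
  · exact isLittleO_param_of_nonneg ht hN hN'c (hunif 0 t) hy hη h0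
  -- Negative times follow by reversing time, which replaces `N` by `-N (-s)`.
  · have hneg : ∀ {f : ℝ → 𝔸} {f' : 𝔸} {s : ℝ}, HasDerivAt f f' (-s) →
        HasDerivAt (fun s => f (-s)) (-f') s := fun {f f' s} hf => by
      have := hf.scomp s (hasDerivAt_neg s)
      rwa [neg_smul, one_smul] at this
    have := isLittleO_param_of_nonneg (N := fun p s => -N p (-s)) (N' := fun s => -N' p₀ (-s))
      (y := fun p s => y p (-s)) (η := fun s => η (-s)) (p₀ := p₀) (t := -t) (neg_nonneg.2 ht)
      (hN.comp continuous_neg).neg (hN'c.comp continuous_neg).neg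
      (fun ε hε => (hunif t 0 ε hε).mono fun p hp s hs => by
        have := hp (-s) ⟨by linarith [hs.2], by linarith [hs.1]⟩
        have e : -N p (-s) - -N p₀ (-s) - (p - p₀) • -N' p₀ (-s)
            = -(N p (-s) - N p₀ (-s) - (p - p₀) • N' p₀ (-s)) := by rw [smul_neg]; abel
        rwa [e, norm_neg])
      (fun p s => by simpa using hneg (hy p (-s)))
      (fun s => (hneg (hη (-s))).congr_deriv (by rw [neg_mul, neg_mul]; abel))
      (by simpa using h0)
    simpa using this

end LinearODE

/-! ### Fundamental matrices, their inverses and their holomorphy in a parameter. -/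

section MatrixODE

open scoped Matrix.Norms.Operator

variable {n : Type*} [Fintype n]

lemma hasDerivAt_matrix {𝕜 : Type*} [NontriviallyNormedField 𝕜] [NormedAlgebra 𝕜 ℂ]
    {f : 𝕜 → Matrix n n ℂ} {f' : Matrix n n ℂ} {s : 𝕜} :
    HasDerivAt f f' s ↔ ∀ i j, HasDerivAt (fun s => f s i j) (f' i j) s :=
  (hasDerivAt_pi (φ := fun s i => f s i)).trans (forall_congr' fun _ => hasDerivAt_pi)

lemma HasDerivAt.matrix_transpose {f : ℝ → Matrix n n ℂ} {f' : Matrix n n ℂ} {s : ℝ}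
    (hf : HasDerivAt f f' s) : HasDerivAt (fun s => (f s)ᵀ) f'ᵀ s :=
  hasDerivAt_matrix.2 fun i j => hasDerivAt_matrix.1 hf j i

lemma HasDerivAt.matrix_mulVec {𝕜 : Type*} [NontriviallyNormedField 𝕜] [NormedAlgebra 𝕜 ℂ]
    {f : 𝕜 → Matrix n n ℂ} {f' : Matrix n n ℂ} {g : 𝕜 → n → ℂ}
    {g' : n → ℂ} {s : 𝕜} (hf : HasDerivAt f f' s) (hg : HasDerivAt g g' s) :
    HasDerivAt (fun s => f s *ᵥ g s) (f' *ᵥ g s + f s *ᵥ g') s := by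
  rw [hasDerivAt_matrix] at hf
  rw [hasDerivAt_pi] at hg ⊢
  intro i
  have := HasDerivAt.fun_sum (u := Finset.univ) fun j _ => (hf i j).mul (hg j)
  refine this.congr_deriv ?_
  simp [mulVec, dotProduct, Finset.sum_add_distrib]

/-- Fundamental matrix of a linear system, together with its inverse. -/
theorem exists_fundamental_matrix [DecidableEq n] {N : ℝ → Matrix n n ℂ} (hN : Continuous N) :
    ∃ Y W : ℝ → Matrix n n ℂ, Y 0 = 1 ∧ (∀ s, HasDerivAt Y (N s * Y s) s) ∧
      (∀ s, HasDerivAt W (-(W s * N s)) s) ∧ (∀ s, W s * Y s = 1) ∧ ∀ s, Y s * W s = 1 := by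
  obtain ⟨Y, hY0, hY⟩ := exists_fundamental hN
  -- The inverse is the transpose of the fundamental solution of the adjoint equation `Z' = -Nᵀ Z`:
  -- its product with `Y` has zero derivative and starts at `1`.
  obtain ⟨Z, hZ0, hZ⟩ := exists_fundamental (N := fun s => -(N s)ᵀ)
    (hN.matrix_transpose).neg
  have hW : ∀ s, HasDerivAt (fun s => (Z s)ᵀ) (-((Z s)ᵀ * N s)) s := fun s =>
    (hZ s).matrix_transpose.congr_deriv (by simp)
  have hWY : ∀ s, (Z s)ᵀ * Y s = 1 := fun s => by
    have hd : ∀ s, HasDerivAt (fun s => (Z s)ᵀ * Y s) 0 s := fun s =>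
      ((hW s).mul (hY s)).congr_deriv (by simp [mul_assoc])
    have := is_const_of_deriv_eq_zero (fun s => (hd s).differentiableAt) (fun s => (hd s).deriv) s 0
    simpa [hY0, hZ0] using this
  exact ⟨Y, fun s => (Z s)ᵀ, hY0, hY, hW, hWY, fun s => mul_eq_one_comm.1 (hWY s)⟩

/-- The fundamental matrix is holomorphic in a parameter on which the coefficients depend
holomorphically. -/
theorem differentiable_fundamental [DecidableEq n] {N N' : ℂ → ℝ → Matrix n n ℂ} {Y : ℂ → ℝ → Matrix n n ℂ}
    (hN : ∀ p, Continuous (N p)) (hN' : Continuous (Function.uncurry N'))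
    (hd : ∀ p s, HasDerivAt (fun p => N p s) (N' p s) p)
    (hY0 : ∀ p, Y p 0 = 1) (hY : ∀ p s, HasDerivAt (Y p) (N p s * Y p s) s) (s : ℝ) :
    Differentiable ℂ fun p => Y p s := by
  intro p
  obtain ⟨X, W, -, hX, hW, hWX, hXW⟩ := exists_fundamental_matrix (hN p)
  have hYc : Continuous (Y p) := continuous_iff_continuousAt.2 fun s => (hY p s).continuousAt
  have hWc : Continuous W := continuous_iff_continuousAt.2 fun s => (hW s).continuousAt
  have hN'c : Continuous (N' p) := hN'.comp (continuous_const.prodMk continuous_id)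
  have hG : Continuous fun r => W r * N' p r * Y p r := (hWc.mul hN'c).mul hYc
  have hI := fun s => (hG.integral_hasStrictDerivAt 0 s).hasDerivAt
  -- Variation of constants: `X ∫ W N' Y` solves the variational equation. Its initial value is `0`
  -- because `Y p 0 = 1` for every `p`.
  refine (hasDerivAt_param (y := Y)
    (η := fun s => X s * ∫ r in (0 : ℝ)..s, W r * N' p r * Y p r)
    (hN p) hN' hd hY (fun s => ?_) ?_ s).differentiableAt
  · refine ((hX s).mul (hI s)).congr_deriv ?_
    rw [← mul_assoc (X s), ← mul_assoc (X s), hXW, one_mul, mul_assoc]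
  · simpa [hY0] using hasDerivAt_const p (1 : Matrix n n ℂ)

end MatrixODE

/-! ### The zero curvature identity. -/

section LaxAlgebra

/-- The coefficient of the `x`-equation as a function of the spectral parameter `k` and of the
value of `q`. -/
def laxU (κ : ℂ) (w : Fin 2 → ℂ) : Matrix (Fin 3) (Fin 3) ℂ :=
  (Complex.I * κ) • sigmaThree + blockQ w

/-- The coefficient of the `t`-equation as a function of `k`, `q`, `q_x` and `q_xx`. -/
def laxV (κ : ℂ) (w w₁ w₂ : Fin 2 → ℂ) : Matrix (Fin 3) (Fin 3) ℂ :=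
  (4 * Complex.I * κ ^ 3) • sigmaThree + (4 * κ ^ 2) • blockQ w
    - (2 * Complex.I * κ) • (sigmaThree * (blockQ w₁ - blockQ w ^ 2))
    + (2 : ℂ) • blockQ w ^ 3 - blockQ w₂ + (blockQ w₁ * blockQ w - blockQ w * blockQ w₁)

/-- The derivative of `laxV` along a curve with velocity `(w₁, w₂, w₃)`. -/
def laxVx (κ : ℂ) (w w₁ w₂ w₃ : Fin 2 → ℂ) : Matrix (Fin 3) (Fin 3) ℂ :=
  (4 * κ ^ 2) • blockQ w₁
    - (2 * Complex.I * κ) • (sigmaThree * (blockQ w₂ - (blockQ w₁ * blockQ w + blockQ w * blockQ w₁)))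
    + (2 : ℂ) • (blockQ w₁ * blockQ w ^ 2 + blockQ w * blockQ w₁ * blockQ w + blockQ w ^ 2 * blockQ w₁)
    - blockQ w₃ + (blockQ w₂ * blockQ w - blockQ w * blockQ w₂)

lemma sigmaThree_eq : sigmaThree = !![1, 0, 0; 0, 1, 0; 0, 0, -1] := by
  ext i j; fin_cases i <;> fin_cases j <;> simp [sigmaThree]

lemma blockQ_mul (w v : Fin 2 → ℂ) : blockQ w * blockQ v =
    !![-(w 0 * conj (v 0)), -(w 0 * conj (v 1)), 0;
       -(w 1 * conj (v 0)), -(w 1 * conj (v 1)), 0;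
       0, 0, -(conj (w 0) * v 0 + conj (w 1) * v 1)] := by
  ext i j
  fin_cases i <;> fin_cases j <;> simp [blockQ]
  ring

set_option maxHeartbeats 1000000 in
-- This is `U_t - V_x + [U, V] = 0`. The diagonal blocks vanish identically; the upper off-diagonal
-- block is the mKdV equation and the lower one is minus its conjugate.
lemma zero_curvature (κ : ℂ) {w w₁ w₂ w₃ wt : Fin 2 → ℂ}
    (h : wt + w₃ + (3 * (star w ⬝ᵥ w)) • w₁ + (3 * (star w ⬝ᵥ w₁)) • w = 0) :
    blockQ wt + laxU κ w * laxV κ w w₁ w₂ = laxVx κ w w₁ w₂ w₃ + laxV κ w w₁ w₂ * laxU κ w := by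
  have h0 := congrFun h 0
  have h1 := congrFun h 1
  simp only [dotProduct, Fin.sum_univ_two, Pi.add_apply, Pi.smul_apply, Pi.star_apply,
    Pi.zero_apply, smul_eq_mul, RCLike.star_def] at h0 h1
  have c0 := congrArg conj h0
  have c1 := congrArg conj h1
  simp only [map_add, map_mul, Complex.conj_conj, map_zero, map_ofNat] at c0 c1
  have hI := Complex.I_sq
  simp only [laxU, laxV, laxVx, pow_succ (blockQ w), pow_zero, one_mul, blockQ_mul]
  simp only [blockQ, sigmaThree_eq]
  -- With the conjugates as independent variables, every entry is a polynomial identity modulo `I² =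
  -- -1`, the equation and its conjugate.
  generalize conj (w 0) = a at *
  generalize conj (w 1) = b at *
  generalize conj (w₁ 0) = a₁ at *
  generalize conj (w₁ 1) = b₁ at *
  generalize conj (w₂ 0) = a₂ at *
  generalize conj (w₂ 1) = b₂ at *
  generalize conj (w₃ 0) = a₃ at *
  generalize conj (w₃ 1) = b₃ at *
  generalize conj (wt 0) = d at *
  generalize conj (wt 1) = bt at *
  generalize Complex.I = I at *
  ext i j
  fin_cases i <;> fin_cases j <;> simp
  · ring
  · ring
  · linear_combination h0 - 4 * κ ^ 2 * w₁ 0 * hI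
  · ring
  · ring
  · linear_combination h1 - 4 * κ ^ 2 * w₁ 1 * hI
  · linear_combination -c0 + 4 * κ ^ 2 * a₁ * hI
  · linear_combination -c1 + 4 * κ ^ 2 * b₁ * hI
  · ring

end LaxAlgebra

/-! ### Adjoint symmetry and traces of the Lax matrices, and the constant background. -/

section LaxAlgebra

lemma conjTranspose_blockQ (w : Fin 2 → ℂ) : (blockQ w)ᴴ = -blockQ w := by
  ext i j; fin_cases i <;> fin_cases j <;> simp [blockQ]

lemma conjTranspose_sigmaThree : sigmaThreeᴴ = sigmaThree := by
  ext i j; fin_cases i <;> fin_cases j <;> simp [sigmaThree_eq]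

lemma sigmaThree_mul_blockQ (w : Fin 2 → ℂ) : sigmaThree * blockQ w = -(blockQ w * sigmaThree) := by
  ext i j; fin_cases i <;> fin_cases j <;> simp [sigmaThree_eq, blockQ]

/-- `σ₃` is Hermitian and `Q` is anti-Hermitian. This symmetry and its analogue for `V` are the
source of `F(k^*)† F(k) = 1`. -/
lemma conjTranspose_laxU (κ : ℂ) (w : Fin 2 → ℂ) : (laxU (conj κ) w)ᴴ = -laxU κ w := by
  simp [laxU, conjTranspose_blockQ, conjTranspose_sigmaThree, add_comm]

lemma conjTranspose_laxV (κ : ℂ) (w w₁ w₂ : Fin 2 → ℂ) :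
    (laxV (conj κ) w w₁ w₂)ᴴ = -laxV κ w w₁ w₂ := by
  have h1 : blockQ w₁ * sigmaThree = -(sigmaThree * blockQ w₁) := by
    rw [sigmaThree_mul_blockQ, neg_neg]
  have h2 : blockQ w ^ 2 * sigmaThree = sigmaThree * blockQ w ^ 2 := by
    rw [pow_two, ← mul_assoc, sigmaThree_mul_blockQ, mul_assoc, neg_mul, mul_assoc,
      sigmaThree_mul_blockQ]
    simp
  simp only [laxV, conjTranspose_add, conjTranspose_sub, conjTranspose_smul, conjTranspose_mul,
    conjTranspose_pow, conjTranspose_blockQ, conjTranspose_sigmaThree, RCLike.star_def, map_mul,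
    map_pow, Complex.conj_conj, Complex.conj_I, map_ofNat, neg_sq, neg_mul, h1, h2, mul_sub]
  rw [Odd.neg_pow (by decide)]
  simp only [mul_neg, neg_mul, smul_neg, neg_smul, smul_sub, neg_neg]
  abel

lemma trace_laxU (κ : ℂ) (w : Fin 2 → ℂ) : (laxU κ w).trace = Complex.I * κ := by
  simp [laxU, blockQ, sigmaThree_eq, Matrix.trace, Fin.sum_univ_three]

lemma trace_laxV (κ : ℂ) (w w₁ w₂ : Fin 2 → ℂ) :
    (laxV κ w w₁ w₂).trace = 4 * Complex.I * κ ^ 3 := by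
  simp only [laxV, pow_succ (blockQ w), pow_zero, one_mul, blockQ_mul]
  simp [blockQ, sigmaThree_eq, Matrix.trace, Fin.sum_univ_three]
  ring

/-- For vanishing derivatives, `V` is a polynomial in `U`. -/
lemma laxV_const (κ : ℂ) (w : Fin 2 → ℂ) :
    laxV κ w 0 0 = (2 : ℂ) • laxU κ w ^ 3 + (6 * κ ^ 2) • laxU κ w := by
  have hs : sigmaThree ^ 2 = 1 := by
    ext i j; fin_cases i <;> fin_cases j <;> simp [sigmaThree_eq, pow_two]
  have h0 : blockQ 0 = 0 := by
    ext i j; fin_cases i <;> fin_cases j <;> simp [blockQ]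
  have hU : laxU κ w ^ 2 = (-κ ^ 2) • 1 + blockQ w ^ 2 := by
    rw [laxU, pow_two, add_mul, mul_add, mul_add, smul_mul_smul_comm, ← pow_two sigmaThree, hs,
      smul_mul_assoc, sigmaThree_mul_blockQ, mul_smul_comm, ← pow_two (blockQ w)]
    have : Complex.I * κ * (Complex.I * κ) = -κ ^ 2 := by linear_combination κ ^ 2 * Complex.I_sq
    rw [this]
    simp only [smul_neg]
    abel
  rw [pow_succ' _ 2, hU, mul_add, mul_smul_comm, mul_one]
  simp only [laxU, laxV, h0, add_mul, smul_mul_assoc, pow_succ' (blockQ w) 2, zero_mul, mul_zero,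
    zero_sub, mul_neg, smul_neg, smul_add, smul_smul]
  module

/-- The infinitesimal form of `Ma × Mb = det M · M⁻ᵀ (a × b)` at `M = 1`, in the direction `Nᵀ`. -/
lemma crossProduct_transpose_mulVec (N : Matrix (Fin 3) (Fin 3) ℂ) (a b : Fin 3 → ℂ) :
    crossProduct (Nᵀ *ᵥ a) b + crossProduct a (Nᵀ *ᵥ b)
      = N.trace • crossProduct a b - N *ᵥ crossProduct a b := by
  ext i
  fin_cases i <;>
  simp [crossProduct, mulVec, dotProduct, Fin.sum_univ_three, Matrix.trace] <;> ring

end LaxAlgebra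

/-! ### Partial derivatives of the potential. -/

section Partial

variable {E : Type*} [NormedAddCommGroup E] [NormedSpace ℝ E]

lemma ContDiff.hasDerivAt_fst {n : WithTop ℕ∞} {G : ℝ × ℝ → E} (hG : ContDiff ℝ n G) (hn : n ≠ 0)
    (x t : ℝ) : HasDerivAt (fun y => G (y, t)) (fderiv ℝ G (x, t) (1, 0)) x := by
  have h := (hG.differentiable hn (x, t)).hasFDerivAt
  exact h.comp_hasDerivAt x ((hasDerivAt_id x).prodMk (hasDerivAt_const x t))

lemma ContDiff.hasDerivAt_snd {n : WithTop ℕ∞} {G : ℝ × ℝ → E} (hG : ContDiff ℝ n G) (hn : n ≠ 0)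
    (x t : ℝ) : HasDerivAt (fun r => G (x, r)) (fderiv ℝ G (x, t) (0, 1)) t := by
  have h := (hG.differentiable hn (x, t)).hasFDerivAt
  exact h.comp_hasDerivAt t ((hasDerivAt_const t x).prodMk (hasDerivAt_id t))

lemma ContDiff.fderiv_apply_const {m n : WithTop ℕ∞} {G : ℝ × ℝ → E} (hG : ContDiff ℝ n G)
    (hmn : m + 1 ≤ n) (v : ℝ × ℝ) : ContDiff ℝ m fun p => fderiv ℝ G p v :=
  (hG.fderiv_right hmn).clm_apply contDiff_const

end Partial

namespace Potential

variable {S : Potential}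

lemma contDiff_qx (hS : S.IsSolution) : ContDiff ℝ 2 (fun p : ℝ × ℝ => S.qx p.1 p.2) := by
  have : (fun p : ℝ × ℝ => S.qx p.1 p.2)
      = fun p => fderiv ℝ (fun p : ℝ × ℝ => S.q p.1 p.2) p (1, 0) :=
    funext fun p => (hS.smooth.hasDerivAt_fst (by norm_num) p.1 p.2).deriv
  rw [this]
  exact hS.smooth.fderiv_apply_const (by norm_num) _

lemma hasDerivAt_q (hS : S.IsSolution) (x t : ℝ) :
    HasDerivAt (fun y => S.q y t) (S.qx x t) x :=
  (hS.smooth.hasDerivAt_fst (by norm_num) x t).differentiableAt.hasDerivAt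

lemma hasDerivAt_q_time (hS : S.IsSolution) (x t : ℝ) :
    HasDerivAt (fun r => S.q x r) (S.qt x t) t :=
  (hS.smooth.hasDerivAt_snd (by norm_num) x t).differentiableAt.hasDerivAt

lemma qxx_eq (x t : ℝ) : S.qxx x t = deriv (fun y => S.qx y t) x := by
  rw [qxx, iteratedDeriv_succ, iteratedDeriv_one]; rfl

lemma qxxx_eq (x t : ℝ) : S.qxxx x t = deriv (fun y => S.qxx y t) x := by
  rw [qxxx, iteratedDeriv_succ]; rfl

lemma hasDerivAt_qx (hS : S.IsSolution) (x t : ℝ) :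
    HasDerivAt (fun y => S.qx y t) (S.qxx x t) x := by
  rw [qxx_eq]
  exact ((contDiff_qx hS).hasDerivAt_fst (by norm_num) x t).differentiableAt.hasDerivAt

lemma contDiff_qxx (hS : S.IsSolution) : ContDiff ℝ 1 (fun p : ℝ × ℝ => S.qxx p.1 p.2) := by
  have : (fun p : ℝ × ℝ => S.qxx p.1 p.2)
      = fun p => fderiv ℝ (fun p : ℝ × ℝ => S.qx p.1 p.2) p (1, 0) :=
    funext fun p => by rw [qxx_eq]; exact ((contDiff_qx hS).hasDerivAt_fst (by norm_num) p.1 p.2).deriv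
  rw [this]
  exact (contDiff_qx hS).fderiv_apply_const (by norm_num) _

lemma hasDerivAt_qxx (hS : S.IsSolution) (x t : ℝ) :
    HasDerivAt (fun y => S.qxx y t) (S.qxxx x t) x := by
  rw [qxxx_eq]
  exact ((contDiff_qxx hS).hasDerivAt_fst (by norm_num) x t).differentiableAt.hasDerivAt

lemma continuous_qxxx (hS : S.IsSolution) : Continuous (fun p : ℝ × ℝ => S.qxxx p.1 p.2) := by
  have : (fun p : ℝ × ℝ => S.qxxx p.1 p.2)
      = fun p => fderiv ℝ (fun p : ℝ × ℝ => S.qxx p.1 p.2) p (1, 0) :=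
    funext fun p => by rw [qxxx_eq]; exact ((contDiff_qxx hS).hasDerivAt_fst (by norm_num) p.1 p.2).deriv
  rw [this]
  exact ((contDiff_qxx hS).fderiv_apply_const (m := 0) (by norm_num) _).continuous

lemma continuous_q_left (hS : S.IsSolution) (t : ℝ) : Continuous fun x => S.q x t :=
  continuous_iff_continuousAt.2 fun x => (hasDerivAt_q hS x t).continuousAt

lemma continuous_q_right (hS : S.IsSolution) (x : ℝ) : Continuous fun t => S.q x t :=
  continuous_iff_continuousAt.2 fun t => (hasDerivAt_q_time hS x t).continuousAt

lemma continuous_qx_right (hS : S.IsSolution) (x : ℝ) : Continuous fun t => S.qx x t :=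
  continuous_iff_continuousAt.2 fun t =>
    ((contDiff_qx hS).hasDerivAt_snd (by norm_num) x t).continuousAt

lemma continuous_qxx_right (hS : S.IsSolution) (x : ℝ) : Continuous fun t => S.qxx x t :=
  continuous_iff_continuousAt.2 fun t =>
    ((contDiff_qxx hS).hasDerivAt_snd (by norm_num) x t).continuousAt

end Potential

lemma hasDerivAt_blockQ {f : ℝ → Fin 2 → ℂ} {f' : Fin 2 → ℂ} {s : ℝ} (hf : HasDerivAt f f' s) :
    HasDerivAt (fun s => blockQ (f s)) (blockQ f') s := by
  rw [hasDerivAt_pi] at hf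
  have h0 := hf 0
  have h1 := hf 1
  have c0 : HasDerivAt (fun s => conj (f s 0)) (conj (f' 0)) s := h0.star
  have c1 : HasDerivAt (fun s => conj (f s 1)) (conj (f' 1)) s := h1.star
  refine hasDerivAt_matrix.2 fun i j => ?_
  fin_cases i <;> fin_cases j
  all_goals first
    | exact hasDerivAt_const _ _
    | exact h0
    | exact h1
    | exact c0.neg
    | exact c1.neg

lemma continuous_blockQ : Continuous blockQ := by
  refine continuous_matrix fun i j => ?_
  fin_cases i <;> fin_cases j <;> simp [blockQ] <;> fun_prop

/-! ### The fundamental matrix of the Lax pair. -/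

section LaxFundamental

open scoped Matrix.Norms.Operator

variable {S : Potential}

lemma hasDerivAt_laxU {f : ℝ → Fin 2 → ℂ} {f' : Fin 2 → ℂ} {s : ℝ} (κ : ℂ)
    (hf : HasDerivAt f f' s) : HasDerivAt (fun s => laxU κ (f s)) (blockQ f') s :=
  (hasDerivAt_blockQ hf).const_add _

lemma hasDerivAt_laxV {w w₁ w₂ : ℝ → Fin 2 → ℂ} {w₃ : Fin 2 → ℂ} {s : ℝ} (κ : ℂ)
    (h : HasDerivAt w (w₁ s) s) (h₁ : HasDerivAt w₁ (w₂ s) s) (h₂ : HasDerivAt w₂ w₃ s) :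
    HasDerivAt (fun s => laxV κ (w s) (w₁ s) (w₂ s)) (laxVx κ (w s) (w₁ s) (w₂ s) w₃) s := by
  have b := hasDerivAt_blockQ h
  have b₁ := hasDerivAt_blockQ h₁
  have b₂ := hasDerivAt_blockQ h₂
  have d2 := b.mul b
  have d3 := d2.mul b
  have := ((((b.const_smul (4 * κ ^ 2)).const_add ((4 * Complex.I * κ ^ 3) • sigmaThree)).sub
    (((b₁.sub d2).const_mul sigmaThree).const_smul (2 * Complex.I * κ))).add
    (d3.const_smul (2 : ℂ))).sub b₂ |>.add ((b₁.mul b).sub (b.mul b₁))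
  refine (this.congr_of_eventuallyEq (Eventually.of_forall fun r => ?_)).congr_deriv ?_
  · simp only [laxV, pow_succ, pow_zero, one_mul]; rfl
  · simp only [laxVx, pow_two, Pi.mul_apply, add_mul, mul_assoc]
    rw [← sub_eq_zero]
    abel

lemma continuous_laxU {X : Type*} [TopologicalSpace X] {κ : X → ℂ} {w : X → Fin 2 → ℂ}
    (hκ : Continuous κ) (h : Continuous w) : Continuous fun p => laxU (κ p) (w p) := by
  have := continuous_blockQ
  unfold laxU
  fun_prop

lemma continuous_laxV {X : Type*} [TopologicalSpace X] {κ : X → ℂ} {w w₁ w₂ : X → Fin 2 → ℂ}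
    (hκ : Continuous κ) (h : Continuous w) (h₁ : Continuous w₁) (h₂ : Continuous w₂) :
    Continuous fun p => laxV (κ p) (w p) (w₁ p) (w₂ p) := by
  have := continuous_blockQ
  unfold laxV
  fun_prop

lemma continuous_laxVx {X : Type*} [TopologicalSpace X] {κ : X → ℂ} {w w₁ w₂ w₃ : X → Fin 2 → ℂ}
    (hκ : Continuous κ) (h : Continuous w) (h₁ : Continuous w₁) (h₂ : Continuous w₂)
    (h₃ : Continuous w₃) : Continuous fun p => laxVx (κ p) (w p) (w₁ p) (w₂ p) (w₃ p) := by
  have := continuous_blockQ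
  unfold laxVx
  fun_prop

/-- The fundamental matrix of the Lax pair normalized at the origin. -/
structure Potential.IsFundamental (S : Potential) (F : ℝ → ℝ → ℂ → Matrix (Fin 3) (Fin 3) ℂ) :
    Prop where
  zero : ∀ κ, F 0 0 κ = 1
  deriv_x : ∀ x t κ, HasDerivAt (fun y => F y t κ) (laxU κ (S.q x t) * F x t κ) x
  deriv_t : ∀ x t κ,
    HasDerivAt (fun r => F x r κ) (laxV κ (S.q x t) (S.qx x t) (S.qxx x t) * F x t κ) t
  differentiable : ∀ x t, Differentiable ℂ (F x t)
  adj_mul : ∀ x t κ, (F x t (conj κ))ᴴ * F x t κ = 1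

/-- The derivative of the product contains `N(κ^*)† + N(κ)`, which is zero. -/
lemma conjTranspose_mul_const {Y : ℂ → ℝ → Matrix (Fin 3) (Fin 3) ℂ}
    {N : ℂ → ℝ → Matrix (Fin 3) (Fin 3) ℂ} (hY : ∀ κ s, HasDerivAt (Y κ) (N κ s * Y κ s) s)
    (hN : ∀ κ s, (N (conj κ) s)ᴴ = -N κ s) (κ : ℂ) (s : ℝ) :
    (Y (conj κ) s)ᴴ * Y κ s = (Y (conj κ) 0)ᴴ * Y κ 0 := by
  have hd : ∀ s, HasDerivAt (fun s => (Y (conj κ) s)ᴴ * Y κ s) 0 s := fun s => by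
    have h1 : HasDerivAt (fun s => (Y (conj κ) s)ᴴ) ((N (conj κ) s * Y (conj κ) s)ᴴ) s :=
      hasDerivAt_matrix.2 fun i j => (hasDerivAt_matrix.1 (hY (conj κ) s) j i).star
    refine (h1.mul (hY κ s)).congr_deriv ?_
    rw [conjTranspose_mul, hN, mul_neg, neg_mul, mul_assoc, neg_add_cancel]
  exact is_const_of_deriv_eq_zero (fun s => (hd s).differentiableAt) (fun s => (hd s).deriv) s 0

/-- The matrix is built by solving the `x`-equation along `t = 0` and then the `t`-equation along
each vertical line. The `t`-equation and the holomorphy in `κ` hold by construction; only the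
`x`-equation at `t ≠ 0` needs the zero curvature identity. -/
theorem Potential.exists_isFundamental (hS : S.IsSolution) : ∃ F, S.IsFundamental F := by
  have hq := hS.smooth.continuous
  have hq₁ := (Potential.contDiff_qx hS).continuous
  have hq₂ := (Potential.contDiff_qxx hS).continuous
  have hq₃ := Potential.continuous_qxxx hS
  have eq0 := S.continuous_q_left hS 0
  have eq := S.continuous_q_right hS
  have eq₁ := S.continuous_qx_right hS
  have eq₂ := S.continuous_qxx_right hS
  have cUx : ∀ κ, Continuous fun x => laxU κ (S.q x 0) := fun κ =>
    continuous_laxU continuous_const eq0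
  have cVt : ∀ x κ, Continuous fun t => laxV κ (S.q x t) (S.qx x t) (S.qxx x t) := fun x κ =>
    continuous_laxV continuous_const (eq x) (eq₁ x) (eq₂ x)
  choose X hX0 hX using fun κ => exists_fundamental (cUx κ)
  choose T hT0 hT using fun x κ => exists_fundamental (cVt x κ)
  have hXd : ∀ s, Differentiable ℂ fun κ => X κ s :=
    differentiable_fundamental (N := fun κ x => laxU κ (S.q x 0))
      (N' := fun _ _ => Complex.I • sigmaThree) cUx continuous_const
      (fun κ s => by
        have := (((hasDerivAt_id κ).const_mul Complex.I).smul_const sigmaThree).add_const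
          (blockQ (S.q s 0))
        rwa [mul_one] at this) hX0 hX
  have hTd : ∀ x s, Differentiable ℂ fun κ => T x κ s := fun x =>
    differentiable_fundamental (N := fun κ t => laxV κ (S.q x t) (S.qx x t) (S.qxx x t))
      (N' := fun κ t => (12 * Complex.I * κ ^ 2) • sigmaThree + (8 * κ) • blockQ (S.q x t)
        - (2 * Complex.I) • (sigmaThree * (blockQ (S.qx x t) - blockQ (S.q x t) ^ 2))) (cVt x)
      (by
        have h1 : Continuous fun t => blockQ (S.q x t) :=
          continuous_blockQ.comp (eq x)
        have h2 : Continuous fun t => blockQ (S.qx x t) :=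
          continuous_blockQ.comp (eq₁ x)
        have h1' : Continuous fun p : ℂ × ℝ => blockQ (S.q x p.2) := h1.comp continuous_snd
        have h2' : Continuous fun p : ℂ × ℝ => blockQ (S.qx x p.2) := h2.comp continuous_snd
        simp only [Function.uncurry_def]
        fun_prop)
      (fun κ s => by
        have a1 := ((hasDerivAt_pow 3 κ).const_mul (4 * Complex.I)).smul_const sigmaThree
        have a2 := ((hasDerivAt_pow 2 κ).const_mul 4).smul_const (blockQ (S.q x s))
        have a3 := ((hasDerivAt_id κ).const_mul (2 * Complex.I)).smul_const
          (sigmaThree * (blockQ (S.qx x s) - blockQ (S.q x s) ^ 2))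
        refine (((((a1.add a2).sub a3).add_const ((2 : ℂ) • blockQ (S.q x s) ^ 3)).sub_const
          (blockQ (S.qxx x s))).add_const (blockQ (S.qx x s) * blockQ (S.q x s)
            - blockQ (S.q x s) * blockQ (S.qx x s))).congr_deriv ?_
        congr 2
        · congr 1; push_cast; ring
        · congr 1; push_cast; ring
        · rw [mul_one]) (hT0 x) (hT x)
  -- The `x`-derivative of the solution of the `t`-equation is characterized by the variational
  -- equation with coefficient derivative `V_x`. Zero curvature says that `U F` solves this
  -- equation, and at `t = 0` it is the `x`-derivative of `X`.
  have hFx : ∀ x t κ, HasDerivAt (fun y => T y κ t * X κ y)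
      (laxU κ (S.q x t) * (T x κ t * X κ x)) x := fun x t κ => by
    refine hasDerivAt_param (𝕜 := ℝ) (y := fun y s => T y κ s * X κ y)
      (N := fun y s => laxV κ (S.q y s) (S.qx y s) (S.qxx y s))
      (N' := fun y s => laxVx κ (S.q y s) (S.qx y s) (S.qxx y s) (S.qxxx y s))
      (η := fun s => laxU κ (S.q x s) * (T x κ s * X κ x)) (cVt x κ)
      (continuous_laxVx continuous_const hq hq₁ hq₂ hq₃)
      (fun y s => hasDerivAt_laxV κ (S.hasDerivAt_q hS y s) (S.hasDerivAt_qx hS y s)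
        (S.hasDerivAt_qxx hS y s))
      (fun y s => ((hT y κ s).mul_const _).congr_deriv (mul_assoc _ _ _))
      (fun s => ?_) ?_ t
    · refine ((hasDerivAt_laxU κ (S.hasDerivAt_q_time hS x s)).mul ((hT x κ s).mul_const (X κ x))).congr_deriv ?_
      have := congrArg (· * (T x κ s * X κ x)) (zero_curvature κ (w₂ := S.qxx x s) (hS.equation x s))
      simp only [add_mul, mul_assoc] at this ⊢
      rw [this, add_comm]
    · simpa [hT0] using hX κ x
  refine ⟨fun x t κ => T x κ t * X κ x, fun κ => by simp [hT0, hX0], hFx,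
    fun x t κ => ((hT x κ t).mul_const _).congr_deriv (mul_assoc _ _ _),
    fun x t => (hTd x t).mul (hXd x), fun x t κ => ?_⟩
  have h1 := conjTranspose_mul_const (Y := fun κ t => T x κ t * X κ x)
    (N := fun κ t => laxV κ (S.q x t) (S.qx x t) (S.qxx x t))
    (fun κ s => ((hT x κ s).mul_const _).congr_deriv (mul_assoc _ _ _))
    (fun κ s => conjTranspose_laxV _ _ _ _) κ t
  have h2 := conjTranspose_mul_const hX (fun κ s => conjTranspose_laxU _ _) κ x
  simpa [hT0, hX0, h2] using h1

end LaxFundamental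

/-! ### Eigenvalues and eigenvectors at the constant background. -/

namespace Potential

variable (S : Potential)

/-- The exponents `λ, k, -λ` of the eigenvalues `iλ, ik, -iλ` of `U` at a constant background. -/
def nu (j : Fin 3) (z : ℂ) : ℂ := ![S.lam z, S.k z, -S.lam z] j

/-- The exponents of the eigenvalues of `V` at a constant background. -/
def om (j : Fin 3) (z : ℂ) : ℂ :=
  ![S.lam z * (2 * (2 * S.k z ^ 2 - (S.q0 : ℂ) ^ 2)), 4 * S.k z ^ 3,
    -(S.lam z * (2 * (2 * S.k z ^ 2 - (S.q0 : ℂ) ^ 2)))] j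

/-- The bilinear norm of the columns of `Γ`. -/
def gamma (j : Fin 3) (z : ℂ) : ℂ := ![1 + (S.q0 : ℂ) ^ 2 / z ^ 2, 1, 1 + (S.q0 : ℂ) ^ 2 / z ^ 2] j

variable {S}

lemma theta_eq (j : Fin 3) (x t : ℝ) (z : ℂ) : S.theta j x t z = S.nu j z * x + S.om j z * t := by
  fin_cases j <;> simp [theta, nu, om, theta1, theta2] <;> ring

lemma k_conj (z : ℂ) : S.k (conj z) = conj (S.k z) := by simp [k, map_ofNat]

lemma lam_conj (z : ℂ) : S.lam (conj z) = conj (S.lam z) := by simp [lam, map_ofNat]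

lemma lam_sq {z : ℂ} (hz : z ≠ 0) : S.lam z ^ 2 = S.k z ^ 2 + (S.q0 : ℂ) ^ 2 := by
  simp only [lam, k]; field_simp; ring

lemma laxU_mul_Gam {w : Fin 2 → ℂ} (hw : conj (w 0) * w 0 + conj (w 1) * w 1 = (S.q0 : ℂ) ^ 2)
    (hq : S.q0 ≠ 0) {z : ℂ} (hz : z ≠ 0) :
    laxU (S.k z) w * S.Gam w z = S.Gam w z * diagonal fun j => Complex.I * S.nu j z := by
  have hq' : (S.q0 : ℂ) ≠ 0 := by exact_mod_cast hq
  have hI := Complex.I_sq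
  simp only [laxU, blockQ, sigmaThree_eq, Gam, nu, k, lam]
  generalize conj (w 0) = a at *
  generalize conj (w 1) = b at *
  generalize (S.q0 : ℂ) = p at *
  ext i j
  fin_cases i <;> fin_cases j <;> simp [Matrix.mul_apply, Fin.sum_univ_three, diagonal] <;>
    field_simp
  · ring
  · linear_combination w 0 * 2 * z ^ 2 * hI
  · ring
  · linear_combination w 1 * 2 * z ^ 2 * hI
  · linear_combination -2 * z ^ 2 * hw - 2 * p ^ 2 * z ^ 2 * hI
  · ring
  · linear_combination -2 * hw

/-- Taking the adjoint at `z^*` keeps the product holomorphic in `z`. It provides an explicit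
inverse of `Γ` wherever `1 + q₀²/z² ≠ 0`, that is, away from `z = ±i q₀`. -/
lemma Gam_adj_mul {w : Fin 2 → ℂ} (hw : conj (w 0) * w 0 + conj (w 1) * w 1 = (S.q0 : ℂ) ^ 2)
    (hq : S.q0 ≠ 0) {z : ℂ} (hz : z ≠ 0) :
    (S.Gam w (conj z))ᴴ * S.Gam w z = diagonal fun j => S.gamma j z := by
  have hq' : (S.q0 : ℂ) ≠ 0 := by exact_mod_cast hq
  have hI := Complex.I_sq
  simp only [Gam]
  ext i j
  fin_cases i <;> fin_cases j <;>
    simp [gamma, Matrix.mul_apply, Fin.sum_univ_three, diagonal, conjTranspose_apply] <;>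
    field_simp
  · linear_combination z ^ 2 * hw - (S.q0 : ℂ) ^ 4 * hI
  · ring
  · linear_combination Complex.I * hw
  · ring
  · linear_combination hw
  · ring
  · linear_combination -Complex.I * hw
  · ring
  · linear_combination -Complex.I ^ 2 * hw - (S.q0 : ℂ) ^ 2 * hI

lemma laxU_mulVec_Gam {w : Fin 2 → ℂ} (hw : conj (w 0) * w 0 + conj (w 1) * w 1 = (S.q0 : ℂ) ^ 2)
    (hq : S.q0 ≠ 0) {z : ℂ} (hz : z ≠ 0) (j : Fin 3) :
    laxU (S.k z) w *ᵥ (fun i => S.Gam w z i j)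
      = (Complex.I * S.nu j z) • fun i => S.Gam w z i j := by
  have h := laxU_mul_Gam hw hq hz
  ext i
  have := congrFun (congrFun h i) j
  rw [Matrix.mul_diagonal] at this
  simpa [Matrix.mul_apply, mulVec, dotProduct, mul_comm] using this

/-- At the background `V = 2U³ + 6k²U`, so the eigenvectors of `U` serve for `V`, with eigenvalue
`2(iν)³ + 6k² iν`. The relation `λ² = k² + q₀²` brings it to the coefficient of `t` in `iθ_j`. -/
lemma laxV_mulVec_Gam {w : Fin 2 → ℂ} (hw : conj (w 0) * w 0 + conj (w 1) * w 1 = (S.q0 : ℂ) ^ 2)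
    (hq : S.q0 ≠ 0) {z : ℂ} (hz : z ≠ 0) (j : Fin 3) :
    laxV (S.k z) w 0 0 *ᵥ (fun i => S.Gam w z i j)
      = (Complex.I * S.om j z) • fun i => S.Gam w z i j := by
  have h := laxU_mulVec_Gam hw hq hz j
  rw [laxV_const, add_mulVec, smul_mulVec, smul_mulVec, pow_succ, pow_two,
    ← mulVec_mulVec, ← mulVec_mulVec, h, mulVec_smul, h, mulVec_smul, mulVec_smul, h,
    smul_smul, smul_smul, smul_smul, smul_smul, ← add_smul]
  congr 1
  have hl := lam_sq (S := S) hz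
  have hI := Complex.I_sq
  fin_cases j <;> simp [nu, om]
  · linear_combination 2 * Complex.I * S.lam z ^ 3 * hI - 2 * Complex.I * S.lam z * hl
  · linear_combination 2 * Complex.I * S.k z ^ 3 * hI
  · linear_combination -2 * Complex.I * S.lam z ^ 3 * hI + 2 * Complex.I * S.lam z * hl

/-- The inverse of `Γ`. -/
def GamInv (S : Potential) (w : Fin 2 → ℂ) (z : ℂ) : Matrix (Fin 3) (Fin 3) ℂ :=
  diagonal (fun j => (S.gamma j z)⁻¹) * (S.Gam w (conj z))ᴴ

lemma gamma_ne {z : ℂ} (h : 1 + (S.q0 : ℂ) ^ 2 / z ^ 2 ≠ 0) (j : Fin 3) : S.gamma j z ≠ 0 := by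
  fin_cases j
  · simpa [gamma] using h
  · simp [gamma]
  · simpa [gamma] using h

lemma GamInv_mul_Gam {w : Fin 2 → ℂ} (hw : conj (w 0) * w 0 + conj (w 1) * w 1 = (S.q0 : ℂ) ^ 2)
    (hq : S.q0 ≠ 0) {z : ℂ} (hz : z ≠ 0) (h : 1 + (S.q0 : ℂ) ^ 2 / z ^ 2 ≠ 0) :
    S.GamInv w z * S.Gam w z = 1 := by
  rw [GamInv, mul_assoc, Gam_adj_mul hw hq hz, diagonal_mul_diagonal, ← diagonal_one]
  congr 1
  ext j
  exact inv_mul_cancel₀ (gamma_ne h j)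

lemma continuousOn_Gam (w : Fin 2 → ℂ) : ContinuousOn (S.Gam w) {0}ᶜ := by
  refine continuousOn_pi.2 fun i => continuousOn_pi.2 fun j => ?_
  fin_cases i <;> fin_cases j <;> simp only [Gam] <;> simp <;>
  first
    | exact continuousOn_const
    | exact continuousOn_const.div continuousOn_id fun z hz => hz

lemma differentiableAt_Gam (w : Fin 2 → ℂ) {z : ℂ} (hz : z ≠ 0) (j : Fin 3) :
    DifferentiableAt ℂ (fun z i => S.Gam w z i j) z := by
  refine differentiableAt_pi.2 fun i => ?_
  fin_cases i <;> fin_cases j <;> simp only [Gam] <;> simp <;>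
  exact (differentiableAt_const _).div differentiableAt_id hz

lemma continuousOn_GamInv (w : Fin 2 → ℂ) :
    ContinuousOn (S.GamInv w) {z | z ≠ 0 ∧ 1 + (S.q0 : ℂ) ^ 2 / z ^ 2 ≠ 0} := by
  have h1 : ContinuousOn (fun z => (S.Gam w (conj z))ᴴ)
      {z | z ≠ 0 ∧ 1 + (S.q0 : ℂ) ^ 2 / z ^ 2 ≠ 0} := by
    refine continuousOn_pi.2 fun i => continuousOn_pi.2 fun j => ?_
    have := (continuousOn_pi.1 (continuousOn_pi.1 (continuousOn_Gam (S := S) w) j) i)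
    exact Complex.continuous_conj.comp_continuousOn (this.comp Complex.continuous_conj.continuousOn
      fun z hz => by simpa using hz.1)
  refine ContinuousOn.mul ?_ h1
  refine (Continuous.matrix_diagonal continuous_id).comp_continuousOn
    (continuousOn_pi.2 fun j => ?_)
  refine ContinuousOn.inv₀ ?_ fun z hz => gamma_ne hz.2 j
  have : ContinuousOn (fun z : ℂ => 1 + (S.q0 : ℂ) ^ 2 / z ^ 2)
      {z | z ≠ 0 ∧ 1 + (S.q0 : ℂ) ^ 2 / z ^ 2 ≠ 0} :=
    continuousOn_const.add (continuousOn_const.div (by fun_prop) fun z hz => pow_ne_zero 2 hz.1)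
  fin_cases j
  · exact this
  · exact continuousOn_const
  · exact this

end Potential

/-! ### Energy estimates for linear systems. -/

section Energy

/-- The squared Hermitian norm. -/
def energy (v : Fin 3 → ℂ) : ℝ := ‖v 0‖ ^ 2 + ‖v 1‖ ^ 2 + ‖v 2‖ ^ 2

lemma energy_nonneg (v : Fin 3 → ℂ) : 0 ≤ energy v := by unfold energy; positivity

lemma norm_sq_le_energy (v : Fin 3 → ℂ) : ‖v‖ ^ 2 ≤ energy v := by
  have h : ‖v‖ ≤ Real.sqrt (energy v) := by
    refine (pi_norm_le_iff_of_nonneg (Real.sqrt_nonneg _)).2 fun i => Real.le_sqrt_of_sq_le ?_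
    unfold energy
    fin_cases i <;> simp <;> nlinarith [sq_nonneg ‖v 0‖, sq_nonneg ‖v 1‖, sq_nonneg ‖v 2‖]
  calc ‖v‖ ^ 2 ≤ Real.sqrt (energy v) ^ 2 := by gcongr
    _ = energy v := Real.sq_sqrt (energy_nonneg v)

lemma energy_le (v : Fin 3 → ℂ) : energy v ≤ 3 * ‖v‖ ^ 2 := by
  have h : ∀ i, ‖v i‖ ^ 2 ≤ ‖v‖ ^ 2 := fun i => by gcongr; exact norm_le_pi_norm v i
  unfold energy
  linarith [h 0, h 1, h 2]

lemma hasDerivAt_energy {ψ : ℝ → Fin 3 → ℂ} {ψ' : Fin 3 → ℂ} {x : ℝ} (h : HasDerivAt ψ ψ' x) :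
    HasDerivAt (fun x => energy (ψ x)) (2 * (star (ψ x) ⬝ᵥ ψ').re) x := by
  rw [hasDerivAt_pi] at h
  refine (((h 0).norm_sq.add (h 1).norm_sq).add (h 2).norm_sq).congr_deriv ?_
  simp [dotProduct, Fin.sum_univ_three, Complex.inner]
  ring

/-- Backward stability with constant `C` of a linear system on the half-line. -/
def BackwardStable (N : ℝ → Matrix (Fin 3) (Fin 3) ℂ) (C : ℝ) : Prop :=
  ∀ ψ : ℝ → Fin 3 → ℂ, (∀ x, HasDerivAt ψ (N x *ᵥ ψ x) x) →
    ∀ x s, 0 ≤ x → x ≤ s → ‖ψ x‖ ≤ C * ‖ψ s‖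

/-- The hypothesis says exactly that the energy times `exp ∫ρ` is nondecreasing, so the energy at
`x` is controlled by the energy at a later `s`. -/
lemma energy_le_exp_mul {N : ℝ → Matrix (Fin 3) (Fin 3) ℂ} {ρ : ℝ → ℝ} {J : ℝ} (hρ : Continuous ρ)
    (hN : ∀ x v, 0 ≤ 2 * (star v ⬝ᵥ (N x *ᵥ v)).re + ρ x * energy v)
    (hJ : ∀ x s, 0 ≤ x → x ≤ s → ∫ r in x..s, ρ r ≤ J) {ψ : ℝ → Fin 3 → ℂ}
    (hψ : ∀ x, HasDerivAt ψ (N x *ᵥ ψ x) x) {x s : ℝ} (hx : 0 ≤ x) (hxs : x ≤ s) :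
    energy (ψ x) ≤ Real.exp J * energy (ψ s) := by
  have hP : ∀ y, HasDerivAt (fun y => ∫ r in x..y, ρ r) (ρ y) y := fun y =>
    (hρ.integral_hasStrictDerivAt x y).hasDerivAt
  have hd : ∀ y, HasDerivAt (fun y => energy (ψ y) * Real.exp (∫ r in x..y, ρ r))
      ((2 * (star (ψ y) ⬝ᵥ (N y *ᵥ ψ y)).re + ρ y * energy (ψ y))
        * Real.exp (∫ r in x..y, ρ r)) y := fun y =>
    ((hasDerivAt_energy (hψ y)).mul (hP y).exp).congr_deriv (by ring)
  have hmono := monotone_of_deriv_nonneg (fun y => (hd y).differentiableAt)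
    (fun y => by rw [(hd y).deriv]; exact mul_nonneg (hN _ _) (Real.exp_pos _).le) hxs
  simp only [intervalIntegral.integral_same, Real.exp_zero, mul_one] at hmono
  refine hmono.trans ?_
  rw [mul_comm]
  exact mul_le_mul_of_nonneg_right (Real.exp_le_exp.2 (hJ x s hx hxs)) (energy_nonneg _)

/-- The energy lies between `‖v‖²` and `3‖v‖²` for the maximum norm; the factor `2` absorbs `√3`. -/
lemma norm_le_of_energy_le {u v : Fin 3 → ℂ} {J : ℝ} (hJ : 0 ≤ J)
    (h : energy u ≤ Real.exp J * energy v) : ‖u‖ ≤ 2 * Real.exp J * ‖v‖ := by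
  have h1 := norm_sq_le_energy u
  have h2 := energy_le v
  have h3 : 1 ≤ Real.exp J := Real.one_le_exp hJ
  refine abs_le_of_sq_le_sq' ?_ (by positivity) |>.2
  calc ‖u‖ ^ 2 ≤ Real.exp J * (3 * ‖v‖ ^ 2) := h1.trans (h.trans (by gcongr))
    _ ≤ Real.exp J * (Real.exp J * (4 * ‖v‖ ^ 2)) := by
      refine mul_le_mul_of_nonneg_left ?_ (by positivity)
      nlinarith [sq_nonneg ‖v‖, mul_le_mul_of_nonneg_right h3 (sq_nonneg ‖v‖)]
    _ = (2 * Real.exp J * ‖v‖) ^ 2 := by ring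

end Energy

/-! ### The two ends of the line and backward stability. -/

namespace Potential

open MeasureTheory Set

/-- The end `ε s`, `s → ∞`, of the line, with boundary value `w`. -/
structure IsEnd (S : Potential) (l : Filter ℝ) (w : Fin 2 → ℂ) (ε : ℝ) : Prop where
  sign : ε = 1 ∨ ε = -1
  filter : l = map (fun s => ε * s) atTop
  norm : conj (w 0) * w 0 + conj (w 1) * w 1 = (S.q0 : ℂ) ^ 2
  tendsto_q : ∀ t, Tendsto (fun x => S.q x t) l (𝓝 w)
  tendsto_qx : ∀ t, Tendsto (fun x => S.qx x t) l (𝓝 0)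
  tendsto_qxx : ∀ t, Tendsto (fun x => S.qxx x t) l (𝓝 0)
  integrable : IntegrableOn (fun s => S.q (ε * s) 0 - w) (Ioi 0)

variable {S : Potential}

lemma norm_phase_smul (θ : ℝ) : conj ((Complex.exp (Complex.I * θ) • S.c) 0) *
    (Complex.exp (Complex.I * θ) • S.c) 0 + conj ((Complex.exp (Complex.I * θ) • S.c) 1) *
    (Complex.exp (Complex.I * θ) • S.c) 1 = (S.q0 : ℂ) ^ 2 := by
  have he : conj (Complex.exp (Complex.I * θ)) * Complex.exp (Complex.I * θ) = 1 := by
    rw [← Complex.exp_conj, ← Complex.exp_add]; simp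
  have h0 := Complex.conj_mul' (S.c 0)
  have h1 := Complex.conj_mul' (S.c 1)
  have hq : (S.q0 : ℂ) ^ 2 = ((‖S.c 0‖ ^ 2 + ‖S.c 1‖ ^ 2 : ℝ) : ℂ) := by
    rw [q0, ← Complex.ofReal_pow, Real.sq_sqrt (by positivity)]
  rw [hq]
  simp only [Pi.smul_apply, smul_eq_mul, map_mul]
  push_cast
  linear_combination (conj (S.c 0) * S.c 0 + conj (S.c 1) * S.c 1) * he + h0 + h1

lemma isEnd_plus (hS : S.IsSolution) : S.IsEnd atTop S.qPlus 1 where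
  sign := Or.inl rfl
  filter := by simp
  norm := norm_phase_smul _
  tendsto_q := hS.tendsto_plus
  tendsto_qx := hS.tendsto_qx_plus
  tendsto_qxx := hS.tendsto_qxx_plus
  integrable := by simpa using hS.integrable_plus 0 0

lemma isEnd_minus (hS : S.IsSolution) : S.IsEnd atBot S.qMinus (-1) where
  sign := Or.inr rfl
  filter := by
    simp only [neg_mul, one_mul]
    exact map_neg_atTop.symm
  norm := norm_phase_smul _
  tendsto_q := hS.tendsto_minus
  tendsto_qx := hS.tendsto_qx_minus
  tendsto_qxx := hS.tendsto_qxx_minus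
  integrable := by
    have := ((Measure.measurePreserving_neg (volume : Measure ℝ)).integrableOn_comp_preimage
      (MeasurableEquiv.neg ℝ).measurableEmbedding).2 (hS.integrable_minus 0 0)
    simpa [Function.comp_def] using this

/-- The set on which the column `j` at the end with sign `ε` is constructed. -/
def regJost (S : Potential) (ε : ℝ) : Fin 3 → Set ℂ
  | 0 => {z | z ≠ 0 ∧ ε * z.im ≤ 0 ∧ 0 ≤ ε * (S.lam z).im ∧ 1 + (S.q0 : ℂ) ^ 2 / z ^ 2 ≠ 0}
  | 1 => {z | z ≠ 0 ∧ 0 ≤ ε * z.im}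
  | 2 => {z | z ≠ 0 ∧ ε * z.im ≤ 0 ∧ ε * (S.lam z).im ≤ 0 ∧ 1 + (S.q0 : ℂ) ^ 2 / z ^ 2 ≠ 0}

/-- The coefficient of the equation satisfied by `e^{-iν_j ε s} φ(ε s, 0)`. -/
def normalizedU (S : Potential) (ε : ℝ) (j : Fin 3) (z : ℂ) (s : ℝ) : Matrix (Fin 3) (Fin 3) ℂ :=
  (ε : ℂ) • (laxU (S.k z) (S.q (ε * s) 0) - (Complex.I * S.nu j z) • 1)

lemma k_im (z : ℂ) : (S.k z).im = z.im * (1 + S.q0 ^ 2 / Complex.normSq z) / 2 := by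
  have : S.k z = z / 2 - ((S.q0 ^ 2 / 2 : ℝ) : ℂ) * z⁻¹ := by
    simp only [k]; push_cast; field_simp
  rw [this]
  simp [Complex.inv_im, -Complex.ofReal_div, -Complex.ofReal_pow]
  ring

lemma lam_im (z : ℂ) : (S.lam z).im = z.im * (1 - S.q0 ^ 2 / Complex.normSq z) / 2 := by
  have : S.lam z = z / 2 + ((S.q0 ^ 2 / 2 : ℝ) : ℂ) * z⁻¹ := by
    simp only [lam]; push_cast; field_simp
  rw [this]
  simp [Complex.inv_im, -Complex.ofReal_div, -Complex.ofReal_pow]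
  ring

lemma re_star_dotProduct_laxU (κ : ℂ) (w : Fin 2 → ℂ) (v : Fin 3 → ℂ) :
    (star v ⬝ᵥ (laxU κ w *ᵥ v)).re = -κ.im * (‖v 0‖ ^ 2 + ‖v 1‖ ^ 2 - ‖v 2‖ ^ 2) := by
  simp [laxU, blockQ, sigmaThree_eq, mulVec, dotProduct, Fin.sum_univ_three,
    ← Complex.normSq_eq_norm_sq, Complex.normSq_apply]
  ring

lemma star_dotProduct_self (v : Fin 3 → ℂ) : star v ⬝ᵥ v = energy v := by
  simp [dotProduct, Fin.sum_univ_three, energy, Complex.conj_mul']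

/-- Since `Q` is anti-Hermitian it does not contribute to the energy. The Hermitian part of `ε(U -
ik)` is `ε diag(0, 0, 2 Im k)`, and `Im k` has the sign of `Im z`, so the energy is nondecreasing in
`s`, whatever the potential. -/
lemma backwardStable_one {ε : ℝ} {z : ℂ} (hz : z ∈ S.regJost ε 1) :
    BackwardStable (S.normalizedU ε 1 z) 2 := by
  intro ψ hψ x s hx hxs
  have hk : 0 ≤ ε * (S.k z).im := by
    rw [k_im]
    have := hz.2
    have h2 : 0 ≤ S.q0 ^ 2 / Complex.normSq z := div_nonneg (sq_nonneg _) (Complex.normSq_nonneg _)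
    have : ε * (z.im * (1 + S.q0 ^ 2 / Complex.normSq z) / 2)
      = (ε * z.im) * (1 + S.q0 ^ 2 / Complex.normSq z) / 2 := by ring
    rw [this]; positivity
  have h := energy_le_exp_mul (J := 0) (ρ := fun _ => 0) continuous_const (fun x v => ?_)
    (fun _ _ _ _ => by simp) hψ hx hxs
  · simpa using norm_le_of_energy_le le_rfl h
  · have : star v ⬝ᵥ (S.normalizedU ε 1 z x *ᵥ v) = (ε : ℂ) * (star v ⬝ᵥ (laxU (S.k z) (S.q (ε * x) 0) *ᵥ v)
        - (Complex.I * S.k z) * energy v) := by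
      rw [← star_dotProduct_self]
      simp [normalizedU, smul_mulVec, sub_mulVec, dotProduct_smul, dotProduct_sub, nu]
    rw [this, Complex.re_ofReal_mul, Complex.sub_re, re_star_dotProduct_laxU]
    simp only [Complex.mul_re, Complex.I_re, Complex.I_im, Complex.ofReal_re, Complex.ofReal_im, energy,
      Complex.mul_im]
    have h3 := mul_nonneg hk (sq_nonneg ‖v 2‖)
    ring_nf
    nlinarith

section

open scoped Matrix.Norms.Operator

lemma blockQ_sub (a b : Fin 2 → ℂ) : blockQ a - blockQ b = blockQ (a - b) := by
  ext i j
  fin_cases i <;> fin_cases j <;> simp [blockQ] <;> ring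

lemma norm_blockQ_le (a : Fin 2 → ℂ) : ‖blockQ a‖ ≤ 2 * ‖a‖ := by
  have h0 := norm_le_pi_norm a 0
  have h1 := norm_le_pi_norm a 1
  have h : ‖blockQ a‖₊ ≤ 2 * ‖a‖₊ := by
    rw [Matrix.linfty_opNNNorm_def]
    refine Finset.sup_le fun i _ => ?_
    rw [← NNReal.coe_le_coe]
    push_cast
    fin_cases i <;> simp [blockQ, Fin.sum_univ_three] <;> linarith [norm_nonneg a]
  exact_mod_cast h

lemma norm_star_dotProduct_mulVec_le (R : Matrix (Fin 3) (Fin 3) ℂ) (v : Fin 3 → ℂ) :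
    |(star v ⬝ᵥ (R *ᵥ v)).re| ≤ 3 * ‖R‖ * energy v := by
  have h1 : ∀ i, ‖(R *ᵥ v) i‖ ≤ ‖R‖ * ‖v‖ := fun i =>
    (norm_le_pi_norm _ i).trans (Matrix.linfty_opNorm_mulVec R v)
  have h2 : ∀ i, ‖star v i * (R *ᵥ v) i‖ ≤ ‖R‖ * energy v := fun i => by
    rw [norm_mul]
    have h3 : ‖star v i‖ ≤ ‖v‖ := by simpa using norm_le_pi_norm v i
    calc ‖star v i‖ * ‖(R *ᵥ v) i‖ ≤ ‖v‖ * (‖R‖ * ‖v‖) :=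
          mul_le_mul h3 (h1 i) (norm_nonneg _) (norm_nonneg _)
      _ = ‖R‖ * ‖v‖ ^ 2 := by ring
      _ ≤ ‖R‖ * energy v := by gcongr; exact norm_sq_le_energy v
  calc |(star v ⬝ᵥ (R *ᵥ v)).re| ≤ ‖star v ⬝ᵥ (R *ᵥ v)‖ := Complex.abs_re_le_norm _
    _ ≤ ∑ i, ‖star v i * (R *ᵥ v) i‖ := norm_sum_le _ _
    _ ≤ ∑ _i : Fin 3, ‖R‖ * energy v := Finset.sum_le_sum fun i _ => h2 i
    _ = 3 * ‖R‖ * energy v := by simp; ring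

lemma re_star_dotProduct_diagonal (d v : Fin 3 → ℂ) :
    (star v ⬝ᵥ (diagonal d *ᵥ v)).re = ∑ i, (d i).re * ‖v i‖ ^ 2 := by
  simp [dotProduct, mulVec_diagonal, Fin.sum_univ_three, ← Complex.normSq_eq_norm_sq,
    Complex.normSq_apply]
  ring

variable {l : Filter ℝ} {w : Fin 2 → ℂ} {ε : ℝ}

lemma IsEnd.abs_sign (he : S.IsEnd l w ε) : |ε| = 1 := by
  rcases he.sign with h | h <;> simp [h]

lemma continuous_q_end (hS : S.IsSolution) (w : Fin 2 → ℂ) (ε : ℝ) :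
    Continuous fun s => S.q (ε * s) 0 - w :=
  ((continuous_q_left hS 0).comp (continuous_const.mul continuous_id)).sub continuous_const

/-- The stability constant for the last column. -/
def stabConst (S : Potential) (w : Fin 2 → ℂ) (ε : ℝ) (z : ℂ) : ℝ :=
  ‖S.Gam w z‖ * (2 * Real.exp (12 * ‖S.GamInv w z‖ * ‖S.Gam w z‖ *
    ∫ s in Ioi (0 : ℝ), ‖S.q (ε * s) 0 - w‖)) * ‖S.GamInv w z‖

lemma stabConst_nonneg (w : Fin 2 → ℂ) (ε : ℝ) (z : ℂ) : 0 ≤ S.stabConst w ε z := by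
  unfold stabConst; positivity

lemma intervalIntegral_le_Ioi {f : ℝ → ℝ} (hf : IntegrableOn f (Ioi 0)) (h0 : ∀ x, 0 ≤ f x)
    {x s : ℝ} (hx : 0 ≤ x) (hxs : x ≤ s) : ∫ r in x..s, f r ≤ ∫ r in Ioi 0, f r := by
  rw [intervalIntegral.integral_of_le hxs]
  exact setIntegral_mono_set hf (Eventually.of_forall h0)
    (LE.le.eventuallyLE fun r hr => hx.trans_lt hr.1)

/-- In the basis of the columns of `Γ` the background part is diagonal, with entries `iε(ν_j - ν₂)`.
Their real parts are nonnegative on the region, so only the integrable perturbation `q - w` can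
increase the backward norm. The constant `12` is `2` from the energy derivative, `3` from the bound
on the Hermitian form and `2` from `‖blockQ‖`. -/
lemma backwardStable_two (hS : S.IsSolution) (he : S.IsEnd l w ε) {z : ℂ}
    (hz : z ∈ S.regJost ε 2) :
    BackwardStable (S.normalizedU ε 2 z) (S.stabConst w ε z) := by
  obtain ⟨hz0, hzi, hli, hg⟩ := hz
  intro ψ hψ x s hx hxs
  have hq := hS.q0_pos.ne'
  have hinv := GamInv_mul_Gam he.norm hq hz0 hg
  have hinv' := mul_eq_one_comm.1 hinv
  set G := S.Gam w z with hG
  set H := S.GamInv w z with hH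
  set P := 12 * ‖H‖ * ‖G‖ with hP
  have hP0 : 0 ≤ P := by positivity
  set I₀ := ∫ s in Ioi (0 : ℝ), ‖S.q (ε * s) 0 - w‖ with hI₀
  have hI0 : 0 ≤ I₀ := setIntegral_nonneg measurableSet_Ioi fun _ _ => norm_nonneg _
  have hη : ∀ x, HasDerivAt (fun x => H *ᵥ ψ x)
      ((H * S.normalizedU ε 2 z x * G) *ᵥ (H *ᵥ ψ x)) x := fun x => by
    refine ((hasDerivAt_const x H).matrix_mulVec (hψ x)).congr_deriv ?_
    rw [zero_mulVec, zero_add, ← mulVec_mulVec, ← mulVec_mulVec, mulVec_mulVec (ψ x) G H, hinv',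
      one_mulVec]
  have hN : ∀ x, H * S.normalizedU ε 2 z x * G
      = diagonal (fun j => (ε : ℂ) * (Complex.I * (S.nu j z - S.nu 2 z)))
        + (ε : ℂ) • (H * blockQ (S.q (ε * x) 0 - w) * G) := fun x => by
    have h1 : laxU (S.k z) (S.q (ε * x) 0) = laxU (S.k z) w + blockQ (S.q (ε * x) 0 - w) := by
      rw [← blockQ_sub, laxU, laxU]; abel
    have h2 : H * laxU (S.k z) w * G = diagonal fun j => Complex.I * S.nu j z := by
      rw [mul_assoc, laxU_mul_Gam he.norm hq hz0, ← mul_assoc, hinv, one_mul]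
    rw [normalizedU, h1, mul_smul_comm, smul_mul_assoc, mul_sub, mul_add, sub_mul, add_mul, h2,
      mul_smul_comm, smul_mul_assoc, mul_one, hinv, add_sub_right_comm, smul_add]
    congr 1
    rw [← diagonal_one, ← diagonal_smul, diagonal_sub, ← diagonal_smul]
    congr 1
    ext j
    simp only [Pi.smul_apply, smul_eq_mul, mul_one]
    ring
  -- Here `k + λ = z`: the condition on `Im z` controls the second component, and the condition on
  -- `Im λ` controls the first, whose exponent differs from the third by `2λ`.
  have hk2 : S.nu 1 z - S.nu 2 z = z := by
    simp [nu, k, lam]; ring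
  have h := energy_le_exp_mul (J := P * I₀)
    (N := fun x => H * S.normalizedU ε 2 z x * G)
    (ρ := fun s => P * ‖S.q (ε * s) 0 - w‖)
    (continuous_const.mul (continuous_q_end hS w ε).norm) (fun x v => ?_)
    (fun a b ha hab => ?_) hη hx hxs
  · have h1 := norm_le_of_energy_le (mul_nonneg hP0 hI0) h
    have h2 : ∀ y, ψ y = G *ᵥ (H *ᵥ ψ y) := fun y => by rw [mulVec_mulVec, hinv', one_mulVec]
    calc ‖ψ x‖ ≤ ‖G‖ * ‖H *ᵥ ψ x‖ := by
          conv_lhs => rw [h2 x]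
          exact Matrix.linfty_opNorm_mulVec _ _
      _ ≤ ‖G‖ * (2 * Real.exp (P * I₀) * (‖H‖ * ‖ψ s‖)) := by
          gcongr
          exact h1.trans (by gcongr; exact Matrix.linfty_opNorm_mulVec _ _)
      _ = S.stabConst w ε z * ‖ψ s‖ := by rw [stabConst]; ring
  · rw [hN, add_mulVec, dotProduct_add, Complex.add_re, re_star_dotProduct_diagonal]
    have h1 := norm_star_dotProduct_mulVec_le ((ε : ℂ) • (H * blockQ (S.q (ε * x) 0 - w) * G)) v
    have h2 : ‖(ε : ℂ) • (H * blockQ (S.q (ε * x) 0 - w) * G)‖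
        ≤ ‖H‖ * (2 * ‖S.q (ε * x) 0 - w‖) * ‖G‖ := by
      rw [norm_smul, Complex.norm_real, Real.norm_eq_abs, he.abs_sign, one_mul]
      refine (norm_mul_le _ _).trans (mul_le_mul_of_nonneg_right ?_ (norm_nonneg _))
      refine (norm_mul_le _ _).trans (mul_le_mul_of_nonneg_left (norm_blockQ_le _) (norm_nonneg _))
    have h3 : 0 ≤ ∑ i, ((ε : ℂ) * (Complex.I * (S.nu i z - S.nu 2 z))).re * ‖v i‖ ^ 2 := by
      refine Finset.sum_nonneg fun i _ => mul_nonneg ?_ (sq_nonneg _)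
      rw [Complex.re_ofReal_mul, Complex.I_mul_re]
      fin_cases i
      · simp [nu]; linarith
      · have := congrArg Complex.im hk2
        simp only [Fin.mk_one, this]; linarith
      · simp
    have h4 := (abs_le.1 h1).1
    have h5 : 3 * ‖(ε : ℂ) • (H * blockQ (S.q (ε * x) 0 - w) * G)‖ * energy v
        ≤ 3 * (‖H‖ * (2 * ‖S.q (ε * x) 0 - w‖) * ‖G‖) * energy v := by
      gcongr
      exact energy_nonneg v
    simp only [hP]
    linarith
  · rw [intervalIntegral.integral_const_mul]
    exact mul_le_mul_of_nonneg_left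
      (intervalIntegral_le_Ioi he.integrable.norm (fun _ => norm_nonneg _) ha hab) hP0

/-- Continuity makes the stability constant locally bounded in `z`, hence the construction of the
Jost vector locally uniform. -/
lemma continuousOn_stabConst (w : Fin 2 → ℂ) (ε : ℝ) :
    ContinuousOn (S.stabConst w ε) (S.regJost ε 2) := by
  have h1 := ((continuousOn_Gam (S := S) w).mono fun z (hz : z ∈ S.regJost ε 2) => hz.1).norm
  have h2 := ((continuousOn_GamInv (S := S) w).mono
    fun z (hz : z ∈ S.regJost ε 2) => ⟨hz.1, hz.2.2.2⟩).norm
  unfold stabConst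
  exact (h1.mul (continuousOn_const.mul
    (((continuousOn_const.mul h2).mul h1).mul continuousOn_const).rexp)).mul h2

end

end Potential

/-! ### Jost vectors as limits of normalized backward propagation. -/

namespace Potential

open MeasureTheory Set
open scoped Matrix.Norms.Operator

variable {S : Potential} {F : ℝ → ℝ → ℂ → Matrix (Fin 3) (Fin 3) ℂ} {l : Filter ℝ}
  {w : Fin 2 → ℂ} {ε : ℝ}

lemma IsFundamental.mul_adj (hF : S.IsFundamental F) (x t : ℝ) (κ : ℂ) :
    F x t κ * (F x t (conj κ))ᴴ = 1 := mul_eq_one_comm.1 (hF.adj_mul x t κ)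

lemma IsFundamental.differentiable_adj (hF : S.IsFundamental F) (x t : ℝ) :
    Differentiable ℂ fun κ => (F x t (conj κ))ᴴ := fun κ => by
  have h := hasDerivAt_matrix.1 (hF.differentiable x t (conj κ)).hasDerivAt
  refine HasDerivAt.differentiableAt (f' := (deriv (F x t) (conj κ))ᴴ)
    (hasDerivAt_matrix.2 fun i j => ?_)
  have := (h j i).star_conj
  rwa [Complex.conj_conj] at this

lemma IsFundamental.hasDerivAt_end (hF : S.IsFundamental F) (ε : ℝ) (κ : ℂ) (s : ℝ) :
    HasDerivAt (fun s => F (ε * s) 0 κ)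
      ((ε : ℂ) • (laxU κ (S.q (ε * s) 0) * F (ε * s) 0 κ)) s := by
  have h := (hF.deriv_x (ε * s) 0 κ).scomp s ((hasDerivAt_id s).const_mul ε)
  rw [mul_one] at h
  exact h.congr_deriv (by ext i j; simp)

lemma IsFundamental.hasDerivAt_adj_end (hF : S.IsFundamental F) (ε : ℝ) (κ : ℂ) (s : ℝ) :
    HasDerivAt (fun s => (F (ε * s) 0 (conj κ))ᴴ)
      (-(ε : ℂ) • ((F (ε * s) 0 (conj κ))ᴴ * laxU κ (S.q (ε * s) 0))) s := by
  have h : HasDerivAt (fun s => (F (ε * s) 0 (conj κ))ᴴ)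
      (((ε : ℂ) • (laxU (conj κ) (S.q (ε * s) 0) * F (ε * s) 0 (conj κ)))ᴴ) s :=
    hasDerivAt_matrix.2 fun i j =>
      (hasDerivAt_matrix.1 (hF.hasDerivAt_end ε (conj κ) s) j i).star
  refine h.congr_deriv ?_
  rw [conjTranspose_smul, conjTranspose_mul, conjTranspose_laxU]
  simp

lemma hasDerivAt_cexp_mul (c : ℂ) (a s : ℝ) :
    HasDerivAt (fun s : ℝ => Complex.exp (c * ((s - a : ℝ) : ℂ)))
      (c * Complex.exp (c * ((s - a : ℝ) : ℂ))) s := by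
  have h : HasDerivAt (fun s : ℝ => c * ((s - a : ℝ) : ℂ)) c s := by
    have := (((hasDerivAt_id s).sub_const a).ofReal_comp).const_mul c
    simpa using this
  exact h.cexp.congr_deriv (mul_comm _ _)

/-- The normalized propagator along the end, applied to a vector. -/
def propagate (S : Potential) (F : ℝ → ℝ → ℂ → Matrix (Fin 3) (Fin 3) ℂ) (ε : ℝ) (j : Fin 3) (z : ℂ)
    (y : Fin 3 → ℂ) (s x : ℝ) : Fin 3 → ℂ :=
  Complex.exp (-(Complex.I * S.nu j z * ε) * ((x - s : ℝ) : ℂ)) •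
    (F (ε * x) 0 (S.k z) *ᵥ ((F (ε * s) 0 (conj (S.k z)))ᴴ *ᵥ y))

lemma propagate_self (hF : S.IsFundamental F) (ε : ℝ) (j : Fin 3) (z : ℂ) (y : Fin 3 → ℂ) (s : ℝ) :
    S.propagate F ε j z y s s = y := by
  simp [propagate, hF.mul_adj]

lemma hasDerivAt_normalized (hF : S.IsFundamental F) (ε : ℝ) (j : Fin 3) (z : ℂ) (y : Fin 3 → ℂ)
    (s x : ℝ) :
    HasDerivAt (fun x => Complex.exp (-(Complex.I * S.nu j z * ε) * ((x - s : ℝ) : ℂ)) •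
      (F (ε * x) 0 (S.k z) *ᵥ y)) (S.normalizedU ε j z x *ᵥ
      (Complex.exp (-(Complex.I * S.nu j z * ε) * ((x - s : ℝ) : ℂ)) •
      (F (ε * x) 0 (S.k z) *ᵥ y))) x := by
  refine ((hasDerivAt_cexp_mul _ s x).smul ((hF.hasDerivAt_end ε (S.k z) x).matrix_mulVec
    (hasDerivAt_const x y))).congr_deriv ?_
  simp only [normalizedU, mulVec_zero, add_zero, smul_mulVec, sub_mulVec, one_mulVec, mulVec_smul,
    ← mulVec_mulVec, smul_sub, smul_smul]
  module

lemma norm_propagate_le (hF : S.IsFundamental F) {j : Fin 3} {z : ℂ} {C : ℝ}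
    (hst : BackwardStable (S.normalizedU ε j z) C) (y : Fin 3 → ℂ) {x s : ℝ} (hx : 0 ≤ x)
    (hxs : x ≤ s) : ‖S.propagate F ε j z y s x‖ ≤ C * ‖y‖ := by
  have := hst _ (fun x => hasDerivAt_normalized hF ε j z ((F (ε * s) 0 (conj (S.k z)))ᴴ *ᵥ y) s x)
    x s hx hxs
  have h2 := propagate_self hF ε j z y s
  rw [propagate] at h2
  rwa [h2] at this

/-- `Γ_j` is an eigenvector of the background coefficient with eigenvalue `iν_j`, which cancels
against the derivative of the exponential. What remains is linear in `q - w`, hence integrable. -/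
lemma hasDerivAt_propagate_Gam (hF : S.IsFundamental F) (hS : S.IsSolution) (he : S.IsEnd l w ε)
    (j : Fin 3) {z : ℂ} (hz : z ≠ 0) (x s : ℝ) :
    HasDerivAt (fun s => S.propagate F ε j z (fun i => S.Gam w z i j) s x)
      (-(ε : ℂ) • S.propagate F ε j z (blockQ (S.q (ε * s) 0 - w) *ᵥ fun i => S.Gam w z i j) s x)
      s := by
  have hc : HasDerivAt (fun s : ℝ => Complex.exp (-(Complex.I * S.nu j z * ε) * ((x - s : ℝ) : ℂ)))
      ((Complex.I * S.nu j z * ε) *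
        Complex.exp (-(Complex.I * S.nu j z * ε) * ((x - s : ℝ) : ℂ))) s := by
    have := hasDerivAt_cexp_mul (Complex.I * S.nu j z * ε) x s
    have e : ∀ s : ℝ, -(Complex.I * S.nu j z * ε) * ((x - s : ℝ) : ℂ)
      = (Complex.I * S.nu j z * ε) * ((s - x : ℝ) : ℂ) := fun s => by push_cast; ring
    simpa only [e] using this
  have hv := (hasDerivAt_const s (F (ε * x) 0 (S.k z))).matrix_mulVec
    ((hF.hasDerivAt_adj_end ε (S.k z) s).matrix_mulVec
      (hasDerivAt_const s (fun i => S.Gam w z i j)))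
  refine (hc.smul hv).congr_deriv ?_
  have hU : laxU (S.k z) (S.q (ε * s) 0) = laxU (S.k z) w + blockQ (S.q (ε * s) 0 - w) := by
    rw [← blockQ_sub, laxU, laxU]; abel
  rw [hU, zero_mulVec, zero_add, mulVec_zero, add_zero, smul_mulVec, mul_add, add_mulVec,
    ← mulVec_mulVec, laxU_mulVec_Gam he.norm hS.q0_pos.ne' hz, ← mulVec_mulVec]
  simp only [propagate, mulVec_smul, mulVec_add, smul_add, smul_smul]
  rw [add_right_comm, ← add_smul]
  rw [show Complex.exp (-(Complex.I * S.nu j z * ε) * ((x - s : ℝ) : ℂ)) *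
      (-(ε : ℂ) * (Complex.I * S.nu j z)) + Complex.I * S.nu j z * ε *
        Complex.exp (-(Complex.I * S.nu j z * ε) * ((x - s : ℝ) : ℂ)) = 0 by ring, zero_smul,
    zero_add, mul_comm]

/-- The total variation left after `s`. -/
def tailBound (S : Potential) (w : Fin 2 → ℂ) (ε s : ℝ) : ℝ :=
  (∫ r in Ioi (0 : ℝ), ‖S.q (ε * r) 0 - w‖) - ∫ r in (0 : ℝ)..s, ‖S.q (ε * r) 0 - w‖

lemma tendsto_tailBound (he : S.IsEnd l w ε) : Tendsto (S.tailBound w ε) atTop (𝓝 0) := by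
  have := intervalIntegral_tendsto_integral_Ioi (0 : ℝ) he.integrable.norm tendsto_id
  have h := (tendsto_const_nhds (x := ∫ r in Ioi (0 : ℝ), ‖S.q (ε * r) 0 - w‖)).sub this
  rwa [sub_self] at h

/-- The bound on the derivative in the starting point is integrated from `s` to `s'`; the result
depends on `s` only through the tail of `‖q - w‖`, which gives the Cauchy property. -/
lemma norm_propagate_sub_le (hF : S.IsFundamental F) (hS : S.IsSolution) (he : S.IsEnd l w ε)
    {j : Fin 3} {z : ℂ} (hz : z ≠ 0) {C : ℝ} (hst : BackwardStable (S.normalizedU ε j z) C)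
    (hC : 0 ≤ C) {x s s' : ℝ} (hx : 0 ≤ x) (hxs : x ≤ s) (hs : s ≤ s') :
    ‖S.propagate F ε j z (fun i => S.Gam w z i j) s' x
      - S.propagate F ε j z (fun i => S.Gam w z i j) s x‖
      ≤ 2 * C * ‖fun i => S.Gam w z i j‖ * S.tailBound w ε s := by
  set g : Fin 3 → ℂ := fun i => S.Gam w z i j with hg
  have hqc := (continuous_q_end hS w ε).norm
  have hB : ∀ r, HasDerivAt (fun r => 2 * C * ‖g‖ * ∫ r in s..r, ‖S.q (ε * r) 0 - w‖)
      (2 * C * ‖g‖ * ‖S.q (ε * r) 0 - w‖) r := fun r =>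
    (hqc.integral_hasStrictDerivAt s r).hasDerivAt.const_mul _
  have hd := fun r => hasDerivAt_propagate_Gam hF hS he j hz x r
  have hmain := image_norm_le_of_norm_deriv_right_le_deriv_boundary (a := s) (b := s')
    (f := fun r => S.propagate F ε j z g r x - S.propagate F ε j z g s x)
    (fun r _ => ((hd r).sub_const _).continuousAt.continuousWithinAt)
    (fun r _ => ((hd r).sub_const _).hasDerivWithinAt) (by simp) hB
    (fun r hr => ?_) (right_mem_Icc.2 hs)
  · refine hmain.trans (mul_le_mul_of_nonneg_left ?_ (by positivity))
    rw [tailBound, ← intervalIntegral.integral_interval_sub_left (a := 0)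
      (hqc.intervalIntegrable _ _) (hqc.intervalIntegrable _ _)]
    exact sub_le_sub_right (intervalIntegral_le_Ioi he.integrable.norm (fun _ => norm_nonneg _) le_rfl
      (hx.trans (hxs.trans hs))) _
  · rw [norm_smul, norm_neg, Complex.norm_real, Real.norm_eq_abs, he.abs_sign, one_mul]
    calc _ ≤ C * ‖blockQ (S.q (ε * r) 0 - w) *ᵥ g‖ :=
          norm_propagate_le hF hst _ hx (hxs.trans hr.1)
      _ ≤ C * ((2 * ‖S.q (ε * r) 0 - w‖) * ‖g‖) := by
          gcongr
          refine (Matrix.linfty_opNorm_mulVec _ _).trans ?_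
          gcongr
          exact norm_blockQ_le _
      _ = 2 * C * ‖g‖ * ‖S.q (ε * r) 0 - w‖ := by ring

/-- The initial value at the origin of the Jost solution, as the limit of the normalized backward
propagations of `Γ_j`; it depends continuously, resp. holomorphically, on the spectral parameter. -/
theorem exists_jostVector (hF : S.IsFundamental F) (hS : S.IsSolution) (he : S.IsEnd l w ε)
    (j : Fin 3) {R : Set ℂ} {C : ℂ → ℝ} (hR : ∀ z ∈ R, z ≠ 0) (hC : ContinuousOn C R)
    (hC0 : ∀ z, 0 ≤ C z) (hst : ∀ z ∈ R, BackwardStable (S.normalizedU ε j z) (C z)) :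
    ∃ v : ℂ → Fin 3 → ℂ, ContinuousOn v R ∧ (∀ O, IsOpen O → O ⊆ R → DifferentiableOn ℂ v O) ∧
      ∀ z ∈ R, Tendsto (fun x => Complex.exp (-(Complex.I * S.nu j z * ε) * ((x - 0 : ℝ) : ℂ)) •
        (F (ε * x) 0 (S.k z) *ᵥ v z)) atTop (𝓝 fun i => S.Gam w z i j) := by
  set h : ℕ → ℂ → Fin 3 → ℂ := fun n z => S.propagate F ε j z (fun i => S.Gam w z i j) n 0 with hh
  have hτ := tendsto_tailBound he
  have hτn : Tendsto (fun n : ℕ => S.tailBound w ε n) atTop (𝓝 0) :=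
    hτ.comp tendsto_natCast_atTop_atTop
  set K : ℂ → ℝ := fun z => 2 * C z * ‖fun i => S.Gam w z i j‖ with hK
  have hK0 : ∀ z, 0 ≤ K z := fun z => by have := hC0 z; positivity
  have hKc : ContinuousOn K R := by
    have : ContinuousOn (fun z i => S.Gam w z i j) R := fun z hz =>
      (differentiableAt_Gam w (hR z hz) j).continuousAt.continuousWithinAt
    exact (continuousOn_const.mul hC).mul this.norm
  have hτ0 : ∀ s, 0 ≤ s → 0 ≤ S.tailBound w ε s := fun s hs =>
    sub_nonneg.2 (intervalIntegral_le_Ioi he.integrable.norm (fun _ => norm_nonneg _) le_rfl hs)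
  have hdist : ∀ z ∈ R, ∀ n m N : ℕ, N ≤ n → n ≤ m → dist (h m z) (h n z)
      ≤ K z * S.tailBound w ε n := fun z hz n m N _ hnm => by
    rw [dist_eq_norm]
    exact norm_propagate_sub_le hF hS he (hR z hz) (hst z hz) (hC0 z) le_rfl (Nat.cast_nonneg n)
      (Nat.cast_le.2 hnm)
  have hcauchy : ∀ z ∈ R, ∃ v, Tendsto (fun n => h n z) atTop (𝓝 v) := fun z hz => by
    refine cauchySeq_tendsto_of_complete (cauchySeq_of_le_tendsto_0'
      (fun n : ℕ => K z * S.tailBound w ε n) (fun n m hnm => ?_) ?_)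
    · rw [dist_comm]; exact hdist z hz n m n le_rfl hnm
    · simpa using hτn.const_mul (K z)
  classical
  set v : ℂ → Fin 3 → ℂ := fun z => if hz : z ∈ R then (hcauchy z hz).choose else 0 with hv
  have hlim : ∀ z ∈ R, Tendsto (fun n => h n z) atTop (𝓝 (v z)) := fun z hz => by
    have : v z = (hcauchy z hz).choose := dif_pos hz
    rw [this]; exact (hcauchy z hz).choose_spec
  -- The error at `z` is at most `K z` times a tail that does not depend on `z`, and `K` is
  -- continuous on `R`. Locally uniform limits keep continuity on `R` and holomorphy on its open
  -- subsets.
  have hunif : TendstoLocallyUniformlyOn h v atTop R := by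
    rw [Metric.tendstoLocallyUniformlyOn_iff]
    intro δ hδ z hz
    have hlt : ∀ᶠ y in 𝓝[R] z, K y < K z + 1 :=
      (hKc z hz).eventually_lt_const (by linarith)
    refine ⟨{y | K y < K z + 1} ∩ R, inter_mem hlt self_mem_nhdsWithin, ?_⟩
    have hsmall : ∀ᶠ n : ℕ in atTop, (K z + 1) * S.tailBound w ε n < δ := by
      have : Tendsto (fun n : ℕ => (K z + 1) * S.tailBound w ε n) atTop (𝓝 0) := by
        simpa using hτn.const_mul (K z + 1)
      exact this.eventually_lt_const hδ
    filter_upwards [hsmall] with n hn y hy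
    refine lt_of_le_of_lt ?_ hn
    have h1 : dist (v y) (h n y) ≤ K y * S.tailBound w ε n :=
      le_of_tendsto ((hlim y hy.2).dist tendsto_const_nhds)
        ((eventually_ge_atTop n).mono fun m hm => hdist y hy.2 n m n le_rfl hm)
    exact h1.trans (mul_le_mul_of_nonneg_right (le_of_lt hy.1) (hτ0 _ (Nat.cast_nonneg n)))
  have hk : ∀ z, z ≠ 0 → DifferentiableAt ℂ S.k z := fun z hz => by
    unfold k
    exact (differentiableAt_id.sub ((differentiableAt_const _).div differentiableAt_id hz)).div_const _
  have hlam : ∀ z, z ≠ 0 → DifferentiableAt ℂ S.lam z := fun z hz => by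
    unfold lam
    exact (differentiableAt_id.add ((differentiableAt_const _).div differentiableAt_id hz)).div_const _
  have hnu : ∀ z, z ≠ 0 → DifferentiableAt ℂ (S.nu j) z := fun z hz => by
    fin_cases j
    · exact hlam z hz
    · exact hk z hz
    · exact (hlam z hz).neg
  have hhd : ∀ n z, z ≠ 0 → DifferentiableAt ℂ (h n) z := fun n z hz => by
    have hadj : DifferentiableAt ℂ (fun z => (F (ε * n) 0 (conj (S.k z)))ᴴ) z :=
      (hF.differentiable_adj _ _ _).comp z (hk z hz)
    have hFz : DifferentiableAt ℂ (fun z => F (ε * 0) 0 (S.k z)) z :=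
      (hF.differentiable _ _ _).comp z (hk z hz)
    have hexp : DifferentiableAt ℂ (fun z => Complex.exp (-(Complex.I * S.nu j z * ε) *
        ((0 - (n : ℝ) : ℝ) : ℂ))) z :=
      ((((hnu z hz).const_mul _).mul_const _).neg.mul_const _).cexp
    exact hexp.smul (hFz.hasDerivAt.matrix_mulVec
      (hadj.hasDerivAt.matrix_mulVec (differentiableAt_Gam w hz j).hasDerivAt)).differentiableAt
  refine ⟨v, hunif.continuousOn (Frequently.of_forall fun n z hz =>
      (hhd n z (hR z hz)).continuousAt.continuousWithinAt), fun O hO hOR =>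
      (hunif.mono hOR).differentiableOn (Eventually.of_forall fun n z hz =>
        (hhd n z (hR z (hOR hz))).differentiableWithinAt) hO, fun z hz => ?_⟩
  have hF0 : F (ε * 0) 0 (S.k z) = 1 := by rw [mul_zero]; exact hF.zero _
  -- Propagating the limit vector out to `x` amounts to letting the starting point tend to infinity
  -- in the propagation back to `x`. Comparison with the starting point `x` itself, where the value
  -- is `Γ_j`, costs only the tail beyond `x`.
  have hkey : ∀ x, 0 ≤ x → ‖Complex.exp (-(Complex.I * S.nu j z * ε) * ((x - 0 : ℝ) : ℂ)) •
      (F (ε * x) 0 (S.k z) *ᵥ v z) - (fun i => S.Gam w z i j)‖ ≤ K z * S.tailBound w ε x := by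
    intro x hx
    have hcont : Continuous fun y : Fin 3 → ℂ =>
        Complex.exp (-(Complex.I * S.nu j z * ε) * ((x - 0 : ℝ) : ℂ)) •
          (F (ε * x) 0 (S.k z) *ᵥ y) := by fun_prop
    have hprop : ∀ n : ℕ, Complex.exp (-(Complex.I * S.nu j z * ε) * ((x - 0 : ℝ) : ℂ)) •
          (F (ε * x) 0 (S.k z) *ᵥ h n z) = S.propagate F ε j z (fun i => S.Gam w z i j) n x :=
      fun n => by
        simp only [hh, propagate, hF0, one_mulVec, mulVec_smul, smul_smul, ← Complex.exp_add]
        congr 2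
        push_cast; ring
    have hl := (hcont.tendsto (v z)).comp (hlim z hz)
    have hl' := (hl.sub_const (fun i => S.Gam w z i j)).norm
    refine le_of_tendsto hl' ((eventually_ge_atTop ⌈x⌉₊).mono fun n hn => ?_)
    have := norm_propagate_sub_le hF hS he (hR z hz) (hst z hz) (hC0 z) hx le_rfl (Nat.ceil_le.1 hn)
    rw [propagate_self hF] at this
    simpa only [Function.comp_apply, hprop] using this
  rw [tendsto_iff_norm_sub_tendsto_zero]
  refine squeeze_zero' (Eventually.of_forall fun _ => norm_nonneg _)
    ((eventually_ge_atTop 0).mono fun x hx => hkey x hx) ?_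
  simpa using hτ.const_mul (K z)

end Potential

/-! ### A Gronwall bound with integrable forcing. -/

section Forced

open scoped Matrix.Norms.Operator
open Set

variable {n : Type*} [Fintype n]

/-- Gronwall's inequality is applied to `d - ∫f`, whose derivative is `A d`. The forcing thus enters
through its integral rather than its supremum, as dominated convergence will require. -/
lemma norm_le_of_forced_linear_nonneg {A : ℝ → Matrix n n ℂ} {d f : ℝ → n → ℂ} {C t : ℝ} (hC : 0 < C)
    (ht : 0 ≤ t) (hA : ∀ s ∈ Icc 0 t, ‖A s‖ ≤ C) (hf : Continuous f)
    (hd : ∀ s, HasDerivAt d (A s *ᵥ d s + f s) s) :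
    ‖d t‖ ≤ (‖d 0‖ + ∫ s in (0 : ℝ)..t, ‖f s‖) * Real.exp (C * t) := by
  set I₀ := ∫ s in (0 : ℝ)..t, ‖f s‖ with hI₀
  have hI : ∀ s ∈ Icc 0 t, ‖∫ r in (0 : ℝ)..s, f r‖ ≤ I₀ := fun s hs =>
    (intervalIntegral.norm_integral_le_integral_norm hs.1).trans
      (intervalIntegral.integral_mono_interval le_rfl hs.1 hs.2
        (Eventually.of_forall fun _ => norm_nonneg _) (hf.norm.intervalIntegrable _ _))
  have hg : ∀ s, HasDerivAt (fun s => d s - ∫ r in (0 : ℝ)..s, f r) (A s *ᵥ d s) s := fun s =>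
    ((hd s).sub (hf.integral_hasStrictDerivAt 0 s).hasDerivAt).congr_deriv (by abel)
  have hgr := norm_le_gronwallBound_of_norm_deriv_right_le (a := 0) (b := t)
    (f := fun s => d s - ∫ r in (0 : ℝ)..s, f r) (δ := ‖d 0‖) (K := C) (ε := C * I₀)
    (fun s _ => (hg s).continuousAt.continuousWithinAt) (fun s _ => (hg s).hasDerivWithinAt)
    (by simp)
    (fun s hs => by
      have hs' : s ∈ Icc 0 t := ⟨hs.1, hs.2.le⟩
      have h1 : ‖d s‖ ≤ ‖d s - ∫ r in (0 : ℝ)..s, f r‖ + I₀ := by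
        have := norm_add_le (d s - ∫ r in (0 : ℝ)..s, f r) (∫ r in (0 : ℝ)..s, f r)
        rw [sub_add_cancel] at this
        linarith [hI s hs']
      calc ‖A s *ᵥ d s‖ ≤ ‖A s‖ * ‖d s‖ := Matrix.linfty_opNorm_mulVec _ _
        _ ≤ C * (‖d s - ∫ r in (0 : ℝ)..s, f r‖ + I₀) :=
          mul_le_mul (hA s hs') h1 (norm_nonneg _) hC.le
        _ = _ := by ring) t ⟨ht, le_rfl⟩
  rw [gronwallBound_of_K_ne_0 hC.ne', sub_zero, mul_div_cancel_left₀ _ hC.ne'] at hgr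
  have h2 := norm_add_le (d t - ∫ r in (0 : ℝ)..t, f r) (∫ r in (0 : ℝ)..t, f r)
  rw [sub_add_cancel] at h2
  have h3 := hI t ⟨ht, le_rfl⟩
  calc ‖d t‖ ≤ ‖d 0‖ * Real.exp (C * t) + I₀ * (Real.exp (C * t) - 1) + I₀ := by linarith
    _ = _ := by ring

lemma norm_le_of_forced_linear {A : ℝ → Matrix n n ℂ} {d f : ℝ → n → ℂ} {C t : ℝ} (hC : 0 < C)
    (hA : ∀ s, |s| ≤ |t| → ‖A s‖ ≤ C) (hf : Continuous f)
    (hd : ∀ s, HasDerivAt d (A s *ᵥ d s + f s) s) :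
    ‖d t‖ ≤ (‖d 0‖ + |∫ s in (0 : ℝ)..t, ‖f s‖|) * Real.exp (C * |t|) := by
  rcases le_total 0 t with ht | ht
  · rw [abs_of_nonneg ht, abs_of_nonneg
      (intervalIntegral.integral_nonneg ht fun _ _ => norm_nonneg _)]
    exact norm_le_of_forced_linear_nonneg hC ht (fun s hs => hA s (by
      rw [abs_of_nonneg hs.1]; exact hs.2.trans (le_abs_self t))) hf hd
  · have h := norm_le_of_forced_linear_nonneg (A := fun s => -A (-s)) (d := fun s => d (-s))
      (f := fun s => -f (-s)) (t := -t) hC (neg_nonneg.2 ht)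
      (fun s hs => by
        rw [norm_neg]
        exact hA _ (by rw [abs_neg, abs_of_nonneg hs.1, abs_of_nonpos ht]; exact hs.2))
      (hf.comp continuous_neg).neg (fun s => by
        have := (hd (-s)).scomp s (hasDerivAt_neg s)
        refine this.congr_deriv ?_
        rw [neg_smul, one_smul, neg_mulVec, neg_add])
    have e : ∫ s in (0 : ℝ)..-t, ‖-f (-s)‖ = -∫ s in (0 : ℝ)..t, ‖f s‖ := by
      simp only [norm_neg]
      rw [intervalIntegral.integral_comp_neg (fun s => ‖f s‖), intervalIntegral.integral_symm]
      simp
    rw [e, neg_neg, neg_zero] at h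
    rw [abs_of_nonpos ht]
    refine h.trans (mul_le_mul_of_nonneg_right ?_ (Real.exp_pos _).le)
    gcongr
    exact neg_le_abs _

end Forced

/-! ### Time evolution of the asymptotics, and uniqueness of Jost solutions. -/

namespace Potential

open MeasureTheory Set
open scoped Matrix.Norms.Operator

variable {S : Potential} {F : ℝ → ℝ → ℂ → Matrix (Fin 3) (Fin 3) ℂ} {l : Filter ℝ}
  {w : Fin 2 → ℂ} {ε : ℝ}

lemma tendsto_laxV_end (he : S.IsEnd l w ε) (κ : ℂ) (t : ℝ) :
    Tendsto (fun x => laxV κ (S.q x t) (S.qx x t) (S.qxx x t)) l (𝓝 (laxV κ w 0 0)) := by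
  have hc : Continuous fun p : (Fin 2 → ℂ) × (Fin 2 → ℂ) × (Fin 2 → ℂ) =>
      laxV κ p.1 p.2.1 p.2.2 :=
    continuous_laxV continuous_const continuous_fst (continuous_fst.comp continuous_snd)
      (continuous_snd.comp continuous_snd)
  have h : Tendsto (fun x => (S.q x t, S.qx x t, S.qxx x t)) l (𝓝 (w, 0, 0)) :=
    (he.tendsto_q t).prodMk_nhds ((he.tendsto_qx t).prodMk_nhds (he.tendsto_qxx t))
  have h' := (hc.tendsto (w, 0, 0)).comp h
  simpa only [Function.comp_def] using h'

/-- The boundedness of `q`, `q_x`, `q_xx` on strips confines the arguments of `V` to a compact set.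
The bound dominates the time integrals in the limit of large `|x|`. -/
lemma exists_norm_laxV_le (hS : S.IsSolution) (κ : ℂ) (T : ℝ) :
    ∃ C : ℝ, ∀ x t, |t| ≤ T → ‖laxV κ (S.q x t) (S.qx x t) (S.qxx x t)‖ ≤ C := by
  have hc : Continuous fun p : (Fin 2 → ℂ) × (Fin 2 → ℂ) × (Fin 2 → ℂ) =>
      laxV κ p.1 p.2.1 p.2.2 :=
    continuous_laxV continuous_const continuous_fst (continuous_fst.comp continuous_snd)
      (continuous_snd.comp continuous_snd)
  obtain ⟨M, hM⟩ := hS.bounded T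
  obtain ⟨C, hC⟩ := ((isCompact_closedBall (0 : Fin 2 → ℂ) M).prod
    ((isCompact_closedBall (0 : Fin 2 → ℂ) M).prod
      (isCompact_closedBall (0 : Fin 2 → ℂ) M))).exists_bound_of_continuousOn hc.continuousOn
  refine ⟨C, fun x t ht => hC (S.q x t, S.qx x t, S.qxx x t) ?_⟩
  obtain ⟨h0, h1, h2⟩ := hM x t ht
  simp [h0, h1, h2]

/-- The deviation `d` of the normalized solution from `Γ_j` satisfies a linear `t`-equation with
forcing `(V - iω_j) Γ_j`. At the end of the line `V` tends to its background value, of which `Γ_j`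
is an eigenvector, so the forcing tends to zero; the deviation at `t = 0` tends to zero by
assumption. -/
lemma tendsto_time (hF : S.IsFundamental F) (hS : S.IsSolution) (he : S.IsEnd l w ε) (j : Fin 3)
    {z : ℂ} (hz : z ≠ 0) {v : Fin 3 → ℂ}
    (h0 : Tendsto (fun x => Complex.exp (-Complex.I * S.theta j x 0 z) • (F x 0 (S.k z) *ᵥ v)) l
      (𝓝 fun i => S.Gam w z i j)) (t : ℝ) :
    Tendsto (fun x => Complex.exp (-Complex.I * S.theta j x t z) • (F x t (S.k z) *ᵥ v)) l
      (𝓝 fun i => S.Gam w z i j) := by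
  have : l.IsCountablyGenerated := by rw [he.filter]; infer_instance
  set g : Fin 3 → ℂ := fun i => S.Gam w z i j with hg
  set A : ℝ → ℝ → Matrix (Fin 3) (Fin 3) ℂ := fun x s =>
    laxV (S.k z) (S.q x s) (S.qx x s) (S.qxx x s) - (Complex.I * S.om j z) • 1 with hA
  set d : ℝ → ℝ → Fin 3 → ℂ := fun x s =>
    Complex.exp (-Complex.I * S.theta j x s z) • (F x s (S.k z) *ᵥ v) - g with hd
  have hAc : ∀ x, Continuous (A x) := fun x =>
    (continuous_laxV continuous_const (S.continuous_q_right hS x) (S.continuous_qx_right hS x)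
      (S.continuous_qxx_right hS x)).sub continuous_const
  have hder : ∀ x s, HasDerivAt (d x) (A x s *ᵥ d x s + A x s *ᵥ g) s := fun x s => by
    have he : HasDerivAt (fun s : ℝ => Complex.exp (-Complex.I * S.theta j x s z))
        (-(Complex.I * S.om j z) * Complex.exp (-Complex.I * S.theta j x s z)) s := by
      have h1 : HasDerivAt (fun s : ℝ => -Complex.I * S.theta j x s z)
          (-Complex.I * S.om j z) s := by
        simp only [theta_eq]
        have := ((Complex.ofRealCLM.hasDerivAt (x := s)).const_mul (S.om j z)).const_add
          (S.nu j z * x)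
        simpa using this.const_mul (-Complex.I)
      exact h1.cexp.congr_deriv (by ring)
    have h2 := (he.smul ((hF.deriv_t x s (S.k z)).matrix_mulVec (hasDerivAt_const s v))).sub_const g
    refine h2.congr_deriv ?_
    rw [← mulVec_add]
    simp only [hd, hA, sub_add_cancel, mulVec_zero, add_zero, sub_mulVec, smul_mulVec, one_mulVec,
      mulVec_smul, ← mulVec_mulVec]
    module
  obtain ⟨C₀, hC₀⟩ := exists_norm_laxV_le hS (S.k z) |t|
  set C := |C₀| + ‖(Complex.I * S.om j z) • (1 : Matrix (Fin 3) (Fin 3) ℂ)‖ + 1 with hC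
  have hC1 : 0 < C := by positivity
  have hAb : ∀ x s, |s| ≤ |t| → ‖A x s‖ ≤ C := fun x s hs => by
    refine (norm_sub_le _ _).trans ?_
    linarith [hC₀ x s hs, le_abs_self C₀]
  have hbound : ∀ x, ‖d x t‖ ≤ (‖d x 0‖ + |∫ s in (0 : ℝ)..t, ‖A x s *ᵥ g‖|) * Real.exp (C * |t|) :=
    fun x => norm_le_of_forced_linear hC1 (hAb x) ((hAc x).matrix_mulVec continuous_const) (hder x)
  have hint : Tendsto (fun x => ∫ s in (0 : ℝ)..t, ‖A x s *ᵥ g‖) l (𝓝 0) := by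
    have := intervalIntegral.tendsto_integral_filter_of_dominated_convergence (a := 0) (b := t)
      (μ := volume) (l := l) (F := fun x s => ‖A x s *ᵥ g‖) (f := fun _ => (0 : ℝ))
      (fun _ => C * ‖g‖)
      (Eventually.of_forall fun x =>
        ((hAc x).matrix_mulVec continuous_const).norm.aestronglyMeasurable)
      (Eventually.of_forall fun x => Eventually.of_forall fun s hs => by
        rw [norm_norm]
        refine (Matrix.linfty_opNorm_mulVec _ _).trans (mul_le_mul_of_nonneg_right (hAb x s ?_)
          (norm_nonneg _))
        simpa using abs_sub_left_of_mem_uIcc (uIoc_subset_uIcc hs))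
      (by simp)
      (Eventually.of_forall fun s _ => by
        have h1 : Tendsto (fun x => A x s *ᵥ g) l
            (𝓝 ((laxV (S.k z) w 0 0 - (Complex.I * S.om j z) • 1) *ᵥ g)) := by
          have hc : Continuous fun N : Matrix (Fin 3) (Fin 3) ℂ => N *ᵥ g :=
            continuous_id.matrix_mulVec continuous_const
          exact (hc.tendsto _).comp ((tendsto_laxV_end he (S.k z) s).sub_const _)
        rw [sub_mulVec, laxV_mulVec_Gam he.norm hS.q0_pos.ne' hz, smul_mulVec, one_mulVec,
          sub_self] at h1
        simpa using h1.norm)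
    simpa using this
  have hd0 : Tendsto (fun x => ‖d x 0‖) l (𝓝 0) := by
    have : Tendsto (fun x => ‖d x 0‖) l (𝓝 ‖g - g‖) := (h0.sub_const g).norm
    rwa [sub_self, norm_zero] at this
  have hdt : Tendsto (fun x => d x t) l (𝓝 0) := by
    rw [tendsto_zero_iff_norm_tendsto_zero]
    refine squeeze_zero (fun _ => norm_nonneg _) hbound ?_
    simpa using (hd0.add hint.abs).mul_const (Real.exp (C * |t|))
  simpa [hd] using hdt.add_const g

lemma tendsto_end_iff (he : S.IsEnd l w ε) (j : Fin 3) (z : ℂ) (v : Fin 3 → ℂ) (p : Filter (Fin 3 → ℂ)) :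
    Tendsto (fun x => Complex.exp (-Complex.I * S.theta j x 0 z) • (F x 0 (S.k z) *ᵥ v)) l p ↔
    Tendsto (fun s => Complex.exp (-(Complex.I * S.nu j z * ε) * ((s - 0 : ℝ) : ℂ)) •
        (F (ε * s) 0 (S.k z) *ᵥ v)) atTop p := by
  rw [he.filter, tendsto_map'_iff]
  refine tendsto_congr fun s => ?_
  simp only [Function.comp_apply, theta_eq]
  congr 2
  push_cast; ring

theorem isJost_of_tendsto (hF : S.IsFundamental F) (hS : S.IsSolution) (he : S.IsEnd l w ε)
    (j : Fin 3) {z : ℂ} (hz : z ≠ 0) {v : Fin 3 → ℂ}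
    (h : Tendsto (fun s => Complex.exp (-(Complex.I * S.nu j z * ε) * ((s - 0 : ℝ) : ℂ)) •
        (F (ε * s) 0 (S.k z) *ᵥ v)) atTop (𝓝 fun i => S.Gam w z i j)) :
    S.IsJost l w j z (fun x t => F x t (S.k z) *ᵥ v) := by
  refine ⟨fun x t => ?_, fun x t => ?_, tendsto_time hF hS he j hz ((tendsto_end_iff he j z v _).2 h)⟩
  · refine ((hF.deriv_x x t (S.k z)).matrix_mulVec (hasDerivAt_const x v)).congr_deriv ?_
    rw [mulVec_zero, add_zero, ← mulVec_mulVec]; rfl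
  · refine ((hF.deriv_t x t (S.k z)).matrix_mulVec (hasDerivAt_const t v)).congr_deriv ?_
    rw [mulVec_zero, add_zero, ← mulVec_mulVec]; rfl

/-- Every simultaneous solution of the Lax pair is a constant combination of the columns of the
fundamental matrix. -/
theorem eq_fundamental_mulVec (hF : S.IsFundamental F) {κ : ℂ} {φ : ℝ → ℝ → Fin 3 → ℂ}
    (hx : ∀ x t, HasDerivAt (fun y => φ y t) (laxU κ (S.q x t) *ᵥ φ x t) x)
    (ht : ∀ x t, HasDerivAt (fun r => φ x r)
      (laxV κ (S.q x t) (S.qx x t) (S.qxx x t) *ᵥ φ x t) t) (x t : ℝ) :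
    φ x t = F x t κ *ᵥ φ 0 0 := by
  have key : ∀ {Y : ℝ → Matrix (Fin 3) (Fin 3) ℂ} {N : ℝ → Matrix (Fin 3) (Fin 3) ℂ}
      {f : ℝ → Fin 3 → ℂ}, (∀ s, HasDerivAt Y (-(Y s * N s)) s) → (∀ s, HasDerivAt f (N s *ᵥ f s) s) →
      ∀ s, Y s *ᵥ f s = Y 0 *ᵥ f 0 := fun {Y N f} hY hf s => by
    have hd : ∀ s, HasDerivAt (fun s => Y s *ᵥ f s) 0 s := fun s =>
      ((hY s).matrix_mulVec (hf s)).congr_deriv (by rw [neg_mulVec, mulVec_mulVec]; abel)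
    exact is_const_of_deriv_eq_zero (fun s => (hd s).differentiableAt) (fun s => (hd s).deriv) s 0
  -- Multiplication by the inverse `F(κ^*)†` removes the dependence on `t` at fixed `x`, and then
  -- the dependence on `x` along `t = 0`.
  have h1 := key (Y := fun r => (F x r (conj κ))ᴴ)
    (N := fun r => laxV κ (S.q x r) (S.qx x r) (S.qxx x r)) (f := fun r => φ x r)
    (fun s => by
      have : HasDerivAt (fun s => (F x s (conj κ))ᴴ)
          ((laxV (conj κ) (S.q x s) (S.qx x s) (S.qxx x s) * F x s (conj κ))ᴴ) s :=
        hasDerivAt_matrix.2 fun i j => (hasDerivAt_matrix.1 (hF.deriv_t x s (conj κ)) j i).star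
      refine this.congr_deriv ?_
      rw [conjTranspose_mul, conjTranspose_laxV, mul_neg]) (ht x) t
  have h2 := key (Y := fun y => (F y 0 (conj κ))ᴴ)
    (N := fun y => laxU κ (S.q y 0)) (f := fun y => φ y 0)
    (fun s => by
      have : HasDerivAt (fun s => (F s 0 (conj κ))ᴴ)
          ((laxU (conj κ) (S.q s 0) * F s 0 (conj κ))ᴴ) s :=
        hasDerivAt_matrix.2 fun i j => (hasDerivAt_matrix.1 (hF.deriv_x s 0 (conj κ)) j i).star
      refine this.congr_deriv ?_
      rw [conjTranspose_mul, conjTranspose_laxU, mul_neg]) (fun y => hx y 0) x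
  have h3 := h1.trans h2
  have := congrArg (F x t κ *ᵥ ·) h3
  simpa [mulVec_mulVec, hF.mul_adj, hF.zero] using this

/-- The normalized difference of two Jost solutions tends to zero at the end of the line, and
backward stability carries this zero to the origin. -/
theorem IsJost.unique (hF : S.IsFundamental F) (he : S.IsEnd l w ε) {j : Fin 3} {z : ℂ} {C : ℝ}
    (hst : BackwardStable (S.normalizedU ε j z) C) {φ φ' : ℝ → ℝ → Fin 3 → ℂ}
    (h : S.IsJost l w j z φ) (h' : S.IsJost l w j z φ') : φ = φ' := by
  have e := eq_fundamental_mulVec hF h.1 h.2.1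
  have e' := eq_fundamental_mulVec hF h'.1 h'.2.1
  have hlim := (h.2.2 0).sub (h'.2.2 0)
  have e'' : ∀ x, Complex.exp (-Complex.I * S.theta j x 0 z) • φ x 0
      - Complex.exp (-Complex.I * S.theta j x 0 z) • φ' x 0
      = Complex.exp (-Complex.I * S.theta j x 0 z) • (F x 0 (S.k z) *ᵥ (φ 0 0 - φ' 0 0)) := fun x => by
    rw [e x 0, e' x 0, mulVec_sub, smul_sub]
  simp only [e'', sub_self] at hlim
  rw [tendsto_end_iff he] at hlim
  have hz : φ 0 0 - φ' 0 0 = 0 := by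
    have h1 := hst _ (fun x => hasDerivAt_normalized hF ε j z (φ 0 0 - φ' 0 0) 0 x)
    have h2 : ‖φ 0 0 - φ' 0 0‖ ≤ C * ‖(0 : Fin 3 → ℂ)‖ :=
      ge_of_tendsto (hlim.norm.const_mul C) ((eventually_ge_atTop 0).mono fun s hs => by
        simpa [hF.zero] using h1 0 s le_rfl hs)
    rw [norm_zero, mul_zero] at h2
    exact norm_le_zero_iff.1 h2
  funext x t
  rw [e x t, e' x t, sub_eq_zero.1 hz]

end Potential

/-! ### The Jost columns on their regions, the reflection symmetry and the pairings. -/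

namespace Potential

open Set

variable {S : Potential} {F : ℝ → ℝ → ℂ → Matrix (Fin 3) (Fin 3) ℂ} {l : Filter ℝ}
  {w : Fin 2 → ℂ} {ε : ℝ}

/-- Existence, uniqueness and regularity in `z ∈ R` of the `j`-th Jost solution. -/
structure JostColumn (S : Potential) (l : Filter ℝ) (w : Fin 2 → ℂ) (j : Fin 3) (R : Set ℂ) : Prop where
  isJost : ∀ z ∈ R, S.IsJost l w j z (S.jost l w j z)
  unique : ∀ z ∈ R, ∀ φ, S.IsJost l w j z φ → S.jost l w j z = φ
  cont : ContinuousOn (fun z => S.jost l w j z 0 0) R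
  diff : ∀ O, IsOpen O → O ⊆ R → DifferentiableOn ℂ (fun z => S.jost l w j z 0 0) O

lemma jost_isJost {j : Fin 3} {z : ℂ} {φ : ℝ → ℝ → Fin 3 → ℂ} (h : S.IsJost l w j z φ) :
    S.IsJost l w j z (S.jost l w j z) := by
  have hex : ∃ φ, S.IsJost l w j z φ := ⟨φ, h⟩
  rw [jost, dif_pos hex]
  exact hex.choose_spec

lemma jostColumn_of_stable (hF : S.IsFundamental F) (hS : S.IsSolution) (he : S.IsEnd l w ε)
    (j : Fin 3) {R : Set ℂ} {C : ℂ → ℝ} (hR : ∀ z ∈ R, z ≠ 0) (hC : ContinuousOn C R)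
    (hC0 : ∀ z, 0 ≤ C z) (hst : ∀ z ∈ R, BackwardStable (S.normalizedU ε j z) (C z)) :
    S.JostColumn l w j R := by
  obtain ⟨v, hvc, hvd, hvl⟩ := exists_jostVector hF hS he j hR hC hC0 hst
  have hJ : ∀ z ∈ R, S.IsJost l w j z (fun x t => F x t (S.k z) *ᵥ v z) := fun z hz =>
    isJost_of_tendsto hF hS he j (hR z hz) (hvl z hz)
  have huniq : ∀ z ∈ R, ∀ φ, S.IsJost l w j z φ → S.jost l w j z = φ := fun z hz φ hφ =>
    (jost_isJost hφ).unique hF he (hst z hz) hφ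
  have hv : EqOn (fun z => S.jost l w j z 0 0) v R := fun z hz => by
    simp [huniq z hz _ (hJ z hz), hF.zero]
  exact ⟨fun z hz => jost_isJost (hJ z hz), huniq, hvc.congr hv, fun O hO hOR =>
    (hvd O hO hOR).congr fun z hz => hv (hOR hz)⟩

lemma jostColumn_one (hF : S.IsFundamental F) (hS : S.IsSolution) (he : S.IsEnd l w ε) :
    S.JostColumn l w 1 (S.regJost ε 1) :=
  jostColumn_of_stable (C := fun _ => 2) hF hS he 1 (fun _ hz => hz.1) continuousOn_const
    (fun _ => zero_le_two) fun _ hz => backwardStable_one hz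

lemma jostColumn_two (hF : S.IsFundamental F) (hS : S.IsSolution) (he : S.IsEnd l w ε) :
    S.JostColumn l w 2 (S.regJost ε 2) :=
  jostColumn_of_stable hF hS he 2 (fun _ hz => hz.1) (continuousOn_stabConst w ε)
    (stabConst_nonneg w ε) fun _ hz => backwardStable_two hS he hz

/-! The involution `z ↦ -q₀²/z`. -/

lemma refl_ne_zero (hq : S.q0 ≠ 0) {z : ℂ} (hz : z ≠ 0) : S.refl z ≠ 0 :=
  div_ne_zero (neg_ne_zero.2 (pow_ne_zero 2 (by exact_mod_cast hq))) hz

lemma refl_refl (hq : S.q0 ≠ 0) {z : ℂ} (hz : z ≠ 0) : S.refl (S.refl z) = z := by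
  have hq' : (S.q0 : ℂ) ≠ 0 := by exact_mod_cast hq
  simp only [refl]; field_simp

lemma refl_conj (z : ℂ) : S.refl (conj z) = conj (S.refl z) := by simp [refl]

lemma k_refl (hq : S.q0 ≠ 0) {z : ℂ} (hz : z ≠ 0) : S.k (S.refl z) = S.k z := by
  have hq' : (S.q0 : ℂ) ≠ 0 := by exact_mod_cast hq
  simp only [refl, k]; field_simp; ring

lemma lam_refl (hq : S.q0 ≠ 0) {z : ℂ} (hz : z ≠ 0) : S.lam (S.refl z) = -S.lam z := by
  have hq' : (S.q0 : ℂ) ≠ 0 := by exact_mod_cast hq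
  simp only [refl, lam]; field_simp; ring

lemma theta1_refl (hq : S.q0 ≠ 0) {z : ℂ} (hz : z ≠ 0) (x t : ℝ) :
    S.theta1 x t (S.refl z) = -S.theta1 x t z := by
  simp only [theta1, k_refl hq hz, lam_refl hq hz]; ring

lemma theta2_refl (hq : S.q0 ≠ 0) {z : ℂ} (hz : z ≠ 0) (x t : ℝ) :
    S.theta2 x t (S.refl z) = S.theta2 x t z := by
  simp only [theta2, k_refl hq hz]

lemma gamma_refl (hq : S.q0 ≠ 0) {z : ℂ} (hz : z ≠ 0) : 1 + (S.q0 : ℂ) ^ 2 / (S.refl z) ^ 2 =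
    z ^ 2 / (S.q0 : ℂ) ^ 2 * (1 + (S.q0 : ℂ) ^ 2 / z ^ 2) := by
  have hq' : (S.q0 : ℂ) ≠ 0 := by exact_mod_cast hq
  simp only [refl]; field_simp; ring

lemma im_refl (z : ℂ) : (S.refl z).im = S.q0 ^ 2 / Complex.normSq z * z.im := by
  have : S.refl z = ((-S.q0 ^ 2 : ℝ) : ℂ) * z⁻¹ := by simp [refl, div_eq_mul_inv]
  rw [this, Complex.im_ofReal_mul, Complex.inv_im]; ring

lemma norm_refl (z : ℂ) : ‖S.refl z‖ = S.q0 ^ 2 / ‖z‖ := by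
  simp [refl]

lemma differentiableAt_refl {z : ℂ} (hz : z ≠ 0) : DifferentiableAt ℂ S.refl z :=
  (differentiableAt_const _).div differentiableAt_id hz

/-- Reflection leaves `k` unchanged, so the Lax pair is the same at both points; only the phase and
the normalization have to be matched. -/
lemma IsJost.map_refl (hq : S.q0 ≠ 0) {z : ℂ} (hz : z ≠ 0) {j j' : Fin 3} {c : ℂ}
    (hθ : ∀ x t, S.theta j' x t (S.refl z) = S.theta j x t z)
    (hΓ : ∀ i, S.Gam w (S.refl z) i j' = c * S.Gam w z i j) {φ : ℝ → ℝ → Fin 3 → ℂ}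
    (h : S.IsJost l w j z φ) : S.IsJost l w j' (S.refl z) (fun x t => c • φ x t) := by
  refine ⟨fun x t => ?_, fun x t => ?_, fun t => ?_⟩
  · have e : S.U x t (S.refl z) = S.U x t z := by simp only [U, k_refl hq hz]
    rw [e, mulVec_smul]; exact (h.1 x t).const_smul c
  · have e : S.V x t (S.refl z) = S.V x t z := by simp only [V, k_refl hq hz]
    rw [e, mulVec_smul]; exact (h.2.1 x t).const_smul c
  · have h1 := (h.2.2 t).const_smul c
    have e : (fun i => S.Gam w (S.refl z) i j') = c • fun i => S.Gam w z i j := funext fun i => hΓ i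
    rw [e]
    refine h1.congr fun x => ?_
    rw [hθ, smul_comm]

lemma IsJost.map_refl_two (hq : S.q0 ≠ 0) {z : ℂ} (hz : z ≠ 0) {φ : ℝ → ℝ → Fin 3 → ℂ}
    (h : S.IsJost l w 2 z φ) :
    S.IsJost l w 0 (S.refl z) (fun x t => (z / (Complex.I * S.q0)) • φ x t) := by
  have hq' : (S.q0 : ℂ) ≠ 0 := by exact_mod_cast hq
  refine h.map_refl hq hz (fun x t => by simp [theta, theta1_refl hq hz]) fun i => ?_
  fin_cases i <;> simp [Gam, refl] <;> field_simp
  simp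

lemma IsJost.map_refl_zero (hq : S.q0 ≠ 0) {z : ℂ} (hz : z ≠ 0) {φ : ℝ → ℝ → Fin 3 → ℂ}
    (h : S.IsJost l w 0 z φ) :
    S.IsJost l w 2 (S.refl z) (fun x t => (z / (Complex.I * S.q0)) • φ x t) := by
  have hq' : (S.q0 : ℂ) ≠ 0 := by exact_mod_cast hq
  refine h.map_refl hq hz (fun x t => by simp [theta, theta1_refl hq hz]) fun i => ?_
  fin_cases i <;> simp [Gam, refl] <;> field_simp <;> simp

lemma IsJost.map_refl_one (hq : S.q0 ≠ 0) {z : ℂ} (hz : z ≠ 0) {φ : ℝ → ℝ → Fin 3 → ℂ}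
    (h : S.IsJost l w 1 z φ) : S.IsJost l w 1 (S.refl z) φ := by
  have := h.map_refl (c := 1) hq hz (j' := 1) (fun x t => by simp [theta, theta2_refl hq hz])
    fun i => by fin_cases i <;> simp [Gam]
  simpa using this

lemma refl_mem_regJost_one (hq : S.q0 ≠ 0) {z : ℂ} (hz : z ∈ S.regJost ε 1) :
    S.refl z ∈ S.regJost ε 1 := by
  refine ⟨refl_ne_zero hq hz.1, ?_⟩
  rw [im_refl]
  have h2 : 0 ≤ S.q0 ^ 2 / Complex.normSq z := div_nonneg (sq_nonneg _) (Complex.normSq_nonneg _)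
  calc 0 ≤ S.q0 ^ 2 / Complex.normSq z * (ε * z.im) := mul_nonneg h2 hz.2
    _ = _ := by ring

lemma refl_mem_regJost_two (hq : S.q0 ≠ 0) {z : ℂ} (hz : z ∈ S.regJost ε 0) :
    S.refl z ∈ S.regJost ε 2 := by
  have hq' : (S.q0 : ℂ) ≠ 0 := by exact_mod_cast hq
  obtain ⟨h0, hi, hl, hg⟩ := hz
  refine ⟨refl_ne_zero hq h0, ?_, ?_, ?_⟩
  · rw [im_refl]
    have h2 : 0 ≤ S.q0 ^ 2 / Complex.normSq z := div_nonneg (sq_nonneg _) (Complex.normSq_nonneg _)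
    calc _ = S.q0 ^ 2 / Complex.normSq z * (ε * z.im) := by ring
      _ ≤ 0 := mul_nonpos_of_nonneg_of_nonpos h2 hi
  · rw [lam_refl hq h0, Complex.neg_im]; linarith
  · rw [gamma_refl hq h0]
    exact mul_ne_zero (div_ne_zero (pow_ne_zero 2 h0) (pow_ne_zero 2 hq')) hg

lemma refl_mem_regJost_zero (hq : S.q0 ≠ 0) {z : ℂ} (hz : z ∈ S.regJost ε 2) :
    S.refl z ∈ S.regJost ε 0 := by
  have hq' : (S.q0 : ℂ) ≠ 0 := by exact_mod_cast hq
  obtain ⟨h0, hi, hl, hg⟩ := hz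
  refine ⟨refl_ne_zero hq h0, ?_, ?_, ?_⟩
  · rw [im_refl]
    have h2 : 0 ≤ S.q0 ^ 2 / Complex.normSq z := div_nonneg (sq_nonneg _) (Complex.normSq_nonneg _)
    calc _ = S.q0 ^ 2 / Complex.normSq z * (ε * z.im) := by ring
      _ ≤ 0 := mul_nonpos_of_nonneg_of_nonpos h2 hi
  · rw [lam_refl hq h0, Complex.neg_im]; linarith
  · rw [gamma_refl hq h0]
    exact mul_ne_zero (div_ne_zero (pow_ne_zero 2 h0) (pow_ne_zero 2 hq')) hg

lemma jost_zero_eq (hF : S.IsFundamental F) (hS : S.IsSolution) (he : S.IsEnd l w ε) {z : ℂ}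
    (hz : z ∈ S.regJost ε 0) {φ : ℝ → ℝ → Fin 3 → ℂ} (hφ : S.IsJost l w 0 z φ) :
    φ = fun x t => (S.refl z / (Complex.I * S.q0)) • S.jost l w 2 (S.refl z) x t := by
  have hq := hS.q0_pos.ne'
  have hq' : (S.q0 : ℂ) ≠ 0 := by exact_mod_cast hq
  have hu := (jostColumn_two hF hS he).unique _ (refl_mem_regJost_two hq hz) _
    (hφ.map_refl_zero hq hz.1)
  have hz0 := hz.1
  funext x t
  rw [hu, smul_smul]
  have : S.refl z / (Complex.I * S.q0) * (z / (Complex.I * S.q0)) = 1 := by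
    simp only [refl]; field_simp; simp
  rw [this, one_smul]

/-- No separate energy estimate is needed: existence, uniqueness and regularity of the first column
are those of the third at the reflected point, up to an explicit factor. -/
lemma jostColumn_zero (hF : S.IsFundamental F) (hS : S.IsSolution) (he : S.IsEnd l w ε) :
    S.JostColumn l w 0 (S.regJost ε 0) := by
  have hq := hS.q0_pos.ne'
  have h2 := jostColumn_two hF hS he
  have hJ : ∀ z ∈ S.regJost ε 0, S.IsJost l w 0 z (S.jost l w 0 z) := fun z hz => by
    have := (h2.isJost _ (refl_mem_regJost_two hq hz)).map_refl_two hq (refl_ne_zero hq hz.1)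
    rw [refl_refl hq hz.1] at this
    exact jost_isJost this
  have heq : ∀ z ∈ S.regJost ε 0, S.jost l w 0 z 0 0
      = (S.refl z / (Complex.I * S.q0)) • S.jost l w 2 (S.refl z) 0 0 := fun z hz => by
    conv_lhs => rw [jost_zero_eq hF hS he hz (hJ z hz)]
  refine ⟨hJ, fun z hz φ hφ => (jost_zero_eq hF hS he hz (hJ z hz)).trans
    (jost_zero_eq hF hS he hz hφ).symm, ?_, fun O hO hOR => ?_⟩
  · refine ContinuousOn.congr ?_ heq
    have hr : ContinuousOn S.refl (S.regJost ε 0) := fun z hz =>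
      (differentiableAt_refl hz.1).continuousAt.continuousWithinAt
    exact (hr.div_const _).smul (h2.cont.comp hr fun z hz => refl_mem_regJost_two hq hz)
  · refine DifferentiableOn.congr ?_ fun z hz => heq z (hOR hz)
    have hr : DifferentiableOn ℂ S.refl O := fun z hz =>
      (differentiableAt_refl (hOR hz).1).differentiableWithinAt
    -- As reflection is an involution, the image of `O` is also its preimage within `z ≠ 0`, hence
    -- open.
    have hO' : IsOpen (O.image S.refl) := by
      have : O.image S.refl = {z | z ≠ 0} ∩ S.refl ⁻¹' O := by
        ext y
        constructor
        · rintro ⟨z, hz, rfl⟩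
          exact ⟨refl_ne_zero hq (hOR hz).1, by simpa [refl_refl hq (hOR hz).1] using hz⟩
        · rintro ⟨hy, hyO⟩
          exact ⟨S.refl y, hyO, refl_refl hq hy⟩
      rw [this]
      exact ContinuousOn.isOpen_inter_preimage
        (fun z hz => (differentiableAt_refl hz).continuousAt.continuousWithinAt) isOpen_ne hO
    refine (hr.div_const _).smul ((h2.diff _ hO' ?_).comp hr (mapsTo_image _ _))
    rintro _ ⟨z, hz, rfl⟩
    exact refl_mem_regJost_two hq (hOR hz)

lemma jostColumn (hF : S.IsFundamental F) (hS : S.IsSolution) (he : S.IsEnd l w ε) (j : Fin 3) :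
    S.JostColumn l w j (S.regJost ε j) := by
  fin_cases j
  · exact jostColumn_zero hF hS he
  · exact jostColumn_one hF hS he
  · exact jostColumn_two hF hS he

lemma jost_refl_two (hF : S.IsFundamental F) (hS : S.IsSolution) (he : S.IsEnd l w ε) {z : ℂ}
    (hz : z ∈ S.regJost ε 2) (x t : ℝ) :
    S.jost l w 0 (S.refl z) x t = (z / (Complex.I * S.q0)) • S.jost l w 2 z x t := by
  have hq := hS.q0_pos.ne'
  have h := (jostColumn hF hS he 0).unique _ (refl_mem_regJost_zero hq hz) _
    (((jostColumn hF hS he 2).isJost z hz).map_refl_two hq hz.1)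
  rw [h]

lemma jost_refl_one (hF : S.IsFundamental F) (hS : S.IsSolution) (he : S.IsEnd l w ε) {z : ℂ}
    (hz : z ∈ S.regJost ε 1) (x t : ℝ) :
    S.jost l w 1 (S.refl z) x t = S.jost l w 1 z x t := by
  have hq := hS.q0_pos.ne'
  have h := (jostColumn hF hS he 1).unique _ (refl_mem_regJost_one hq hz) _
    (((jostColumn hF hS he 1).isJost z hz).map_refl_one hq hz.1)
  rw [h]

/-! Bilinear pairing of Jost solutions. -/

/-- `F(k^*)† F(k) = 1` makes the pairing independent of `x` and `t`; it is constant by itself,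
without any phase. -/
lemma star_dotProduct_const (hF : S.IsFundamental F) {z : ℂ} (a b : Fin 3 → ℂ) (x t : ℝ) :
    star (F x t (S.k (conj z)) *ᵥ a) ⬝ᵥ (F x t (S.k z) *ᵥ b) = star a ⬝ᵥ b := by
  rw [star_mulVec, ← dotProduct_mulVec, mulVec_mulVec, k_conj, hF.adj_mul, one_mulVec]

lemma theta_conj (j : Fin 3) (x t : ℝ) (z : ℂ) : S.theta j x t (conj z) = conj (S.theta j x t z) := by
  fin_cases j <;> simp [theta, theta1, theta2, k_conj, lam_conj, map_ofNat]

lemma IsJost.eq_fundamental (hF : S.IsFundamental F) {j : Fin 3} {z : ℂ} {φ : ℝ → ℝ → Fin 3 → ℂ}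
    (h : S.IsJost l w j z φ) (x t : ℝ) : φ x t = F x t (S.k z) *ᵥ φ 0 0 :=
  eq_fundamental_mulVec hF h.1 h.2.1 x t

lemma IsJost.tendsto_pairing (hF : S.IsFundamental F) (hq : S.q0 ≠ 0)
    (hw : conj (w 0) * w 0 + conj (w 1) * w 1 = (S.q0 : ℂ) ^ 2)
    {i j : Fin 3} {z : ℂ} (hz : z ≠ 0) {φ ψ : ℝ → ℝ → Fin 3 → ℂ}
    (hφ : S.IsJost l w i (conj z) φ) (hψ : S.IsJost l w j z ψ) :
    Tendsto (fun x : ℝ => Complex.exp (Complex.I * (S.nu i z - S.nu j z) * x) *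
      (star (φ 0 0) ⬝ᵥ ψ 0 0)) l (𝓝 (diagonal (fun j => S.gamma j z) i j)) := by
  have hc : Continuous fun p : (Fin 3 → ℂ) × (Fin 3 → ℂ) => star p.1 ⬝ᵥ p.2 := by
    simp only [dotProduct]; fun_prop
  have h := (hc.tendsto (_, _)).comp ((hφ.2.2 0).prodMk_nhds (hψ.2.2 0))
  have hΓ : (star fun r => S.Gam w (conj z) r i) ⬝ᵥ (fun r => S.Gam w z r j)
      = diagonal (fun j => S.gamma j z) i j := by
    rw [← Gam_adj_mul hw hq hz]; rfl
  rw [hΓ] at h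
  refine h.congr fun x => ?_
  simp only [Function.comp_apply]
  rw [star_smul, smul_dotProduct, dotProduct_smul, hφ.eq_fundamental hF, hψ.eq_fundamental hF x 0,
    star_dotProduct_const hF, smul_smul, smul_eq_mul]
  congr 1
  rw [RCLike.star_def, ← Complex.exp_conj, map_mul, theta_conj, Complex.conj_conj, map_neg,
    Complex.conj_I, ← Complex.exp_add, theta_eq, theta_eq]
  congr 1
  push_cast; ring

lemma IsJost.pairing_self (hF : S.IsFundamental F) (hq : S.q0 ≠ 0) (he : S.IsEnd l w ε) {j : Fin 3}
    {z : ℂ} (hz : z ≠ 0) {φ ψ : ℝ → ℝ → Fin 3 → ℂ}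
    (hφ : S.IsJost l w j (conj z) φ) (hψ : S.IsJost l w j z ψ) :
    star (φ 0 0) ⬝ᵥ ψ 0 0 = S.gamma j z := by
  have : l.NeBot := by rw [he.filter]; infer_instance
  have h := hφ.tendsto_pairing hF hq he.norm hz hψ
  simpa using h

/-- The constant pairing times an exponential tends to an off-diagonal entry of a diagonal matrix,
which is zero. Under the sign condition the exponential has modulus at least `1`, so the constant
itself is zero. -/
lemma IsJost.pairing_eq_zero (hF : S.IsFundamental F) (hq : S.q0 ≠ 0) (he : S.IsEnd l w ε)
    {i j : Fin 3} (hij : i ≠ j) {z : ℂ} (hz : z ≠ 0) (hle : ε * (S.nu i z - S.nu j z).im ≤ 0)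
    {φ ψ : ℝ → ℝ → Fin 3 → ℂ} (hφ : S.IsJost l w i (conj z) φ) (hψ : S.IsJost l w j z ψ) :
    star (φ 0 0) ⬝ᵥ ψ 0 0 = 0 := by
  have h := hφ.tendsto_pairing hF hq he.norm hz hψ
  rw [diagonal_apply_ne _ hij, he.filter, tendsto_map'_iff] at h
  have h1 : ‖star (φ 0 0) ⬝ᵥ ψ 0 0‖ ≤ ‖(0 : ℂ)‖ := by
    refine ge_of_tendsto h.norm ((eventually_ge_atTop 0).mono fun s hs => ?_)
    simp only [Function.comp_apply, norm_mul]
    refine le_mul_of_one_le_left (norm_nonneg _) ?_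
    rw [Complex.norm_exp]
    refine Real.one_le_exp ?_
    have : (Complex.I * (S.nu i z - S.nu j z) * ((ε * s : ℝ) : ℂ)).re
        = -(ε * (S.nu i z - S.nu j z).im) * s := by
      rw [mul_comm, Complex.re_ofReal_mul, Complex.I_mul_re]; ring
    rw [this]
    exact mul_nonneg (by linarith) hs
  simpa using h1

end Potential

/-! ### Uniqueness of analytic continuation from a real interval. -/

section Continuation

open Set

/-- A holomorphic function vanishing on one side of a square vanishes at its centre. -/
lemma eq_zero_at_center {g : ℂ → ℂ} {ρ : ℝ} (hρ : 0 < ρ)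
    (hd : DifferentiableOn ℂ g {w | |w.re| < ρ ∧ 0 < w.im ∧ w.im < 2 * ρ})
    (hc : ContinuousOn g {w | |w.re| ≤ ρ ∧ 0 ≤ w.im ∧ w.im ≤ 2 * ρ})
    (hz : ∀ w, |w.re| ≤ ρ → w.im = 0 → g w = 0) : g (ρ * Complex.I) = 0 := by
  set Q : Set ℂ := {w | |w.re| < ρ ∧ |w.im| < ρ} with hQ
  set K : Set ℂ := {w | |w.re| ≤ ρ ∧ |w.im| ≤ ρ} with hK
  have hQo : IsOpen Q := (isOpen_lt Complex.continuous_re.abs continuous_const).inter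
    (isOpen_lt Complex.continuous_im.abs continuous_const)
  have hKc : IsClosed K := (isClosed_le Complex.continuous_re.abs continuous_const).inter
    (isClosed_le Complex.continuous_im.abs continuous_const)
  have hQK : closure Q ⊆ K := closure_minimal (fun w hw => ⟨hw.1.le, hw.2.le⟩) hKc
  have hKb : Bornology.IsBounded K := by
    refine (Metric.isBounded_closedBall (x := (0 : ℂ)) (r := ρ + ρ)).subset fun w hw => ?_
    rw [mem_closedBall_zero_iff]
    exact (Complex.norm_le_abs_re_add_abs_im w).trans (add_le_add hw.1 hw.2)
  set e : ℂ → ℂ → ℂ := fun u w => g (ρ * Complex.I + u * w) with he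
  -- The product of the four rotations of `g` about the centre vanishes on every side of the square.
  -- The maximum principle gives `G 0 = 0`, and `G 0` is the fourth power of the value at the
  -- centre.
  set G : ℂ → ℂ := fun w => e 1 w * e Complex.I w * (e (-1) w * e (-Complex.I) w) with hG
  have hrot : ∀ u, (u = 1 ∨ u = Complex.I ∨ u = -1 ∨ u = -Complex.I) →
      DifferentiableOn ℂ (e u) Q ∧ ContinuousOn (e u) K := fun u hu => by
    constructor
    · refine hd.comp (by fun_prop) fun w hw => ?_
      obtain ⟨h1, h2⟩ := hw
      rw [abs_lt] at h1 h2
      rcases hu with rfl | rfl | rfl | rfl <;> simp [abs_lt] <;> refine ⟨⟨?_, ?_⟩, ?_, ?_⟩ <;> linarith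
    · refine hc.comp (by fun_prop) fun w hw => ?_
      obtain ⟨h1, h2⟩ := hw
      rw [abs_le] at h1 h2
      rcases hu with rfl | rfl | rfl | rfl <;> simp [abs_le] <;> refine ⟨⟨?_, ?_⟩, ?_, ?_⟩ <;> linarith
  have hGd : DiffContOnCl ℂ G Q :=
    ⟨(((hrot 1 (by simp)).1.mul (hrot Complex.I (by simp)).1).mul
        ((hrot (-1) (by simp)).1.mul (hrot (-Complex.I) (by simp)).1)),
      (((hrot 1 (by simp)).2.mul (hrot Complex.I (by simp)).2).mul
        ((hrot (-1) (by simp)).2.mul (hrot (-Complex.I) (by simp)).2)).mono hQK⟩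
  have hfr : ∀ w ∈ frontier Q, ‖G w‖ ≤ 0 := fun w hw => by
    have hwK := hQK hw.1
    have hwQ : w ∉ Q := by rw [← hQo.interior_eq]; exact hw.2
    obtain ⟨h1, h2⟩ := id hwK
    have hcase : w.re = ρ ∨ w.re = -ρ ∨ w.im = ρ ∨ w.im = -ρ := by
      by_contra! hne
      refine hwQ ⟨?_, ?_⟩
      · rw [abs_le] at h1
        exact abs_lt.2 ⟨lt_of_le_of_ne h1.1 hne.2.1.symm, lt_of_le_of_ne h1.2 hne.1⟩
      · rw [abs_le] at h2
        exact abs_lt.2 ⟨lt_of_le_of_ne h2.1 hne.2.2.2.symm, lt_of_le_of_ne h2.2 hne.2.2.1⟩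
    rw [norm_le_zero_iff]
    rcases hcase with h | h | h | h
    · have : e (-Complex.I) w = 0 := hz _ (by simpa using h2) (by simp [h])
      simp [hG, this]
    · have : e Complex.I w = 0 := hz _ (by simpa using h2) (by simp [h])
      simp [hG, this]
    · have : e (-1) w = 0 := hz _ (by simpa using h1) (by simp [h])
      simp [hG, this]
    · have : e 1 w = 0 := hz _ (by simpa using h1) (by simp [h])
      simp [hG, this]
  have h0 : ‖G 0‖ ≤ 0 := Complex.norm_le_of_forall_mem_frontier_norm_le
    (hKb.subset (subset_closure.trans hQK)) hGd hfr (subset_closure (by simp [hQ, hρ]))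
  simpa [hG, he] using norm_le_zero_iff.1 h0

/-- `B` contains a real interval which borders `D` from one side. -/
def HasRealEdge (D B : Set ℂ) : Prop :=
  ∃ x₀ r s : ℝ, 0 < r ∧ s ≠ 0 ∧ (∀ w : ℂ, |w.re| ≤ r → 0 < w.im → w.im ≤ r → x₀ + s * w ∈ D) ∧
    ∀ w : ℂ, |w.re| ≤ r → w.im = 0 → x₀ + s * w ∈ B

/-- Squares of varying size standing on the edge have their centres on a segment inside `D`, and the
function vanishes at each centre. The identity theorem on the preconnected set `D` does the rest. -/
lemma eqOn_zero_of_real_edge {D B : Set ℂ} (hD : IsOpen D) (hDc : IsPreconnected D)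
    (hE : HasRealEdge D B) {h : ℂ → ℂ} (hd : DifferentiableOn ℂ h D) (hc : ContinuousOn h (D ∪ B))
    (h0 : EqOn h 0 B) : EqOn h 0 D := by
  obtain ⟨x₀, r, s, hr, hs, hin, hon⟩ := hE
  have hz : ∀ ρ : ℝ, 0 < ρ → ρ ≤ r / 2 → h (x₀ + s * (ρ * Complex.I)) = 0 := fun ρ h1 h2 => by
    refine eq_zero_at_center (g := fun w => h (x₀ + s * w)) h1
      (hd.comp (by fun_prop) fun w hw => hin w (by linarith [hw.1]) hw.2.1 (by linarith [hw.2.2]))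
      (hc.comp (by fun_prop) fun w hw => ?_) fun w hw hw' => h0 (hon w (by linarith) hw')
    rcases hw.2.1.eq_or_lt with hi | hi
    · exact Or.inr (hon w (by linarith [hw.1]) hi.symm)
    · exact Or.inl (hin w (by linarith [hw.1]) hi (by linarith [hw.2.2]))
  set p : ℝ → ℂ := fun ρ => x₀ + s * (ρ * Complex.I) with hp
  have hp0 : p (r / 4) ∈ D := hin _ (by simp [hr.le]) (by simp [hr]) (by simp; linarith)
  have hpt : Tendsto p (𝓝[≠] (r / 4)) (𝓝[≠] (p (r / 4))) := by
    refine tendsto_nhdsWithin_iff.2 ⟨(Continuous.tendsto (by fun_prop) _).mono_left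
      nhdsWithin_le_nhds, ?_⟩
    filter_upwards [self_mem_nhdsWithin] with ρ hρ h
    have h' : (ρ : ℂ) = ((r / 4 : ℝ) : ℂ) := by simpa [hp, hs] using h
    exact hρ (by exact_mod_cast h')
  refine (hd.analyticOnNhd hD).eqOn_zero_of_preconnected_of_frequently_eq_zero hDc hp0
    (hpt.frequently (Eventually.frequently ?_))
  have hev : ∀ᶠ ρ in 𝓝 (r / 4), ρ ∈ Ioo 0 (r / 2) := Ioo_mem_nhds (by linarith) (by linarith)
  filter_upwards [nhdsWithin_le_nhds hev] with ρ hρ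
  exact hz ρ hρ.1 hρ.2.le

lemma analyticContinuation_eqOn {D B : Set ℂ} (hD : IsOpen D) (hDc : IsPreconnected D)
    (hE : HasRealEdge D B) {f g : ℂ → ℂ} (hd : DifferentiableOn ℂ f D)
    (hc : ContinuousOn f (D ∪ B)) (hg : EqOn f g B) : EqOn (analyticContinuation D B g) f D := by
  have hex : ∃ f : ℂ → ℂ, DifferentiableOn ℂ f D ∧ ContinuousOn f (D ∪ B) ∧ EqOn f g B :=
    ⟨f, hd, hc, hg⟩
  rw [analyticContinuation, dif_pos hex]
  obtain ⟨h1, h2, h3⟩ := hex.choose_spec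
  have := eqOn_zero_of_real_edge hD hDc hE (h1.sub hd) (h2.sub hc) fun z hz => by
    simp [h3 hz, hg hz]
  exact fun z hz => sub_eq_zero.1 (this hz)

end Continuation

/-! ### Topology of the four regions and their real edges. -/

namespace Potential

open Set

variable {S : Potential}

lemma isOpen_D1 : IsOpen S.D1 :=
  (isOpen_lt continuous_const continuous_norm).inter (isOpen_lt continuous_const Complex.continuous_im)

lemma isOpen_D2 : IsOpen S.D2 :=
  (isOpen_lt continuous_const continuous_norm).inter (isOpen_lt Complex.continuous_im continuous_const)

lemma isOpen_D3 : IsOpen S.D3 :=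
  (isOpen_lt continuous_norm continuous_const).inter (isOpen_lt Complex.continuous_im continuous_const)

lemma isOpen_D4 : IsOpen S.D4 :=
  (isOpen_lt continuous_norm continuous_const).inter (isOpen_lt continuous_const Complex.continuous_im)

lemma ne_zero_of_im_ne {z : ℂ} (h : z.im ≠ 0) : z ≠ 0 := by
  rintro rfl; simp at h

lemma isPreconnected_D3 : IsPreconnected S.D3 := by
  have : S.D3 = Metric.ball 0 S.q0 ∩ {z | z.im < 0} := by ext; simp [D3]
  rw [this]
  exact ((convex_ball _ _).inter (convex_halfSpace_im_lt 0)).isPreconnected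

lemma isPreconnected_D4 : IsPreconnected S.D4 := by
  have : S.D4 = Metric.ball 0 S.q0 ∩ {z | 0 < z.im} := by ext; simp [D4]
  rw [this]
  exact ((convex_ball _ _).inter (convex_halfSpace_im_gt 0)).isPreconnected

lemma im_refl_factor_pos (hq : S.q0 ≠ 0) {z : ℂ} (hz : z ≠ 0) : 0 < S.q0 ^ 2 / Complex.normSq z :=
  div_pos (by positivity) (Complex.normSq_pos.2 hz)

lemma norm_refl_lt (hq : 0 < S.q0) {z : ℂ} (hz : S.q0 < ‖z‖) : ‖S.refl z‖ < S.q0 := by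
  rw [norm_refl, div_lt_iff₀ (hq.trans hz), sq]
  exact mul_lt_mul_of_pos_left hz hq

lemma lt_norm_refl (hq : 0 < S.q0) {z : ℂ} (hz0 : z ≠ 0) (hz : ‖z‖ < S.q0) : S.q0 < ‖S.refl z‖ := by
  rw [norm_refl, lt_div_iff₀ (norm_pos_iff.2 hz0), sq]
  exact mul_lt_mul_of_pos_left hz hq

lemma refl_mem_D4 (hq : 0 < S.q0) {z : ℂ} (hz : z ∈ S.D1) : S.refl z ∈ S.D4 := by
  refine ⟨norm_refl_lt hq hz.1, ?_⟩
  rw [im_refl]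
  exact mul_pos (im_refl_factor_pos hq.ne' (ne_zero_of_im_ne hz.2.ne')) hz.2

lemma refl_mem_D1 (hq : 0 < S.q0) {z : ℂ} (hz : z ∈ S.D4) : S.refl z ∈ S.D1 := by
  refine ⟨lt_norm_refl hq (ne_zero_of_im_ne hz.2.ne') hz.1, ?_⟩
  rw [im_refl]
  exact mul_pos (im_refl_factor_pos hq.ne' (ne_zero_of_im_ne hz.2.ne')) hz.2

lemma refl_mem_D3 (hq : 0 < S.q0) {z : ℂ} (hz : z ∈ S.D2) : S.refl z ∈ S.D3 := by
  refine ⟨norm_refl_lt hq hz.1, ?_⟩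
  rw [im_refl]
  exact mul_neg_of_pos_of_neg (im_refl_factor_pos hq.ne' (ne_zero_of_im_ne hz.2.ne)) hz.2

lemma refl_mem_D2 (hq : 0 < S.q0) {z : ℂ} (hz : z ∈ S.D3) : S.refl z ∈ S.D2 := by
  refine ⟨lt_norm_refl hq (ne_zero_of_im_ne hz.2.ne) hz.1, ?_⟩
  rw [im_refl]
  exact mul_neg_of_pos_of_neg (im_refl_factor_pos hq.ne' (ne_zero_of_im_ne hz.2.ne)) hz.2

lemma conj_mem_D2 {z : ℂ} (hz : z ∈ S.D1) : conj z ∈ S.D2 := by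
  simpa [D1, D2] using hz

lemma conj_mem_D1 {z : ℂ} (hz : z ∈ S.D2) : conj z ∈ S.D1 := by
  simpa [D1, D2] using hz

lemma conj_mem_D3 {z : ℂ} (hz : z ∈ S.D4) : conj z ∈ S.D3 := by
  simpa [D3, D4] using hz

lemma conj_mem_D4 {z : ℂ} (hz : z ∈ S.D3) : conj z ∈ S.D4 := by
  simpa [D3, D4] using hz

/-- The exterior region is not convex, but it is the image of the convex half-disc `D₄` under
reflection. -/
lemma isPreconnected_D1 (hq : 0 < S.q0) : IsPreconnected S.D1 := by
  have : S.D1 = S.refl '' S.D4 := by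
    ext z
    refine ⟨fun hz => ⟨S.refl z, refl_mem_D4 hq hz, refl_refl hq.ne' (ne_zero_of_im_ne hz.2.ne')⟩, ?_⟩
    rintro ⟨y, hy, rfl⟩
    exact refl_mem_D1 hq hy
  rw [this]
  exact isPreconnected_D4.image _ fun z hz =>
    (differentiableAt_refl (ne_zero_of_im_ne hz.2.ne')).continuousAt.continuousWithinAt

lemma isPreconnected_D2 (hq : 0 < S.q0) : IsPreconnected S.D2 := by
  have : S.D2 = S.refl '' S.D3 := by
    ext z
    refine ⟨fun hz => ⟨S.refl z, refl_mem_D3 hq hz, refl_refl hq.ne' (ne_zero_of_im_ne hz.2.ne)⟩, ?_⟩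
    rintro ⟨y, hy, rfl⟩
    exact refl_mem_D2 hq hy
  rw [this]
  exact isPreconnected_D3.image _ fun z hz =>
    (differentiableAt_refl (ne_zero_of_im_ne hz.2.ne)).continuousAt.continuousWithinAt

lemma lt_norm_edge {q : ℝ} (hq : 0 < q) {w : ℂ} (hw : |w.re| ≤ q / 4) {s : ℝ} (hs : |s| = 1) :
    q < ‖((2 * q : ℝ) : ℂ) + s * w‖ := by
  refine lt_of_lt_of_le ?_ ((le_abs_self _).trans (Complex.abs_re_le_norm _))
  have h1 : |s * w.re| ≤ q / 4 := by rwa [abs_mul, hs, one_mul]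
  have := (abs_le.1 h1).1
  simp only [Complex.add_re, Complex.ofReal_re, Complex.re_ofReal_mul]
  linarith

lemma norm_edge_lt {q : ℝ} (hq : 0 < q) {w : ℂ} (hw : |w.re| ≤ q / 8) (hi : 0 ≤ w.im)
    (hi' : w.im ≤ q / 8) {s : ℝ} (hs : |s| = 1) : ‖((q / 2 : ℝ) : ℂ) + s * w‖ < q := by
  have h1 : ‖w‖ ≤ q / 8 + q / 8 := (Complex.norm_le_abs_re_add_abs_im w).trans
    (add_le_add hw (by rwa [abs_of_nonneg hi]))
  calc _ ≤ ‖((q / 2 : ℝ) : ℂ)‖ + ‖(s : ℂ) * w‖ := norm_add_le _ _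
    _ = q / 2 + ‖w‖ := by
      rw [norm_mul, Complex.norm_real, Complex.norm_real, Real.norm_eq_abs, Real.norm_eq_abs, hs,
        one_mul, abs_of_pos (half_pos hq)]
    _ < q := by linarith

lemma edge_ne_zero {q : ℝ} (hq : 0 < q) {w : ℂ} (hw : |w.re| ≤ q / 8) {s : ℝ} (hs : |s| = 1) :
    ((q / 2 : ℝ) : ℂ) + s * w ≠ 0 := fun h => by
  have h1 : |s * w.re| ≤ q / 8 := by rwa [abs_mul, hs, one_mul]
  have h2 := congrArg Complex.re h
  have := (abs_le.1 h1).1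
  simp only [Complex.add_re, Complex.ofReal_re, Complex.re_ofReal_mul, Complex.zero_re] at h2
  linarith

lemma hasRealEdge_D1 (hq : 0 < S.q0) : HasRealEdge S.D1 S.realOut :=
  ⟨2 * S.q0, S.q0 / 4, 1, by linarith, one_ne_zero,
    fun w h1 h2 _ => ⟨lt_norm_edge hq h1 (by simp), by simpa using h2⟩,
    fun w h1 h2 => ⟨by simpa using h2, lt_norm_edge hq h1 (by simp)⟩⟩

lemma hasRealEdge_D2 (hq : 0 < S.q0) : HasRealEdge S.D2 S.realOut :=
  ⟨2 * S.q0, S.q0 / 4, -1, by linarith, by simp,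
    fun w h1 h2 _ => ⟨lt_norm_edge hq h1 (by simp), by simpa using h2⟩,
    fun w h1 h2 => ⟨by simpa using h2, lt_norm_edge hq h1 (by simp)⟩⟩

lemma hasRealEdge_D3 (hq : 0 < S.q0) : HasRealEdge S.D3 S.realIn :=
  ⟨S.q0 / 2, S.q0 / 8, -1, by linarith, by simp,
    fun w h1 h2 h3 => ⟨norm_edge_lt hq h1 h2.le h3 (by simp), by simpa using h2⟩,
    fun w h1 h2 => ⟨by simpa using h2, norm_pos_iff.2 (edge_ne_zero hq h1 (by simp)),
      norm_edge_lt hq h1 h2.ge (by rw [h2]; linarith) (by simp)⟩⟩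

lemma hasRealEdge_D4 (hq : 0 < S.q0) : HasRealEdge S.D4 S.realIn :=
  ⟨S.q0 / 2, S.q0 / 8, 1, by linarith, one_ne_zero,
    fun w h1 h2 h3 => ⟨norm_edge_lt hq h1 h2.le h3 (by simp), by simpa using h2⟩,
    fun w h1 h2 => ⟨by simpa using h2, norm_pos_iff.2 (edge_ne_zero hq h1 (by simp)),
      norm_edge_lt hq h1 h2.ge (by rw [h2]; linarith) (by simp)⟩⟩

lemma hasRealEdge_upper : HasRealEdge {z | 0 < z.im} realPunctured :=
  ⟨2, 1 / 8, 1, by norm_num, one_ne_zero, fun w _ h2 _ => by simpa using h2, fun w h1 h2 =>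
    ⟨by simpa using h2, by
      have := edge_ne_zero (q := 4) (s := 1) (by norm_num) (h1.trans (by norm_num)) (by simp)
      norm_num at this ⊢
      exact this⟩⟩

lemma hasRealEdge_lower : HasRealEdge {z | z.im < 0} realPunctured :=
  ⟨2, 1 / 8, -1, by norm_num, by simp, fun w _ h2 _ => by simpa using h2, fun w h1 h2 =>
    ⟨by simpa using h2, by
      have := edge_ne_zero (q := 4) (s := -1) (by norm_num) (h1.trans (by norm_num)) (by simp)
      norm_num at this ⊢
      exact this⟩⟩

end Potential

/-! ### Cross products of solutions of the adjoint equation. -/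

section Cross

lemma HasDerivAt.crossProduct {𝕜 : Type*} [NontriviallyNormedField 𝕜] [NormedAlgebra 𝕜 ℂ]
    {a b : 𝕜 → Fin 3 → ℂ} {a' b' : Fin 3 → ℂ} {s : 𝕜}
    (ha : HasDerivAt a a' s) (hb : HasDerivAt b b' s) :
    HasDerivAt (fun s => _root_.crossProduct (a s) (b s))
      (_root_.crossProduct a' (b s) + _root_.crossProduct (a s) b') s := by
  have h1 := hasDerivAt_pi.1 ha
  have h2 := hasDerivAt_pi.1 hb
  refine hasDerivAt_pi.2 fun i => ?_
  simp only [cross_apply]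
  fin_cases i
  · exact (((h1 1).mul (h2 2)).sub ((h1 2).mul (h2 1))).congr_deriv (by simp; ring)
  · exact (((h1 2).mul (h2 0)).sub ((h1 0).mul (h2 2))).congr_deriv (by simp; ring)
  · exact (((h1 0).mul (h2 1)).sub ((h1 1).mul (h2 0))).congr_deriv (by simp; ring)

/-- The cross product of two solutions of the adjoint equation, corrected by the trace, solves the
original equation. -/
lemma hasDerivAt_smul_crossProduct {N : Matrix (Fin 3) (Fin 3) ℂ} {e : ℝ → ℂ} {a b : ℝ → Fin 3 → ℂ}
    {s : ℝ} (he : HasDerivAt e (N.trace * e s) s) (ha : HasDerivAt a (-(Nᵀ *ᵥ a s)) s)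
    (hb : HasDerivAt b (-(Nᵀ *ᵥ b s)) s) :
    HasDerivAt (fun s => e s • crossProduct (a s) (b s))
      (N *ᵥ (e s • crossProduct (a s) (b s))) s := by
  refine (he.smul (ha.crossProduct hb)).congr_deriv ?_
  have h := crossProduct_transpose_mulVec N (a s) (b s)
  rw [map_neg, LinearMap.neg_apply, map_neg, ← neg_add, h, mulVec_smul]
  module

lemma star_mulVec_of_conjTranspose {N N' : Matrix (Fin 3) (Fin 3) ℂ} (h : N'ᴴ = -N) (a : Fin 3 → ℂ) :
    star (N' *ᵥ a) = -(Nᵀ *ᵥ star a) := by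
  rw [star_mulVec, h, vecMul_neg, mulVec_transpose]

end Cross

/-! ### Auxiliary eigenfunctions, regions of analyticity and pairing coefficients. -/

namespace Potential

open Set

variable {S : Potential} {F : ℝ → ℝ → ℂ → Matrix (Fin 3) (Fin 3) ℂ} {l l' : Filter ℝ}
  {w w' : Fin 2 → ℂ} {ε : ℝ}

/-- A cross product of adjoint solutions solves the Lax pair up to the traces `ik` of `U` and `4ik³`
of `V`. These are the derivatives of `iθ₂` in `x` and `t`, so the factor `e^{iθ₂}` compensates for
them. -/
lemma IsJost.cross (hF : S.IsFundamental F) {i j : Fin 3} {z : ℂ} {φ ψ : ℝ → ℝ → Fin 3 → ℂ}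
    (hφ : S.IsJost l w i (conj z) φ) (hψ : S.IsJost l' w' j (conj z) ψ) (x t : ℝ) :
    Complex.exp (Complex.I * S.theta2 x t z) • crossProduct (star (φ x t)) (star (ψ x t))
      = F x t (S.k z) *ᵥ crossProduct (star (φ 0 0)) (star (ψ 0 0)) := by
  have hU : ∀ x t, (S.U x t (conj z))ᴴ = -laxU (S.k z) (S.q x t) := fun x t => by
    rw [← conjTranspose_laxU, ← k_conj]; rfl
  have hV : ∀ x t, (S.V x t (conj z))ᴴ = -laxV (S.k z) (S.q x t) (S.qx x t) (S.qxx x t) :=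
    fun x t => by rw [← conjTranspose_laxV, ← k_conj]; rfl
  have hx : ∀ {l w i φ}, S.IsJost l w i (conj z) φ → ∀ x t, HasDerivAt (fun y => star (φ y t))
      (-((laxU (S.k z) (S.q x t))ᵀ *ᵥ star (φ x t))) x := fun {l w i φ} h x t => by
    rw [← star_mulVec_of_conjTranspose (hU x t)]
    exact (h.1 x t).star
  have ht : ∀ {l w i φ}, S.IsJost l w i (conj z) φ → ∀ x t, HasDerivAt (fun r => star (φ x r))
      (-((laxV (S.k z) (S.q x t) (S.qx x t) (S.qxx x t))ᵀ *ᵥ star (φ x t))) t :=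
    fun {l w i φ} h x t => by
      rw [← star_mulVec_of_conjTranspose (hV x t)]
      exact (h.2.1 x t).star
  have := eq_fundamental_mulVec hF (κ := S.k z)
    (φ := fun x t => Complex.exp (Complex.I * S.theta2 x t z) •
      crossProduct (star (φ x t)) (star (ψ x t)))
    (fun x t => hasDerivAt_smul_crossProduct (e := fun y : ℝ => Complex.exp (Complex.I * S.theta2 y t z))
      (by
        rw [trace_laxU]
        have h1 : HasDerivAt (fun y : ℝ => Complex.I * S.theta2 y t z) (Complex.I * S.k z) x := by
          simp only [theta2]
          have := ((Complex.ofRealCLM.hasDerivAt (x := x)).add_const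
            (4 * S.k z ^ 2 * (t : ℂ))).const_mul (S.k z)
          simpa using this.const_mul Complex.I
        exact h1.cexp.congr_deriv (mul_comm _ _)) (hx hφ x t) (hx hψ x t))
    (fun x t => hasDerivAt_smul_crossProduct (e := fun r : ℝ => Complex.exp (Complex.I * S.theta2 x r z))
      (by
        rw [trace_laxV]
        have h1 : HasDerivAt (fun r : ℝ => Complex.I * S.theta2 x r z)
            (4 * Complex.I * S.k z ^ 3) t := by
          simp only [theta2]
          have := (((Complex.ofRealCLM.hasDerivAt (x := t)).const_mul
            (4 * S.k z ^ 2)).const_add (x : ℂ)).const_mul (S.k z)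
          have := this.const_mul Complex.I
          refine this.congr_deriv ?_
          simp; ring
        exact h1.cexp.congr_deriv (mul_comm _ _)) (ht hφ x t) (ht hψ x t)) x t
  simpa [theta2] using this

/-! Membership in the regions. -/

/-- `1 + q₀²/z²` vanishes only at `z = ±i q₀`, on the circle that separates the regions. -/
lemma one_add_ne_of_norm_ne {z : ℂ} (hz : z ≠ 0) (h : ‖z‖ ≠ |S.q0|) :
    1 + (S.q0 : ℂ) ^ 2 / z ^ 2 ≠ 0 := fun h0 => by
  refine h ?_
  have h1 : z ^ 2 = -(S.q0 : ℂ) ^ 2 := by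
    field_simp at h0; linear_combination h0
  have h2 : ‖z‖ ^ 2 = |S.q0| ^ 2 := by
    rw [← norm_pow, h1, norm_neg, norm_pow, Complex.norm_real, Real.norm_eq_abs]
  exact (pow_left_inj₀ (norm_nonneg _) (abs_nonneg _) two_ne_zero).1 h2

lemma one_add_ne_of_im_eq_zero {z : ℂ} (h : z.im = 0) :
    1 + (S.q0 : ℂ) ^ 2 / z ^ 2 ≠ 0 := fun h0 => by
  have : z = (z.re : ℂ) := Complex.ext rfl (by simp [h])
  rw [this] at h0
  have h1 : (1 : ℝ) + S.q0 ^ 2 / z.re ^ 2 = 0 := by exact_mod_cast h0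
  have h2 : (0 : ℝ) < 1 + S.q0 ^ 2 / z.re ^ 2 := by positivity
  exact h2.ne' h1

lemma q0_sq_div_normSq_le (hq : 0 < S.q0) {z : ℂ} (hz : S.q0 < ‖z‖) :
    S.q0 ^ 2 / Complex.normSq z ≤ 1 := by
  rw [Complex.normSq_eq_norm_sq]
  exact div_le_one_of_le₀ (pow_le_pow_left₀ hq.le hz.le 2) (sq_nonneg _)

lemma le_q0_sq_div_normSq {z : ℂ} (hz0 : z ≠ 0) (hz : ‖z‖ < S.q0) :
    1 ≤ S.q0 ^ 2 / Complex.normSq z := by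
  have : 0 < ‖z‖ := norm_pos_iff.2 hz0
  rw [Complex.normSq_eq_norm_sq, one_le_div (by positivity)]
  exact pow_le_pow_left₀ (norm_nonneg _) hz.le 2

lemma D1_subset_regJost (hq : 0 < S.q0) : S.D1 ⊆ S.regJost (-1) 2 := fun z hz => by
  have h0 := ne_zero_of_im_ne hz.2.ne'
  refine ⟨h0, by linarith [hz.2], ?_, one_add_ne_of_norm_ne h0 (by rw [abs_of_pos hq]; exact hz.1.ne')⟩
  rw [lam_im]
  nlinarith [mul_nonneg hz.2.le (sub_nonneg.2 (q0_sq_div_normSq_le hq hz.1))]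

lemma D2_subset_regJost (hq : 0 < S.q0) : S.D2 ⊆ S.regJost 1 2 := fun z hz => by
  have h0 := ne_zero_of_im_ne hz.2.ne
  refine ⟨h0, by linarith [hz.2], ?_, one_add_ne_of_norm_ne h0 (by rw [abs_of_pos hq]; exact hz.1.ne')⟩
  rw [lam_im]
  nlinarith [mul_nonneg (neg_nonneg.2 hz.2.le) (sub_nonneg.2 (q0_sq_div_normSq_le hq hz.1))]

lemma D3_subset_regJost (hq : 0 < S.q0) : S.D3 ⊆ S.regJost 1 0 := fun z hz => by
  have h0 := ne_zero_of_im_ne hz.2.ne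
  refine ⟨h0, by linarith [hz.2], ?_, one_add_ne_of_norm_ne h0 (by rw [abs_of_pos hq]; exact hz.1.ne)⟩
  rw [lam_im]
  nlinarith [mul_nonneg (neg_nonneg.2 hz.2.le) (sub_nonneg.2 (le_q0_sq_div_normSq h0 hz.1))]

lemma D4_subset_regJost (hq : 0 < S.q0) : S.D4 ⊆ S.regJost (-1) 0 := fun z hz => by
  have h0 := ne_zero_of_im_ne hz.2.ne'
  refine ⟨h0, by linarith [hz.2], ?_, one_add_ne_of_norm_ne h0 (by rw [abs_of_pos hq]; exact hz.1.ne)⟩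
  rw [lam_im]
  nlinarith [mul_nonneg hz.2.le (sub_nonneg.2 (le_q0_sq_div_normSq h0 hz.1))]

lemma upper_subset_regJost : {z : ℂ | 0 < z.im} ⊆ S.regJost 1 1 := fun z hz =>
  ⟨ne_zero_of_im_ne (mem_ofPred.1 hz).ne', by linarith [mem_ofPred.1 hz]⟩

lemma lower_subset_regJost : {z : ℂ | z.im < 0} ⊆ S.regJost (-1) 1 := fun z hz =>
  ⟨ne_zero_of_im_ne (mem_ofPred.1 hz).ne, by linarith [mem_ofPred.1 hz]⟩

lemma real_subset_regJost (ε : ℝ) (j : Fin 3) : realPunctured ⊆ S.regJost ε j := fun z hz => by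
  have hl : (S.lam z).im = 0 := by rw [lam_im, hz.1]; ring
  have hg := one_add_ne_of_im_eq_zero (S := S) hz.1
  fin_cases j
  · exact ⟨hz.2, by simp [hz.1], by simp [hl], hg⟩
  · exact ⟨hz.2, by simp [hz.1]⟩
  · exact ⟨hz.2, by simp [hz.1], by simp [hl], hg⟩

lemma conj_of_mem_real {z : ℂ} (hz : z ∈ realPunctured) : conj z = z := Complex.conj_eq_iff_im.2 hz.1

lemma realOut_subset (hq : 0 < S.q0) : S.realOut ⊆ realPunctured := fun _ hz =>
  ⟨hz.1, norm_pos_iff.1 (hq.trans hz.2)⟩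

lemma realIn_subset : S.realIn ⊆ realPunctured := fun _ hz => ⟨hz.1, norm_pos_iff.1 hz.2.1⟩

/-! Analyticity of the Jost solutions and of the scattering coefficients. -/

lemma JostColumn.eq_fundamental (hF : S.IsFundamental F) {j : Fin 3} {R : Set ℂ}
    (h : S.JostColumn l w j R) {z : ℂ} (hz : z ∈ R) (x t : ℝ) :
    S.jost l w j z x t = F x t (S.k z) *ᵥ S.jost l w j z 0 0 :=
  (h.isJost z hz).eq_fundamental hF x t

lemma differentiableAt_k {z : ℂ} (hz : z ≠ 0) : DifferentiableAt ℂ S.k z :=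
  (differentiableAt_id.sub ((differentiableAt_const _).div differentiableAt_id hz)).div_const 2

lemma differentiableAt_theta (j : Fin 3) (x t : ℝ) {z : ℂ} (hz : z ≠ 0) :
    DifferentiableAt ℂ (S.theta j x t) z := by
  have hk := differentiableAt_k (S := S) hz
  have hl : DifferentiableAt ℂ S.lam z :=
    (differentiableAt_id.add ((differentiableAt_const _).div differentiableAt_id hz)).div_const 2
  fin_cases j
  · change DifferentiableAt ℂ (S.theta1 x t) z
    unfold theta1; fun_prop
  · change DifferentiableAt ℂ (S.theta2 x t) z
    unfold theta2; fun_prop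
  · change DifferentiableAt ℂ (fun z => -S.theta1 x t z) z
    unfold theta1; fun_prop

open scoped Matrix.Norms.Operator in
lemma JostColumn.differentiableOn (hF : S.IsFundamental F) {j : Fin 3} {R O : Set ℂ}
    (h : S.JostColumn l w j R) (hO : IsOpen O) (hOR : O ⊆ R) (h0 : ∀ z ∈ O, z ≠ 0) (x t : ℝ) :
    DifferentiableOn ℂ (fun z => S.jost l w j z x t) O := by
  refine DifferentiableOn.congr (fun z hz => ?_) fun z hz => h.eq_fundamental hF (hOR hz) x t
  have h1 := ((h.diff O hO hOR).differentiableAt (hO.mem_nhds hz)).hasDerivAt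
  have h2 := ((hF.differentiable x t (S.k z)).comp z (differentiableAt_k (h0 z hz))).hasDerivAt
  exact (h2.matrix_mulVec h1).differentiableAt.differentiableWithinAt

lemma JostColumn.analyticAt (hF : S.IsFundamental F) {j : Fin 3} {R O : Set ℂ}
    (h : S.JostColumn l w j R) (hO : IsOpen O) (hOR : O ⊆ R) (h0 : ∀ z ∈ O, z ≠ 0) (x t : ℝ) {z : ℂ}
    (hz : z ∈ O) : AnalyticAt ℂ (fun z => S.jost l w j z x t) z :=
  (h.differentiableOn hF hO hOR h0 x t).analyticAt (hO.mem_nhds hz)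

lemma differentiableOn_star_conj {f : ℂ → Fin 3 → ℂ} {O : Set ℂ} (hO : IsOpen O)
    (hf : DifferentiableOn ℂ f O) : DifferentiableOn ℂ (fun z => star (f (conj z))) (conj ⁻¹' O) :=
  fun z hz => by
    have := (hf.differentiableAt (hO.mem_nhds hz)).star_conj
    rw [Complex.conj_conj] at this
    exact this.differentiableWithinAt

lemma analyticAt_star_conj {f : ℂ → Fin 3 → ℂ} {z : ℂ} (hf : AnalyticAt ℂ f (conj z)) :
    AnalyticAt ℂ (fun z => star (f (conj z))) z := by
  obtain ⟨O, h1, hO, hz⟩ := eventually_nhds_iff.1 hf.eventually_analyticAt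
  have hd : DifferentiableOn ℂ f O := fun y hy => (h1 y hy).differentiableAt.differentiableWithinAt
  exact (differentiableOn_star_conj hO hd).analyticAt
    ((hO.preimage Complex.continuous_conj).mem_nhds hz)

lemma differentiableOn_dotProduct {f g : ℂ → Fin 3 → ℂ} {O : Set ℂ} (hf : DifferentiableOn ℂ f O)
    (hg : DifferentiableOn ℂ g O) : DifferentiableOn ℂ (fun z => f z ⬝ᵥ g z) O := by
  rw [differentiableOn_pi] at hf hg
  simp only [dotProduct, Fin.sum_univ_three]
  exact (((hf 0).mul (hg 0)).add ((hf 1).mul (hg 1))).add ((hf 2).mul (hg 2))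

lemma continuousOn_dotProduct {f g : ℂ → Fin 3 → ℂ} {O : Set ℂ} (hf : ContinuousOn f O)
    (hg : ContinuousOn g O) : ContinuousOn (fun z => f z ⬝ᵥ g z) O := by
  rw [continuousOn_pi] at hf hg
  simp only [dotProduct, Fin.sum_univ_three]
  exact (((hf 0).mul (hg 0)).add ((hf 1).mul (hg 1))).add ((hf 2).mul (hg 2))

lemma differentiableAt_gamma (j : Fin 3) {z : ℂ} (hz : z ≠ 0) : DifferentiableAt ℂ (S.gamma j) z := by
  have h : DifferentiableAt ℂ (fun z : ℂ => 1 + (S.q0 : ℂ) ^ 2 / z ^ 2) z :=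
    (differentiableAt_const _).add ((differentiableAt_const _).div (differentiableAt_id.pow 2)
      (pow_ne_zero 2 hz))
  fin_cases j
  · exact h
  · exact differentiableAt_const _
  · exact h

/-- The coefficient of the `j`-th column at the end `(l, w)` in the expansion of the `j`-th column at
the end `(l', w')`. -/
def coeff (S : Potential) (l : Filter ℝ) (w : Fin 2 → ℂ) (l' : Filter ℝ) (w' : Fin 2 → ℂ) (j : Fin 3)
    (z : ℂ) : ℂ :=
  (star (S.jost l w j (conj z) 0 0) ⬝ᵥ S.jost l' w' j z 0 0) / S.gamma j z

lemma differentiableOn_coeff {j : Fin 3} {R R' D : Set ℂ} (h : S.JostColumn l w j R)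
    (h' : S.JostColumn l' w' j R') (hD : IsOpen D) (hR : ∀ z ∈ D, conj z ∈ R) (hR' : D ⊆ R')
    (h0 : ∀ z ∈ D, z ≠ 0) (hg : ∀ z ∈ D, S.gamma j z ≠ 0) :
    DifferentiableOn ℂ (S.coeff l w l' w' j) D := by
  have hO : IsOpen (conj ⁻¹' D) := hD.preimage Complex.continuous_conj
  have h1 := differentiableOn_star_conj hO (h.diff (conj ⁻¹' D) hO fun z hz => by
    simpa using hR _ hz)
  have e : conj ⁻¹' (conj ⁻¹' D) = D := by ext; simp
  rw [e] at h1
  exact (differentiableOn_dotProduct h1 (h'.diff D hD hR')).div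
    (fun z hz => (differentiableAt_gamma j (h0 z hz)).differentiableWithinAt) hg

lemma continuousOn_coeff {j : Fin 3} {R R' D : Set ℂ} (h : S.JostColumn l w j R)
    (h' : S.JostColumn l' w' j R') (hR : ∀ z ∈ D, conj z ∈ R) (hR' : D ⊆ R')
    (h0 : ∀ z ∈ D, z ≠ 0) (hg : ∀ z ∈ D, S.gamma j z ≠ 0) :
    ContinuousOn (S.coeff l w l' w' j) D := by
  have hc : Continuous fun v : Fin 3 → ℂ => star v := by fun_prop
  have h1 := hc.comp_continuousOn (h.cont.comp Complex.continuous_conj.continuousOn hR)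
  exact (continuousOn_dotProduct h1 (h'.cont.mono hR')).div
    (fun z hz => (differentiableAt_gamma j (h0 z hz)).continuousAt.continuousWithinAt) hg

end Potential

/-! ### Inverses of matrices with orthogonal columns. -/

section Gram

lemma inv_mul_apply_of_gram {P N : Matrix (Fin 3) (Fin 3) ℂ} {d : Fin 3 → ℂ} (hd : ∀ j, d j ≠ 0)
    (hP : Pᴴ * P = diagonal d) (j : Fin 3) :
    (P⁻¹ * N) j j = (Pᴴ * N) j j / d j := by
  have h : (diagonal (fun j => (d j)⁻¹) * Pᴴ) * P = 1 := by
    rw [mul_assoc, hP, diagonal_mul_diagonal, ← diagonal_one]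
    congr 1; ext j; exact inv_mul_cancel₀ (hd j)
  rw [inv_eq_left_inv h, mul_assoc, diagonal_mul, inv_mul_eq_div]

lemma conjTranspose_colMatrix_mul (p n : Fin 3 → Fin 3 → ℂ) (i j : Fin 3) :
    ((colMatrix (p 0) (p 1) (p 2))ᴴ * colMatrix (n 0) (n 1) (n 2)) i j = star (p i) ⬝ᵥ n j := by
  rw [Matrix.mul_apply]
  refine Finset.sum_congr rfl fun k _ => ?_
  fin_cases i <;> fin_cases j <;> rfl

end Gram

/-! ### The diagonal scattering coefficients as pairings, and their symmetries. -/

namespace Potential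

open Set

variable {S : Potential} {F : ℝ → ℝ → ℂ → Matrix (Fin 3) (Fin 3) ℂ} {l l' : Filter ℝ}
  {w w' : Fin 2 → ℂ} {ε ε' : ℝ}

lemma regJost_ne_zero {j : Fin 3} {z : ℂ} (hz : z ∈ S.regJost ε j) : z ≠ 0 := by
  fin_cases j <;> exact hz.1

lemma regJost_gamma_ne {j : Fin 3} {z : ℂ} (hz : z ∈ S.regJost ε j) : S.gamma j z ≠ 0 := by
  fin_cases j
  · exact hz.2.2.2
  · exact one_ne_zero
  · exact hz.2.2.2

lemma nu_im_of_real {z : ℂ} (hz : z.im = 0) (j : Fin 3) : (S.nu j z).im = 0 := by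
  fin_cases j <;> simp [nu, lam_im, k_im, hz]

/-- For real `z` all exponents are real, so the sign condition for vanishing pairings holds for
every pair `i ≠ j`, and the columns are orthogonal. -/
lemma gram_jost (hF : S.IsFundamental F) (hS : S.IsSolution) (he : S.IsEnd l w ε) {z : ℂ}
    (hz : z ∈ realPunctured) (i j : Fin 3) :
    star (S.jost l w i z 0 0) ⬝ᵥ S.jost l w j z 0 0 = diagonal (fun j => S.gamma j z) i j := by
  have hi : S.IsJost l w i (conj z) (S.jost l w i z) := by
    rw [conj_of_mem_real hz]
    exact (jostColumn hF hS he i).isJost z (real_subset_regJost ε i hz)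
  have hj := (jostColumn hF hS he j).isJost z (real_subset_regJost ε j hz)
  by_cases hij : i = j
  · subst hij
    rw [diagonal_apply_eq]
    exact hi.pairing_self hF hS.q0_pos.ne' he hz.2 hj
  · rw [diagonal_apply_ne _ hij]
    exact hi.pairing_eq_zero hF hS.q0_pos.ne' he hij hz.2
      (by simp [nu_im_of_real hz.1]) hj

/-- The explicit form of the diagonal entries of `A`. -/
def scatA (S : Potential) : Fin 3 → ℂ → ℂ := S.coeff atTop S.qPlus atBot S.qMinus

/-- The explicit form of the diagonal entries of `B`. -/
def scatB (S : Potential) : Fin 3 → ℂ → ℂ := S.coeff atBot S.qMinus atTop S.qPlus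

lemma gram_colMatrix (hF : S.IsFundamental F) (hS : S.IsSolution) (he : S.IsEnd l w ε) {z : ℂ}
    (hz : z ∈ realPunctured) :
    (colMatrix (S.jost l w 0 z 0 0) (S.jost l w 1 z 0 0) (S.jost l w 2 z 0 0))ᴴ *
      colMatrix (S.jost l w 0 z 0 0) (S.jost l w 1 z 0 0) (S.jost l w 2 z 0 0)
      = diagonal fun j => S.gamma j z := by
  ext i j
  rw [conjTranspose_colMatrix_mul (fun i => S.jost l w i z 0 0) (fun i => S.jost l w i z 0 0),
    gram_jost hF hS he hz]

lemma inv_colMatrix_mul_apply (hF : S.IsFundamental F) (hS : S.IsSolution) (he : S.IsEnd l w ε)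
    {z : ℂ} (hz : z ∈ realPunctured) (j : Fin 3) :
    ((colMatrix (S.jost l w 0 z 0 0) (S.jost l w 1 z 0 0) (S.jost l w 2 z 0 0))⁻¹ *
      colMatrix (S.jost l' w' 0 z 0 0) (S.jost l' w' 1 z 0 0) (S.jost l' w' 2 z 0 0)) j j
      = S.coeff l w l' w' j z := by
  rw [inv_mul_apply_of_gram (fun j => gamma_ne (one_add_ne_of_im_eq_zero hz.1) j)
    (gram_colMatrix hF hS he hz), conjTranspose_colMatrix_mul (fun i => S.jost l w i z 0 0)
    (fun i => S.jost l' w' i z 0 0), coeff, conj_of_mem_real hz]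

lemma A_apply (hF : S.IsFundamental F) (hS : S.IsSolution) {z : ℂ} (hz : z ∈ realPunctured)
    (j : Fin 3) : S.A z j j = S.scatA j z :=
  inv_colMatrix_mul_apply hF hS (isEnd_plus hS) hz j

/-- `B` is `Φ_-⁻¹ Φ_+`, the scattering matrix with the two ends exchanged. Reversing the inverse of
the product needs `det Φ_+ ≠ 0`, which the determinant of the Gram matrix provides. -/
lemma B_apply (hF : S.IsFundamental F) (hS : S.IsSolution) {z : ℂ} (hz : z ∈ realPunctured)
    (j : Fin 3) : S.B z j j = S.scatB j z := by
  have hu : IsUnit (colMatrix (S.PhiP 0 0 0 z) (S.PhiP 1 0 0 z) (S.PhiP 2 0 0 z)).det := by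
    have h := congrArg Matrix.det (gram_colMatrix hF hS (isEnd_plus hS) hz)
    rw [det_mul, det_diagonal] at h
    refine isUnit_iff_ne_zero.2 (right_ne_zero_of_mul (a := _) (h.trans_ne ?_))
    exact Finset.prod_ne_zero_iff.2 fun j _ => gamma_ne (one_add_ne_of_im_eq_zero hz.1) j
  rw [B, A, Matrix.mul_inv_rev, nonsing_inv_nonsing_inv _ hu]
  exact inv_colMatrix_mul_apply hF hS (isEnd_minus hS) hz j

/-- The pairing formula agrees with the boundary values on the real axis, is continuous up to `B`
and is holomorphic in `D`; uniqueness of the continuation identifies the two on `D`. -/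
lemma analyticContinuation_coeff (hF : S.IsFundamental F) (hS : S.IsSolution) (he : S.IsEnd l w ε)
    (he' : S.IsEnd l' w' ε') {j : Fin 3} {D B : Set ℂ} (hD : IsOpen D) (hDc : IsPreconnected D)
    (hE : HasRealEdge D B) (hB : B ⊆ realPunctured) (hR : ∀ z ∈ D, conj z ∈ S.regJost ε j)
    (hR' : D ⊆ S.regJost ε' j) {g : ℂ → ℂ} (hg : EqOn g (S.coeff l w l' w' j) realPunctured) :
    EqOn (analyticContinuation D B g) (S.coeff l w l' w' j) D := by
  have h := jostColumn hF hS he j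
  have h' := jostColumn hF hS he' j
  have hR'' : D ∪ B ⊆ S.regJost ε' j := union_subset hR' (hB.trans (real_subset_regJost ε' j))
  refine analyticContinuation_eqOn hD hDc hE
    (differentiableOn_coeff h h' hD hR hR' (fun z hz => regJost_ne_zero (hR' hz))
      fun z hz => regJost_gamma_ne (hR' hz))
    (continuousOn_coeff h h' (fun z hz => ?_) hR'' (fun z hz => regJost_ne_zero (hR'' hz))
      fun z hz => regJost_gamma_ne (hR'' hz)) fun z hz => (hg (hB hz)).symm
  rcases hz with hz | hz
  · exact hR z hz
  · rw [conj_of_mem_real (hB hz)]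
    exact real_subset_regJost ε j (hB hz)

lemma isOpen_upper : IsOpen {z : ℂ | 0 < z.im} := isOpen_lt continuous_const Complex.continuous_im

lemma isOpen_lower : IsOpen {z : ℂ | z.im < 0} := isOpen_lt Complex.continuous_im continuous_const

lemma a11_eqOn (hF : S.IsFundamental F) (hS : S.IsSolution) : EqOn S.a11 (S.scatA 0) S.D4 :=
  analyticContinuation_coeff hF hS (isEnd_plus hS) (isEnd_minus hS) isOpen_D4 isPreconnected_D4
    (hasRealEdge_D4 hS.q0_pos) realIn_subset
    (fun _ hz => D3_subset_regJost hS.q0_pos (conj_mem_D3 hz)) (D4_subset_regJost hS.q0_pos)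
    fun _ hz => A_apply hF hS hz 0

lemma a22_eqOn (hF : S.IsFundamental F) (hS : S.IsSolution) :
    EqOn S.a22 (S.scatA 1) {z | z.im < 0} :=
  analyticContinuation_coeff hF hS (isEnd_plus hS) (isEnd_minus hS) isOpen_lower
    (convex_halfSpace_im_lt 0).isPreconnected hasRealEdge_lower Subset.rfl
    (fun z hz => upper_subset_regJost (by simpa using hz)) lower_subset_regJost
    fun _ hz => A_apply hF hS hz 1

lemma a33_eqOn (hF : S.IsFundamental F) (hS : S.IsSolution) : EqOn S.a33 (S.scatA 2) S.D1 :=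
  analyticContinuation_coeff hF hS (isEnd_plus hS) (isEnd_minus hS) isOpen_D1
    (isPreconnected_D1 hS.q0_pos) (hasRealEdge_D1 hS.q0_pos) (realOut_subset hS.q0_pos)
    (fun _ hz => D2_subset_regJost hS.q0_pos (conj_mem_D2 hz)) (D1_subset_regJost hS.q0_pos)
    fun _ hz => A_apply hF hS hz 2

lemma b11_eqOn (hF : S.IsFundamental F) (hS : S.IsSolution) : EqOn S.b11 (S.scatB 0) S.D3 :=
  analyticContinuation_coeff hF hS (isEnd_minus hS) (isEnd_plus hS) isOpen_D3 isPreconnected_D3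
    (hasRealEdge_D3 hS.q0_pos) realIn_subset
    (fun _ hz => D4_subset_regJost hS.q0_pos (conj_mem_D4 hz)) (D3_subset_regJost hS.q0_pos)
    fun _ hz => B_apply hF hS hz 0

lemma b22_eqOn (hF : S.IsFundamental F) (hS : S.IsSolution) :
    EqOn S.b22 (S.scatB 1) {z | 0 < z.im} :=
  analyticContinuation_coeff hF hS (isEnd_minus hS) (isEnd_plus hS) isOpen_upper
    (convex_halfSpace_im_gt 0).isPreconnected hasRealEdge_upper Subset.rfl
    (fun z hz => lower_subset_regJost (by simpa using hz)) upper_subset_regJost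
    fun _ hz => B_apply hF hS hz 1

lemma b33_eqOn (hF : S.IsFundamental F) (hS : S.IsSolution) : EqOn S.b33 (S.scatB 2) S.D2 :=
  analyticContinuation_coeff hF hS (isEnd_minus hS) (isEnd_plus hS) isOpen_D2
    (isPreconnected_D2 hS.q0_pos) (hasRealEdge_D2 hS.q0_pos) (realOut_subset hS.q0_pos)
    (fun _ hz => D1_subset_regJost hS.q0_pos (conj_mem_D1 hz)) (D2_subset_regJost hS.q0_pos)
    fun _ hz => B_apply hF hS hz 2

/-! Symmetries of the scattering coefficients. -/

lemma gamma_conj (j : Fin 3) (z : ℂ) : S.gamma j (conj z) = conj (S.gamma j z) := by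
  fin_cases j <;> simp [gamma]

/-- Exchanging the two entries of a Hermitian pairing conjugates it; here this also exchanges the
ends of the line and `z` with `z^*`. -/
lemma coeff_conj (j : Fin 3) (z : ℂ) :
    S.coeff l' w' l w j (conj z) = conj (S.coeff l w l' w' j z) := by
  have h : star (S.jost l' w' j z 0 0) ⬝ᵥ S.jost l w j (conj z) 0 0
      = conj (star (S.jost l w j (conj z) 0 0) ⬝ᵥ S.jost l' w' j z 0 0) := by
    have := star_dotProduct_star (S.jost l' w' j z 0 0) (star (S.jost l w j (conj z) 0 0))
    rw [star_star] at this
    rw [this]; rfl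
  rw [coeff, coeff, Complex.conj_conj, map_div₀, gamma_conj, h]

/-- The two columns contribute the factors `z/(-i q₀)` and `z/(i q₀)`. Their product `z²/q₀²` is
also the ratio of `γ` at the two points, so it cancels. -/
lemma coeff_refl_two (hF : S.IsFundamental F) (hS : S.IsSolution) (he : S.IsEnd l w ε)
    (he' : S.IsEnd l' w' ε') {z : ℂ} (hz : conj z ∈ S.regJost ε 2) (hz' : z ∈ S.regJost ε' 2) :
    S.coeff l w l' w' 0 (S.refl z) = S.coeff l w l' w' 2 z := by
  have hq := hS.q0_pos.ne'
  have hq' : (S.q0 : ℂ) ≠ 0 := by exact_mod_cast hq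
  have h0 := regJost_ne_zero hz'
  have hg := regJost_gamma_ne hz'
  have hg0 : S.gamma 0 (S.refl z) = z ^ 2 / (S.q0 : ℂ) ^ 2 * S.gamma 2 z := gamma_refl hq h0
  rw [coeff, ← refl_conj, jost_refl_two hF hS he hz, jost_refl_two hF hS he' hz', hg0, coeff,
    star_smul, smul_dotProduct, dotProduct_smul, smul_eq_mul, smul_eq_mul]
  simp only [star_div₀, star_mul', RCLike.star_def, Complex.conj_conj, Complex.conj_I,
    Complex.conj_ofReal]
  field_simp
  simp

lemma coeff_refl_one (hF : S.IsFundamental F) (hS : S.IsSolution) (he : S.IsEnd l w ε)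
    (he' : S.IsEnd l' w' ε') {z : ℂ} (hz : conj z ∈ S.regJost ε 1) (hz' : z ∈ S.regJost ε' 1) :
    S.coeff l w l' w' 1 (S.refl z) = S.coeff l w l' w' 1 z := by
  rw [coeff, ← refl_conj, jost_refl_one hF hS he hz, jost_refl_one hF hS he' hz', coeff]
  rfl

end Potential

/-! ### Simple zeros, principal parts and simple poles. -/

section Poles

/-- `b` is holomorphic near `τ` with a simple zero at `τ`. -/
structure IsSimpleZero (b : ℂ → ℂ) (τ : ℂ) : Prop where
  analytic : AnalyticAt ℂ b τ
  zero : b τ = 0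
  deriv_ne : deriv b τ ≠ 0

/-- `f` has at most a simple pole at `τ`, with residue `R`. -/
def HasPrincipalPart (f : ℂ → Fin 3 → ℂ) (τ : ℂ) (R : Fin 3 → ℂ) : Prop :=
  ∃ g : ℂ → Fin 3 → ℂ, AnalyticAt ℂ g τ ∧ ∀ᶠ z in 𝓝[≠] τ, f z = (z - τ)⁻¹ • R + g z

lemma AnalyticAt.hasPrincipalPart {f : ℂ → Fin 3 → ℂ} {τ : ℂ} (hf : AnalyticAt ℂ f τ) :
    HasPrincipalPart f τ 0 :=
  ⟨f, hf, by simp⟩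

lemma AnalyticAt.dslope {E : Type*} [NormedAddCommGroup E] [NormedSpace ℂ E] [CompleteSpace E]
    {f : ℂ → E} {τ : ℂ} (hf : AnalyticAt ℂ f τ) : AnalyticAt ℂ (_root_.dslope f τ) τ := by
  obtain ⟨p, hp⟩ := hf
  exact hp.has_fpower_series_dslope_fslope.analyticAt

/-- Write `b = (z - τ) c` with `c τ = b' τ ≠ 0`. Then `c⁻¹ f` is analytic; its value at `τ` is the
residue and its slope is the regular part. -/
lemma IsSimpleZero.hasPrincipalPart {b : ℂ → ℂ} {τ : ℂ} (hb : IsSimpleZero b τ) {f : ℂ → Fin 3 → ℂ}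
    (hf : AnalyticAt ℂ f τ) :
    HasPrincipalPart (fun z => (b z)⁻¹ • f z) τ ((deriv b τ)⁻¹ • f τ) := by
  have hc := hb.analytic.dslope
  have hc0 : dslope b τ τ ≠ 0 := by rw [dslope_same]; exact hb.deriv_ne
  have hh : AnalyticAt ℂ (fun z => (dslope b τ z)⁻¹ • f z) τ := (hc.inv hc0).smul hf
  refine ⟨_, hh.dslope, ?_⟩
  filter_upwards [self_mem_nhdsWithin] with z hz
  have hz' : z - τ ≠ 0 := sub_ne_zero.2 hz
  have h1 := sub_smul_dslope b τ z
  rw [hb.zero, sub_zero, smul_eq_mul] at h1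
  have h2 := sub_smul_dslope (fun z => (dslope b τ z)⁻¹ • f z) τ z
  rw [dslope_same b] at h2
  rw [← h1, mul_inv, mul_smul, ← sub_eq_iff_eq_add', ← smul_sub, ← h2, smul_smul,
    inv_mul_cancel₀ hz', one_smul]

lemma IsSimpleZero.hasPrincipalPart_zero {b : ℂ → ℂ} {τ : ℂ} (hb : IsSimpleZero b τ)
    {f : ℂ → Fin 3 → ℂ} (hf : AnalyticAt ℂ f τ) (h0 : f τ = 0) :
    HasPrincipalPart (fun z => (b z)⁻¹ • f z) τ 0 := by
  simpa [h0] using hb.hasPrincipalPart hf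

lemma IsSimpleZero.map_conj {f g : ℂ → ℂ} {z : ℂ} (h : IsSimpleZero f z)
    (hg : AnalyticAt ℂ g (conj z)) (hfg : ∀ᶠ y in 𝓝 z, g (conj y) = conj (f y)) :
    IsSimpleZero g (conj z) := by
  refine ⟨hg, by rw [hfg.self_of_nhds, h.zero, map_zero], fun h0 => h.deriv_ne ?_⟩
  have h1 := hg.differentiableAt.hasDerivAt.conj_conj
  rw [Complex.conj_conj, h0, map_zero] at h1
  refine (h1.congr_of_eventuallyEq ?_).deriv
  filter_upwards [hfg] with y hy
  simp [hy]

/-- By the chain rule, if `g'` vanished at the image point then so would `f'` at `z`. -/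
lemma IsSimpleZero.map_comp {f g φ : ℂ → ℂ} {z : ℂ} (h : IsSimpleZero f z)
    (hφ : DifferentiableAt ℂ φ z) (hg : AnalyticAt ℂ g (φ z)) (hfg : ∀ᶠ y in 𝓝 z, g (φ y) = f y) :
    IsSimpleZero g (φ z) := by
  refine ⟨hg, by rw [hfg.self_of_nhds, h.zero], fun h0 => h.deriv_ne ?_⟩
  have h1 := hg.differentiableAt.hasDerivAt.comp z hφ.hasDerivAt
  rw [h0, zero_mul] at h1
  exact (h1.congr_of_eventuallyEq (hfg.mono fun y hy => hy.symm)).deriv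

lemma colMatrix_add (a b d a' b' d' : Fin 3 → ℂ) :
    colMatrix a b d + colMatrix a' b' d' = colMatrix (a + a') (b + b') (d + d') := by
  ext i j; fin_cases j <;> rfl

lemma smul_colMatrix (c : ℂ) (a b d : Fin 3 → ℂ) :
    c • colMatrix a b d = colMatrix (c • a) (c • b) (c • d) := by
  ext i j; fin_cases j <;> rfl

lemma HasSimplePole.of_columns {F : ℂ → Matrix (Fin 3) (Fin 3) ℂ} {f₀ f₁ f₂ : ℂ → Fin 3 → ℂ}
    {τ : ℂ} {R₀ R₁ R₂ : Fin 3 → ℂ} (hF : ∀ᶠ z in 𝓝 τ, F z = colMatrix (f₀ z) (f₁ z) (f₂ z))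
    (h₀ : HasPrincipalPart f₀ τ R₀) (h₁ : HasPrincipalPart f₁ τ R₁) (h₂ : HasPrincipalPart f₂ τ R₂)
    (hR : R₀ ≠ 0 ∨ R₁ ≠ 0 ∨ R₂ ≠ 0) : HasSimplePole F τ (colMatrix R₀ R₁ R₂) := by
  obtain ⟨g₀, hg₀, h₀⟩ := h₀
  obtain ⟨g₁, hg₁, h₁⟩ := h₁
  obtain ⟨g₂, hg₂, h₂⟩ := h₂
  refine ⟨fun h => ?_, fun z => colMatrix (g₀ z) (g₁ z) (g₂ z), fun i j => ?_, ?_⟩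
  · have hc : ∀ j, (fun i => colMatrix R₀ R₁ R₂ i j) = 0 := fun j => by rw [h]; rfl
    rcases hR with hR | hR | hR
    · exact hR (hc 0)
    · exact hR (hc 1)
    · exact hR (hc 2)
  · fin_cases j
    · exact analyticAt_pi_iff.1 hg₀ i
    · exact analyticAt_pi_iff.1 hg₁ i
    · exact analyticAt_pi_iff.1 hg₂ i
  · filter_upwards [nhdsWithin_le_nhds hF, h₀, h₁, h₂] with z hz e₀ e₁ e₂
    rw [hz, e₀, e₁, e₂, smul_colMatrix, colMatrix_add]

/-- Both the chosen continuation and the default value `0` are holomorphic on `D`. -/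
lemma differentiableOn_analyticContinuation (D B : Set ℂ) (g : ℂ → ℂ) :
    DifferentiableOn ℂ (analyticContinuation D B g) D := by
  rw [analyticContinuation]
  split_ifs with h
  · exact h.choose_spec.1
  · exact differentiableOn_const _

lemma AnalyticAt.crossProduct {f g : ℂ → Fin 3 → ℂ} {z : ℂ} (hf : AnalyticAt ℂ f z)
    (hg : AnalyticAt ℂ g z) : AnalyticAt ℂ (fun z => _root_.crossProduct (f z) (g z)) z := by
  have h1 := analyticAt_pi_iff.1 hf
  have h2 := analyticAt_pi_iff.1 hg
  refine analyticAt_pi_iff.2 fun i => ?_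
  simp only [cross_apply]
  fin_cases i
  · exact ((h1 1).mul (h2 2)).sub ((h1 2).mul (h2 1))
  · exact ((h1 2).mul (h2 0)).sub ((h1 0).mul (h2 2))
  · exact ((h1 0).mul (h2 1)).sub ((h1 1).mul (h2 0))

end Poles

/-! ### Analyticity and symmetry of the entries of `M^±`. -/

namespace Potential

open Set

variable {S : Potential} {F : ℝ → ℝ → ℂ → Matrix (Fin 3) (Fin 3) ℂ}

/-! Analyticity of the continued coefficients. -/

lemma analyticAt_a11 {z : ℂ} (hz : z ∈ S.D4) : AnalyticAt ℂ S.a11 z :=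
  (differentiableOn_analyticContinuation _ _ _).analyticAt (isOpen_D4.mem_nhds hz)

lemma analyticAt_a22 {z : ℂ} (hz : z.im < 0) : AnalyticAt ℂ S.a22 z :=
  (differentiableOn_analyticContinuation _ _ _).analyticAt (isOpen_lower.mem_nhds hz)

lemma analyticAt_a33 {z : ℂ} (hz : z ∈ S.D1) : AnalyticAt ℂ S.a33 z :=
  (differentiableOn_analyticContinuation _ _ _).analyticAt (isOpen_D1.mem_nhds hz)

lemma analyticAt_b11 {z : ℂ} (hz : z ∈ S.D3) : AnalyticAt ℂ S.b11 z :=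
  (differentiableOn_analyticContinuation _ _ _).analyticAt (isOpen_D3.mem_nhds hz)

lemma analyticAt_b22 {z : ℂ} (hz : 0 < z.im) : AnalyticAt ℂ S.b22 z :=
  (differentiableOn_analyticContinuation _ _ _).analyticAt (isOpen_upper.mem_nhds hz)

lemma analyticAt_b33 {z : ℂ} (hz : z ∈ S.D2) : AnalyticAt ℂ S.b33 z :=
  (differentiableOn_analyticContinuation _ _ _).analyticAt (isOpen_D2.mem_nhds hz)

/-! Symmetries of the continued coefficients. -/

lemma a11_refl (hF : S.IsFundamental F) (hS : S.IsSolution) {z : ℂ} (hz : z ∈ S.D1) :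
    S.a11 (S.refl z) = S.a33 z := by
  rw [a11_eqOn hF hS (refl_mem_D4 hS.q0_pos hz), a33_eqOn hF hS hz]
  exact coeff_refl_two hF hS (isEnd_plus hS) (isEnd_minus hS)
    (D2_subset_regJost hS.q0_pos (conj_mem_D2 hz)) (D1_subset_regJost hS.q0_pos hz)

lemma b33_conj (hF : S.IsFundamental F) (hS : S.IsSolution) {z : ℂ} (hz : z ∈ S.D1) :
    S.b33 (conj z) = conj (S.a33 z) := by
  rw [b33_eqOn hF hS (conj_mem_D2 hz), a33_eqOn hF hS hz]
  exact coeff_conj 2 z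

lemma b11_conj (hF : S.IsFundamental F) (hS : S.IsSolution) {z : ℂ} (hz : z ∈ S.D4) :
    S.b11 (conj z) = conj (S.a11 z) := by
  rw [b11_eqOn hF hS (conj_mem_D3 hz), a11_eqOn hF hS hz]
  exact coeff_conj 0 z

lemma a22_conj (hF : S.IsFundamental F) (hS : S.IsSolution) {z : ℂ} (hz : 0 < z.im) :
    S.a22 (conj z) = conj (S.b22 z) := by
  rw [a22_eqOn hF hS (show conj z ∈ {z : ℂ | z.im < 0} by simpa using hz), b22_eqOn hF hS hz]
  exact coeff_conj 1 z

lemma im_refl_pos (hq : S.q0 ≠ 0) {z : ℂ} (hz : 0 < z.im) : 0 < (S.refl z).im := by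
  rw [im_refl]
  exact mul_pos (im_refl_factor_pos hq (ne_zero_of_im_ne hz.ne')) hz

lemma b22_refl (hF : S.IsFundamental F) (hS : S.IsSolution) {z : ℂ} (hz : 0 < z.im) :
    S.b22 (S.refl z) = S.b22 z := by
  rw [b22_eqOn hF hS (im_refl_pos hS.q0_pos.ne' hz), b22_eqOn hF hS hz]
  exact coeff_refl_one hF hS (isEnd_minus hS) (isEnd_plus hS)
    (lower_subset_regJost (by simpa using hz)) (upper_subset_regJost hz)

lemma isSimpleZero_a11 (hF : S.IsFundamental F) (hS : S.IsSolution) {z : ℂ} (hz : z ∈ S.D1)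
    (h : IsSimpleZero S.a33 z) : IsSimpleZero S.a11 (S.refl z) :=
  h.map_comp (differentiableAt_refl (ne_zero_of_im_ne hz.2.ne'))
    (analyticAt_a11 (refl_mem_D4 hS.q0_pos hz))
    (Filter.mem_of_superset (isOpen_D1.mem_nhds hz) fun _ hy => a11_refl hF hS hy)

lemma isSimpleZero_b33 (hF : S.IsFundamental F) (hS : S.IsSolution) {z : ℂ} (hz : z ∈ S.D1)
    (h : IsSimpleZero S.a33 z) : IsSimpleZero S.b33 (conj z) :=
  h.map_conj (analyticAt_b33 (conj_mem_D2 hz))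
    (Filter.mem_of_superset (isOpen_D1.mem_nhds hz) fun _ hy => b33_conj hF hS hy)

lemma isSimpleZero_b11 (hF : S.IsFundamental F) (hS : S.IsSolution) {z : ℂ} (hz : z ∈ S.D4)
    (h : IsSimpleZero S.a11 z) : IsSimpleZero S.b11 (conj z) :=
  h.map_conj (analyticAt_b11 (conj_mem_D3 hz))
    (Filter.mem_of_superset (isOpen_D4.mem_nhds hz) fun _ hy => b11_conj hF hS hy)

lemma isSimpleZero_a22 (hF : S.IsFundamental F) (hS : S.IsSolution) {z : ℂ} (hz : 0 < z.im)
    (h : IsSimpleZero S.b22 z) : IsSimpleZero S.a22 (conj z) :=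
  h.map_conj (analyticAt_a22 (by simpa using hz))
    (Filter.mem_of_superset (isOpen_upper.mem_nhds hz) fun _ hy => a22_conj hF hS hy)

lemma isSimpleZero_b22 (hF : S.IsFundamental F) (hS : S.IsSolution) {z : ℂ} (hz : 0 < z.im)
    (h : IsSimpleZero S.b22 z) : IsSimpleZero S.b22 (S.refl z) :=
  h.map_comp (differentiableAt_refl (ne_zero_of_im_ne hz.ne'))
    (analyticAt_b22 (im_refl_pos hS.q0_pos.ne' hz))
    (Filter.mem_of_superset (isOpen_upper.mem_nhds hz) fun _ hy => b22_refl hF hS hy)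

/-! Analyticity of the eigenfunctions. -/

lemma analyticAt_theta (j : Fin 3) (x t : ℝ) {z : ℂ} (hz : z ≠ 0) :
    AnalyticAt ℂ (S.theta j x t) z :=
  DifferentiableOn.analyticAt (s := {0}ᶜ)
    (fun _ hy => (differentiableAt_theta j x t hy).differentiableWithinAt)
    (isOpen_compl_singleton.mem_nhds hz)

lemma analyticAt_PhiP_zero (hF : S.IsFundamental F) (hS : S.IsSolution) (x t : ℝ) {z : ℂ}
    (hz : z ∈ S.D3) : AnalyticAt ℂ (S.PhiP 0 x t) z :=
  (jostColumn hF hS (isEnd_plus hS) 0).analyticAt hF isOpen_D3 (D3_subset_regJost hS.q0_pos)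
    (fun _ hy => ne_zero_of_im_ne hy.2.ne) x t hz

lemma analyticAt_PhiP_one (hF : S.IsFundamental F) (hS : S.IsSolution) (x t : ℝ) {z : ℂ}
    (hz : 0 < z.im) : AnalyticAt ℂ (S.PhiP 1 x t) z :=
  (jostColumn hF hS (isEnd_plus hS) 1).analyticAt hF isOpen_upper upper_subset_regJost
    (fun _ hy => ne_zero_of_im_ne (ne_of_gt hy)) x t hz

lemma analyticAt_PhiP_two (hF : S.IsFundamental F) (hS : S.IsSolution) (x t : ℝ) {z : ℂ}
    (hz : z ∈ S.D2) : AnalyticAt ℂ (S.PhiP 2 x t) z :=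
  (jostColumn hF hS (isEnd_plus hS) 2).analyticAt hF isOpen_D2 (D2_subset_regJost hS.q0_pos)
    (fun _ hy => ne_zero_of_im_ne hy.2.ne) x t hz

lemma analyticAt_PhiM_zero (hF : S.IsFundamental F) (hS : S.IsSolution) (x t : ℝ) {z : ℂ}
    (hz : z ∈ S.D4) : AnalyticAt ℂ (S.PhiM 0 x t) z :=
  (jostColumn hF hS (isEnd_minus hS) 0).analyticAt hF isOpen_D4 (D4_subset_regJost hS.q0_pos)
    (fun _ hy => ne_zero_of_im_ne hy.2.ne') x t hz

lemma analyticAt_PhiM_one (hF : S.IsFundamental F) (hS : S.IsSolution) (x t : ℝ) {z : ℂ}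
    (hz : z.im < 0) : AnalyticAt ℂ (S.PhiM 1 x t) z :=
  (jostColumn hF hS (isEnd_minus hS) 1).analyticAt hF isOpen_lower lower_subset_regJost
    (fun _ hy => ne_zero_of_im_ne (ne_of_lt hy)) x t hz

lemma analyticAt_PhiM_two (hF : S.IsFundamental F) (hS : S.IsSolution) (x t : ℝ) {z : ℂ}
    (hz : z ∈ S.D1) : AnalyticAt ℂ (S.PhiM 2 x t) z :=
  (jostColumn hF hS (isEnd_minus hS) 2).analyticAt hF isOpen_D1 (D1_subset_regJost hS.q0_pos)
    (fun _ hy => ne_zero_of_im_ne hy.2.ne') x t hz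

lemma analyticAt_phase_smul {c : ℂ} (j : Fin 3) (x t : ℝ) {z : ℂ} (hz : z ≠ 0) {f : ℂ → Fin 3 → ℂ}
    (hf : AnalyticAt ℂ f z) : AnalyticAt ℂ (fun z => Complex.exp (c * S.theta j x t z) • f z) z :=
  (analyticAt_const.mul (analyticAt_theta j x t hz)).cexp.smul hf

lemma analyticAt_m1 (hF : S.IsFundamental F) (hS : S.IsSolution) (x t : ℝ) {z : ℂ}
    (hz : z ∈ S.D1) : AnalyticAt ℂ (S.m1 x t) z :=
  have h0 := ne_zero_of_im_ne hz.2.ne'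
  analyticAt_phase_smul 0 x t h0 <| analyticAt_phase_smul 1 x t h0 <| AnalyticAt.crossProduct
    (analyticAt_star_conj (analyticAt_PhiM_one hF hS x t (by simpa using hz.2)))
    (analyticAt_star_conj (analyticAt_PhiP_two hF hS x t (conj_mem_D2 hz)))

lemma analyticAt_m2 (hF : S.IsFundamental F) (hS : S.IsSolution) (x t : ℝ) {z : ℂ}
    (hz : z ∈ S.D2) : AnalyticAt ℂ (S.m2 x t) z :=
  have h0 := ne_zero_of_im_ne hz.2.ne
  analyticAt_phase_smul 0 x t h0 <| analyticAt_phase_smul 1 x t h0 <| AnalyticAt.crossProduct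
    (analyticAt_star_conj (analyticAt_PhiP_one hF hS x t (by simpa using hz.2)))
    (analyticAt_star_conj (analyticAt_PhiM_two hF hS x t (conj_mem_D1 hz)))

lemma analyticAt_m3 (hF : S.IsFundamental F) (hS : S.IsSolution) (x t : ℝ) {z : ℂ}
    (hz : z ∈ S.D3) : AnalyticAt ℂ (S.m3 x t) z :=
  have h0 := ne_zero_of_im_ne hz.2.ne
  analyticAt_phase_smul 0 x t h0 <| analyticAt_phase_smul 1 x t h0 <| AnalyticAt.crossProduct
    (analyticAt_star_conj (analyticAt_PhiM_zero hF hS x t (conj_mem_D4 hz)))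
    (analyticAt_star_conj (analyticAt_PhiP_one hF hS x t (by simpa using hz.2)))

lemma analyticAt_m4 (hF : S.IsFundamental F) (hS : S.IsSolution) (x t : ℝ) {z : ℂ}
    (hz : z ∈ S.D4) : AnalyticAt ℂ (S.m4 x t) z :=
  have h0 := ne_zero_of_im_ne hz.2.ne'
  analyticAt_phase_smul 0 x t h0 <| analyticAt_phase_smul 1 x t h0 <| AnalyticAt.crossProduct
    (analyticAt_star_conj (analyticAt_PhiP_zero hF hS x t (conj_mem_D3 hz)))
    (analyticAt_star_conj (analyticAt_PhiM_one hF hS x t (by simpa using hz.2)))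

/-! Poles of `M^±` in terms of their columns. -/

lemma Mplus_of_mem_D1 (x t : ℝ) {z : ℂ} (hz : z ∈ S.D1) : S.Mplus x t z =
    colMatrix ((S.b22 z)⁻¹ • S.m1 x t z) (S.muP 1 x t z) ((S.a33 z)⁻¹ • S.muM 2 x t z) :=
  if_pos hz

lemma Mplus_of_mem_D3 (x t : ℝ) {z : ℂ} (hz : z ∈ S.D3) : S.Mplus x t z =
    colMatrix (S.muP 0 x t z) ((S.a22 z)⁻¹ • S.muM 1 x t z) ((S.b11 z)⁻¹ • S.m3 x t z) :=
  (if_neg fun h => lt_asymm h.1 hz.1).trans (if_pos hz)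

lemma Mminus_of_mem_D2 (x t : ℝ) {z : ℂ} (hz : z ∈ S.D2) : S.Mminus x t z =
    colMatrix ((S.b33 z)⁻¹ • S.m2 x t z) ((S.a22 z)⁻¹ • S.muM 1 x t z) (S.muP 2 x t z) :=
  if_pos hz

lemma Mminus_of_mem_D4 (x t : ℝ) {z : ℂ} (hz : z ∈ S.D4) : S.Mminus x t z =
    colMatrix ((S.a11 z)⁻¹ • S.muM 0 x t z) (S.muP 1 x t z) ((S.b22 z)⁻¹ • S.m4 x t z) :=
  (if_neg fun h => lt_asymm h.1 hz.1).trans (if_pos hz)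

/-- In each region one column of `M^±` is a bare Jost column without denominator, so it contributes
no residue; here it is the middle one. -/
lemma hasSimplePole_D1 (hF : S.IsFundamental F) (hS : S.IsSolution) (x t : ℝ) {z : ℂ}
    (hz : z ∈ S.D1) {R₀ R₂ : Fin 3 → ℂ}
    (h₀ : HasPrincipalPart (fun z => (S.b22 z)⁻¹ • S.m1 x t z) z R₀)
    (h₂ : HasPrincipalPart (fun z => (S.a33 z)⁻¹ • S.muM 2 x t z) z R₂) (hR : R₀ ≠ 0 ∨ R₂ ≠ 0) :
    HasSimplePole (S.Mplus x t) z (colMatrix R₀ 0 R₂) :=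
  .of_columns (Filter.mem_of_superset (isOpen_D1.mem_nhds hz) fun _ hy => Mplus_of_mem_D1 x t hy) h₀
    (analyticAt_phase_smul 1 x t (ne_zero_of_im_ne hz.2.ne')
      (analyticAt_PhiP_one hF hS x t hz.2)).hasPrincipalPart h₂ (hR.imp_right Or.inr)

lemma hasSimplePole_D2 (hF : S.IsFundamental F) (hS : S.IsSolution) (x t : ℝ) {z : ℂ}
    (hz : z ∈ S.D2) {R₀ R₁ : Fin 3 → ℂ}
    (h₀ : HasPrincipalPart (fun z => (S.b33 z)⁻¹ • S.m2 x t z) z R₀)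
    (h₁ : HasPrincipalPart (fun z => (S.a22 z)⁻¹ • S.muM 1 x t z) z R₁) (hR : R₀ ≠ 0 ∨ R₁ ≠ 0) :
    HasSimplePole (S.Mminus x t) z (colMatrix R₀ R₁ 0) :=
  .of_columns (Filter.mem_of_superset (isOpen_D2.mem_nhds hz) fun _ hy => Mminus_of_mem_D2 x t hy)
    h₀ h₁ (analyticAt_phase_smul 2 x t (ne_zero_of_im_ne hz.2.ne)
      (analyticAt_PhiP_two hF hS x t hz)).hasPrincipalPart (hR.imp_right Or.inl)

lemma hasSimplePole_D3 (hF : S.IsFundamental F) (hS : S.IsSolution) (x t : ℝ) {z : ℂ}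
    (hz : z ∈ S.D3) {R₁ R₂ : Fin 3 → ℂ}
    (h₁ : HasPrincipalPart (fun z => (S.a22 z)⁻¹ • S.muM 1 x t z) z R₁)
    (h₂ : HasPrincipalPart (fun z => (S.b11 z)⁻¹ • S.m3 x t z) z R₂) (hR : R₁ ≠ 0 ∨ R₂ ≠ 0) :
    HasSimplePole (S.Mplus x t) z (colMatrix 0 R₁ R₂) :=
  .of_columns (Filter.mem_of_superset (isOpen_D3.mem_nhds hz) fun _ hy => Mplus_of_mem_D3 x t hy)
    (analyticAt_phase_smul 0 x t (ne_zero_of_im_ne hz.2.ne)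
      (analyticAt_PhiP_zero hF hS x t hz)).hasPrincipalPart h₁ h₂ (Or.inr hR)

lemma hasSimplePole_D4 (hF : S.IsFundamental F) (hS : S.IsSolution) (x t : ℝ) {z : ℂ}
    (hz : z ∈ S.D4) {R₀ R₂ : Fin 3 → ℂ}
    (h₀ : HasPrincipalPart (fun z => (S.a11 z)⁻¹ • S.muM 0 x t z) z R₀)
    (h₂ : HasPrincipalPart (fun z => (S.b22 z)⁻¹ • S.m4 x t z) z R₂) (hR : R₀ ≠ 0 ∨ R₂ ≠ 0) :
    HasSimplePole (S.Mminus x t) z (colMatrix R₀ 0 R₂) :=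
  .of_columns (Filter.mem_of_superset (isOpen_D4.mem_nhds hz) fun _ hy => Mminus_of_mem_D4 x t hy) h₀
    (analyticAt_phase_smul 1 x t (ne_zero_of_im_ne hz.2.ne')
      (analyticAt_PhiP_one hF hS x t hz.2)).hasPrincipalPart h₂ (hR.imp_right Or.inr)

end Potential

/-! ### Linear dependence through cross products in ℂ³. -/

section CrossProduct

lemma exists_smul_eq_of_crossProduct_eq_zero {u v : Fin 3 → ℂ} (hu : u ≠ 0)
    (h : crossProduct u v = 0) : ∃ s : ℂ, v = s • u := by
  by_contra! hne
  refine crossProduct_ne_zero_iff_linearIndependent.2 ?_ h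
  exact (LinearIndependent.pair_iff' hu).2 fun a ha => hne a ha.symm

lemma crossProduct_ne_zero_of_dotProduct {u v c : Fin 3 → ℂ} (hu : u ≠ 0) (h0 : c ⬝ᵥ u = 0)
    (h : c ⬝ᵥ v ≠ 0) : crossProduct u v ≠ 0 := fun h1 => by
  obtain ⟨s, rfl⟩ := exists_smul_eq_of_crossProduct_eq_zero hu h1
  exact h (by rw [dotProduct_smul, h0, smul_zero])

lemma exists_smul_crossProduct {u v w : Fin 3 → ℂ} (h : crossProduct u v ≠ 0) (hu : w ⬝ᵥ u = 0)
    (hv : w ⬝ᵥ v = 0) : ∃ s : ℂ, w = s • crossProduct u v := by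
  refine exists_smul_eq_of_crossProduct_eq_zero h ?_
  simp only [dotProduct, Fin.sum_univ_three] at hu hv
  ext i
  fin_cases i <;> simp [cross_apply]
  · linear_combination v 0 * hu - u 0 * hv
  · linear_combination v 1 * hu - u 1 * hv
  · linear_combination v 2 * hu - u 2 * hv

lemma star_crossProduct (u v : Fin 3 → ℂ) :
    star (crossProduct u v) = crossProduct (star u) (star v) := by
  ext i
  fin_cases i <;> simp [cross_apply]

end CrossProduct

/-! ### Proportionality of eigenfunctions at the eigenvalues. -/

namespace Potential

open Set

variable {S : Potential} {F : ℝ → ℝ → ℂ → Matrix (Fin 3) (Fin 3) ℂ} {l l' : Filter ℝ}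
  {w w' : Fin 2 → ℂ} {ε ε' : ℝ}

/-- A solution that vanishes at one point vanishes identically, as `F` is invertible. The normalized
limit would then be zero, while `Γ_j` is nonzero because `γ_j ≠ 0`. -/
lemma jost_ne_zero (hF : S.IsFundamental F) (hS : S.IsSolution) (he : S.IsEnd l w ε) {j : Fin 3}
    {z : ℂ} (hz : z ∈ S.regJost ε j) (x t : ℝ) : S.jost l w j z x t ≠ 0 := fun h => by
  have hJ := (jostColumn hF hS he j).isJost z hz
  have h0 : S.jost l w j z 0 0 = 0 := by
    have h1 := hJ.eq_fundamental hF x t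
    rw [h] at h1
    have := congrArg ((F x t (conj (S.k z)))ᴴ *ᵥ ·) h1
    simpa [mulVec_mulVec, hF.adj_mul] using this.symm
  have : l.NeBot := by rw [he.filter]; infer_instance
  have hlim := hJ.2.2 0
  have e : (fun x => Complex.exp (-Complex.I * S.theta j x 0 z) • S.jost l w j z x 0)
      = fun _ => 0 := funext fun x => by
    rw [hJ.eq_fundamental hF x 0, h0, mulVec_zero, smul_zero]
  rw [e] at hlim
  have hΓ := tendsto_nhds_unique hlim tendsto_const_nhds
  have hg := congrFun (congrFun (Gam_adj_mul he.norm hS.q0_pos.ne' (regJost_ne_zero hz)) j) j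
  rw [diagonal_apply_eq, Matrix.mul_apply] at hg
  refine regJost_gamma_ne hz (hg.symm.trans (Finset.sum_eq_zero fun i _ => ?_))
  rw [show S.Gam w z i j = 0 from congrFun hΓ i, mul_zero]

/-! The auxiliary eigenfunctions. -/

lemma chi1_eq (hF : S.IsFundamental F) (hS : S.IsSolution) (x t : ℝ) {z : ℂ} (hz : z ∈ S.D1) :
    S.chi1 x t z = F x t (S.k z) *ᵥ crossProduct (S.adjM 1 0 0 z) (S.adjP 2 0 0 z) :=
  IsJost.cross hF
    ((jostColumn hF hS (isEnd_minus hS) 1).isJost _ (lower_subset_regJost (by simpa using hz.2)))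
    ((jostColumn hF hS (isEnd_plus hS) 2).isJost _ (D2_subset_regJost hS.q0_pos (conj_mem_D2 hz))) x t

lemma chi2_eq (hF : S.IsFundamental F) (hS : S.IsSolution) (x t : ℝ) {z : ℂ} (hz : z ∈ S.D2) :
    S.chi2 x t z = F x t (S.k z) *ᵥ crossProduct (S.adjP 1 0 0 z) (S.adjM 2 0 0 z) :=
  IsJost.cross hF
    ((jostColumn hF hS (isEnd_plus hS) 1).isJost _ (upper_subset_regJost (by simpa using hz.2)))
    ((jostColumn hF hS (isEnd_minus hS) 2).isJost _ (D1_subset_regJost hS.q0_pos (conj_mem_D1 hz))) x t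

/-- The two factors of the cross product appear in opposite order, and the conjugate of `z^*/(i q₀)`
is `-z/(i q₀)`; the two signs cancel. -/
lemma chi3_refl (hF : S.IsFundamental F) (hS : S.IsSolution) (x t : ℝ) {z : ℂ} (hz : z ∈ S.D2) :
    S.chi3 x t (S.refl z) = (z / (Complex.I * S.q0)) • S.chi2 x t z := by
  have h0 := jost_refl_two hF hS (isEnd_minus hS) (D1_subset_regJost hS.q0_pos (conj_mem_D1 hz)) x t
  have h1 := jost_refl_one hF hS (isEnd_plus hS) (z := conj z)
    (upper_subset_regJost (by simpa using hz.2)) x t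
  rw [chi3, chi2, adjM, adjP, PhiM, PhiP, ← refl_conj, h0, h1,
    theta2_refl hS.q0_pos.ne' (ne_zero_of_im_ne hz.2.ne), adjP, adjM, PhiM, PhiP, star_smul,
    map_smul, LinearMap.smul_apply, ← cross_anticomm, smul_neg, smul_neg, smul_comm, ← neg_smul]
  congr 1
  simp [div_neg]

lemma chi4_refl (hF : S.IsFundamental F) (hS : S.IsSolution) (x t : ℝ) {z : ℂ} (hz : z ∈ S.D1) :
    S.chi4 x t (S.refl z) = (z / (Complex.I * S.q0)) • S.chi1 x t z := by
  have h0 := jost_refl_two hF hS (isEnd_plus hS) (D2_subset_regJost hS.q0_pos (conj_mem_D2 hz)) x t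
  have h1 := jost_refl_one hF hS (isEnd_minus hS) (z := conj z)
    (lower_subset_regJost (by simpa using hz.2)) x t
  rw [chi4, chi1, adjM, adjP, PhiM, PhiP, ← refl_conj, h0, h1,
    theta2_refl hS.q0_pos.ne' (ne_zero_of_im_ne hz.2.ne'), adjP, adjM, PhiM, PhiP, star_smul,
    map_smul, LinearMap.smul_apply, ← cross_anticomm, smul_neg, smul_neg, smul_comm, ← neg_smul]
  congr 1
  simp [div_neg]

lemma PhiM_zero_refl (hF : S.IsFundamental F) (hS : S.IsSolution) (x t : ℝ) {z : ℂ} (hz : z ∈ S.D1) :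
    S.PhiM 0 x t (S.refl z) = (z / (Complex.I * S.q0)) • S.PhiM 2 x t z :=
  jost_refl_two hF hS (isEnd_minus hS) (D1_subset_regJost hS.q0_pos hz) x t

lemma PhiP_zero_refl (hF : S.IsFundamental F) (hS : S.IsSolution) (x t : ℝ) {z : ℂ} (hz : z ∈ S.D2) :
    S.PhiP 0 x t (S.refl z) = (z / (Complex.I * S.q0)) • S.PhiP 2 x t z :=
  jost_refl_two hF hS (isEnd_plus hS) (D2_subset_regJost hS.q0_pos hz) x t

lemma PhiP_one_refl (hF : S.IsFundamental F) (hS : S.IsSolution) (x t : ℝ) {z : ℂ} (hz : z ∈ S.D1) :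
    S.PhiP 1 x t (S.refl z) = S.PhiP 1 x t z :=
  jost_refl_one hF hS (isEnd_plus hS) (upper_subset_regJost hz.2) x t

lemma PhiM_one_refl (hF : S.IsFundamental F) (hS : S.IsSolution) (x t : ℝ) {z : ℂ} (hz : z ∈ S.D2) :
    S.PhiM 1 x t (S.refl z) = S.PhiM 1 x t z :=
  jost_refl_one hF hS (isEnd_minus hS) (lower_subset_regJost hz.2) x t

/-! Bilinear relations in `D₁`. -/

/-- Both columns belong to the same end, and `ν₁ - ν₂ = z` has the sign that forces the pairing to
vanish throughout `D₁`. -/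
lemma adjM_one_dotProduct_PhiM_two (hF : S.IsFundamental F) (hS : S.IsSolution) {z : ℂ}
    (hz : z ∈ S.D1) : S.adjM 1 0 0 z ⬝ᵥ S.PhiM 2 0 0 z = 0 :=
  IsJost.pairing_eq_zero hF hS.q0_pos.ne' (isEnd_minus hS) (by decide) (ne_zero_of_im_ne hz.2.ne')
    (by
      have : S.nu 1 z - S.nu 2 z = z := by simp [nu, k, lam]; ring
      rw [this]; linarith [hz.2])
    ((jostColumn hF hS (isEnd_minus hS) 1).isJost _ (lower_subset_regJost (by simpa using hz.2)))
    ((jostColumn hF hS (isEnd_minus hS) 2).isJost _ (D1_subset_regJost hS.q0_pos hz))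

lemma adjP_two_dotProduct_PhiP_one (hF : S.IsFundamental F) (hS : S.IsSolution) {z : ℂ}
    (hz : z ∈ S.D1) : S.adjP 2 0 0 z ⬝ᵥ S.PhiP 1 0 0 z = 0 :=
  IsJost.pairing_eq_zero hF hS.q0_pos.ne' (isEnd_plus hS) (by decide) (ne_zero_of_im_ne hz.2.ne')
    (by
      have : S.nu 2 z - S.nu 1 z = -z := by simp [nu, k, lam]; ring
      rw [this, Complex.neg_im]; linarith [hz.2])
    ((jostColumn hF hS (isEnd_plus hS) 2).isJost _ (D2_subset_regJost hS.q0_pos (conj_mem_D2 hz)))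
    ((jostColumn hF hS (isEnd_plus hS) 1).isJost _ (upper_subset_regJost hz.2))

lemma a33_eq_zero_iff (hF : S.IsFundamental F) (hS : S.IsSolution) {z : ℂ} (hz : z ∈ S.D1) :
    S.a33 z = 0 ↔ S.adjP 2 0 0 z ⬝ᵥ S.PhiM 2 0 0 z = 0 := by
  rw [a33_eqOn hF hS hz, scatA, coeff, div_eq_zero_iff,
    or_iff_left (regJost_gamma_ne (D1_subset_regJost hS.q0_pos hz))]
  rfl

lemma b22_eq_zero_iff (hF : S.IsFundamental F) (hS : S.IsSolution) {z : ℂ} (hz : z ∈ S.D1) :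
    S.b22 z = 0 ↔ S.adjM 1 0 0 z ⬝ᵥ S.PhiP 1 0 0 z = 0 := by
  rw [b22_eqOn hF hS hz.2, scatB, coeff, div_eq_zero_iff,
    or_iff_left (regJost_gamma_ne (upper_subset_regJost hz.2))]
  rfl

lemma PhiM_two_ne_zero (hF : S.IsFundamental F) (hS : S.IsSolution) (x t : ℝ) {z : ℂ}
    (hz : z ∈ S.D1) : S.PhiM 2 x t z ≠ 0 :=
  jost_ne_zero hF hS (isEnd_minus hS) (D1_subset_regJost hS.q0_pos hz) x t

lemma PhiM_one_ne_zero (hF : S.IsFundamental F) (hS : S.IsSolution) (x t : ℝ) {z : ℂ}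
    (hz : z.im < 0) : S.PhiM 1 x t z ≠ 0 :=
  jost_ne_zero hF hS (isEnd_minus hS) (lower_subset_regJost hz) x t

lemma PhiP_one_ne_zero (hF : S.IsFundamental F) (hS : S.IsSolution) (x t : ℝ) {z : ℂ}
    (hz : 0 < z.im) : S.PhiP 1 x t z ≠ 0 :=
  jost_ne_zero hF hS (isEnd_plus hS) (upper_subset_regJost hz) x t

lemma PhiP_two_ne_zero (hF : S.IsFundamental F) (hS : S.IsSolution) (x t : ℝ) {z : ℂ}
    (hz : z ∈ S.D2) : S.PhiP 2 x t z ≠ 0 :=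
  jost_ne_zero hF hS (isEnd_plus hS) (D2_subset_regJost hS.q0_pos hz) x t

lemma PhiM_two_eq (hF : S.IsFundamental F) (hS : S.IsSolution) (x t : ℝ) {z : ℂ} (hz : z ∈ S.D1) :
    S.PhiM 2 x t z = F x t (S.k z) *ᵥ S.PhiM 2 0 0 z :=
  (jostColumn hF hS (isEnd_minus hS) 2).eq_fundamental hF (D1_subset_regJost hS.q0_pos hz) x t

lemma PhiM_one_eq (hF : S.IsFundamental F) (hS : S.IsSolution) (x t : ℝ) {z : ℂ} (hz : z.im < 0) :
    S.PhiM 1 x t z = F x t (S.k z) *ᵥ S.PhiM 1 0 0 z :=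
  (jostColumn hF hS (isEnd_minus hS) 1).eq_fundamental hF (lower_subset_regJost hz) x t

lemma PhiP_one_eq (hF : S.IsFundamental F) (hS : S.IsSolution) (x t : ℝ) {z : ℂ} (hz : 0 < z.im) :
    S.PhiP 1 x t z = F x t (S.k z) *ᵥ S.PhiP 1 0 0 z :=
  (jostColumn hF hS (isEnd_plus hS) 1).eq_fundamental hF (upper_subset_regJost hz) x t

lemma PhiP_two_eq (hF : S.IsFundamental F) (hS : S.IsSolution) (x t : ℝ) {z : ℂ} (hz : z ∈ S.D2) :
    S.PhiP 2 x t z = F x t (S.k z) *ᵥ S.PhiP 2 0 0 z :=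
  (jostColumn hF hS (isEnd_plus hS) 2).eq_fundamental hF (D2_subset_regJost hS.q0_pos hz) x t

/-- `χ₂(z^*)` in terms of the columns at `z`. -/
lemma chi2_conj_eq (hF : S.IsFundamental F) (hS : S.IsSolution) (x t : ℝ) {z : ℂ} (hz : z ∈ S.D1) :
    S.chi2 x t (conj z) = F x t (S.k (conj z)) *ᵥ
      star (crossProduct (S.PhiP 1 0 0 z) (S.PhiM 2 0 0 z)) := by
  rw [chi2_eq hF hS x t (conj_mem_D2 hz), star_crossProduct, adjP, adjM, Complex.conj_conj]

/-! Proportionality of the eigenfunctions at the eigenvalues. -/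

/-- With `b·n = 0`, the vector `n` is orthogonal to `a` and `b`, and `b` is orthogonal to `p` and
`n`. The value `a·p ≠ 0` keeps `a × b` and `p × n` from vanishing. The constant `eHat` is the
inverse of a conjugated factor, nonzero since `b ≠ 0`. -/
lemma IsFirstType.proportional (hF : S.IsFundamental F) (hS : S.IsSolution) {z : ℂ}
    (h : S.IsFirstType z) : ∃ e eHat : ℂ, eHat ≠ 0 ∧ ∀ x t, S.PhiM 2 x t z = e • S.chi1 x t z ∧
      S.chi2 x t (conj z) = eHat • S.PhiP 2 x t (conj z) := by
  have hz := h.mem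
  have han := adjM_one_dotProduct_PhiM_two hF hS hz
  have hbp := adjP_two_dotProduct_PhiP_one hF hS hz
  have hbn := (a33_eq_zero_iff hF hS hz).1 h.a33_zero
  have hap := (b22_eq_zero_iff hF hS hz).not.1 h.b22_ne
  have hb : S.adjP 2 0 0 z ≠ 0 :=
    star_ne_zero.2 (PhiP_two_ne_zero hF hS 0 0 (conj_mem_D2 hz))
  have hn := PhiM_two_ne_zero hF hS 0 0 hz
  have hab : crossProduct (S.adjM 1 0 0 z) (S.adjP 2 0 0 z) ≠ 0 := by
    rw [← cross_anticomm, neg_ne_zero]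
    exact crossProduct_ne_zero_of_dotProduct hb ((dotProduct_comm _ _).trans hbp)
      (by rwa [dotProduct_comm])
  have hpn : crossProduct (S.PhiP 1 0 0 z) (S.PhiM 2 0 0 z) ≠ 0 := by
    rw [← cross_anticomm, neg_ne_zero]
    exact crossProduct_ne_zero_of_dotProduct hn han hap
  obtain ⟨e, he⟩ := exists_smul_crossProduct hab ((dotProduct_comm _ _).trans han)
    ((dotProduct_comm _ _).trans hbn)
  obtain ⟨s, hs⟩ := exists_smul_crossProduct hpn hbp hbn
  have hs0 : s ≠ 0 := by rintro rfl; exact hb (by rw [hs, zero_smul])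
  refine ⟨e, (star s)⁻¹, inv_ne_zero (star_ne_zero.2 hs0), fun x t => ⟨?_, ?_⟩⟩
  · rw [PhiM_two_eq hF hS x t hz, chi1_eq hF hS x t hz, he, mulVec_smul]
  · have h1 := congrArg star hs
    rw [adjP, star_star, star_smul] at h1
    rw [PhiP_two_eq hF hS x t (conj_mem_D2 hz), chi2_conj_eq hF hS x t hz, h1, mulVec_smul,
      smul_smul, inv_mul_cancel₀ (star_ne_zero.2 hs0), one_smul]

/-- Now `a·p = 0`, so `p` is orthogonal to `a` and `b`, and `a` to `p` and `n`; here `b·n ≠ 0` keeps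
the cross products nonzero. -/
lemma IsSecondType.proportional (hF : S.IsFundamental F) (hS : S.IsSolution) {z : ℂ}
    (h : S.IsSecondType z) : ∃ f fHat : ℂ, f ≠ 0 ∧ ∀ x t, S.chi1 x t z = f • S.PhiP 1 x t z ∧
      S.PhiM 1 x t (conj z) = fHat • S.chi2 x t (conj z) := by
  have hz := h.mem
  have hz' : (conj z).im < 0 := by simpa using hz.2
  have han := adjM_one_dotProduct_PhiM_two hF hS hz
  have hbp := adjP_two_dotProduct_PhiP_one hF hS hz
  have hbn := (a33_eq_zero_iff hF hS hz).not.1 h.a33_ne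
  have hap := (b22_eq_zero_iff hF hS hz).1 h.b22_zero
  have ha : S.adjM 1 0 0 z ≠ 0 := star_ne_zero.2 (PhiM_one_ne_zero hF hS 0 0 hz')
  have hp := PhiP_one_ne_zero hF hS 0 0 hz.2
  have hab : crossProduct (S.adjM 1 0 0 z) (S.adjP 2 0 0 z) ≠ 0 :=
    crossProduct_ne_zero_of_dotProduct ha ((dotProduct_comm _ _).trans han)
      (by rwa [dotProduct_comm])
  have hpn : crossProduct (S.PhiP 1 0 0 z) (S.PhiM 2 0 0 z) ≠ 0 :=
    crossProduct_ne_zero_of_dotProduct hp hbp hbn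
  obtain ⟨s, hs⟩ := exists_smul_crossProduct hab ((dotProduct_comm _ _).trans hap)
    ((dotProduct_comm _ _).trans hbp)
  obtain ⟨r, hr⟩ := exists_smul_crossProduct hpn hap han
  have hs0 : s ≠ 0 := by rintro rfl; exact hp (by rw [hs, zero_smul])
  refine ⟨s⁻¹, star r, inv_ne_zero hs0, fun x t => ⟨?_, ?_⟩⟩
  · rw [PhiP_one_eq hF hS x t hz.2, chi1_eq hF hS x t hz, hs, mulVec_smul, smul_smul,
      inv_mul_cancel₀ hs0, one_smul]
  · have h1 := congrArg star hr
    rw [adjM, star_star, star_smul] at h1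
    rw [PhiM_one_eq hF hS x t hz', chi2_conj_eq hF hS x t hz, h1, mulVec_smul]

/-- All four pairings vanish, so orthogonality no longer singles out a direction. Proportionality
comes from the assumed vanishing of `χ₁` and `χ₂`, that is, of `a × b` and `p × n`. -/
lemma IsThirdType.proportional (hF : S.IsFundamental F) (hS : S.IsSolution) {z : ℂ}
    (h : S.IsThirdType z) : ∃ g gHat : ℂ, ∀ x t, S.PhiM 2 x t z = g • S.PhiP 1 x t z ∧
      S.PhiM 1 x t (conj z) = gHat • S.PhiP 2 x t (conj z) := by
  have hz := h.mem
  have hz' : (conj z).im < 0 := by simpa using hz.2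
  have hp := PhiP_one_ne_zero hF hS 0 0 hz.2
  have hb := PhiP_two_ne_zero hF hS 0 0 (conj_mem_D2 hz)
  have h1 : crossProduct (S.PhiP 1 0 0 z) (S.PhiM 2 0 0 z) = 0 := by
    have := h.chi2_zero 0 0
    rw [chi2_conj_eq hF hS 0 0 hz, hF.zero, one_mulVec, star_eq_zero] at this
    exact this
  have h2 : crossProduct (S.PhiP 2 0 0 (conj z)) (S.PhiM 1 0 0 (conj z)) = 0 := by
    have := h.chi1_zero 0 0
    rw [chi1_eq hF hS 0 0 hz, hF.zero, one_mulVec, adjM, adjP, ← star_crossProduct,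
      star_eq_zero] at this
    rw [← cross_anticomm, this, neg_zero]
  obtain ⟨g, hg⟩ := exists_smul_eq_of_crossProduct_eq_zero hp h1
  obtain ⟨s, hs⟩ := exists_smul_eq_of_crossProduct_eq_zero hb h2
  refine ⟨g, s, fun x t => ⟨?_, ?_⟩⟩
  · rw [PhiM_two_eq hF hS x t hz, PhiP_one_eq hF hS x t hz.2, hg, mulVec_smul]
  · rw [PhiM_one_eq hF hS x t hz', PhiP_two_eq hF hS x t (conj_mem_D2 hz), hs, mulVec_smul]

end Potential

/-! ### Residues of `M^±` at the four points of each orbit. -/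

namespace Potential

open Set

variable {S : Potential} {F : ℝ → ℝ → ℂ → Matrix (Fin 3) (Fin 3) ℂ}

lemma exp_mul_exp_eq {a b c : ℂ} (h : a + b = c) : Complex.exp a * Complex.exp b = Complex.exp c := by
  rw [← Complex.exp_add, h]

/-! Regular columns and columns with a simple pole. -/

lemma hasPrincipalPart_inv_smul {b : ℂ → ℂ} {f : ℂ → Fin 3 → ℂ} {τ : ℂ} (hb : AnalyticAt ℂ b τ)
    (h0 : b τ ≠ 0) (hf : AnalyticAt ℂ f τ) : HasPrincipalPart (fun z => (b z)⁻¹ • f z) τ 0 :=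
  ((hb.inv h0).smul hf).hasPrincipalPart

lemma analyticAt_muM_zero (hF : S.IsFundamental F) (hS : S.IsSolution) (x t : ℝ) {z : ℂ}
    (hz : z ∈ S.D4) : AnalyticAt ℂ (S.muM 0 x t) z :=
  analyticAt_phase_smul 0 x t (ne_zero_of_im_ne hz.2.ne') (analyticAt_PhiM_zero hF hS x t hz)

lemma analyticAt_muM_one (hF : S.IsFundamental F) (hS : S.IsSolution) (x t : ℝ) {z : ℂ}
    (hz : z.im < 0) : AnalyticAt ℂ (S.muM 1 x t) z :=
  analyticAt_phase_smul 1 x t (ne_zero_of_im_ne hz.ne) (analyticAt_PhiM_one hF hS x t hz)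

lemma analyticAt_muM_two (hF : S.IsFundamental F) (hS : S.IsSolution) (x t : ℝ) {z : ℂ}
    (hz : z ∈ S.D1) : AnalyticAt ℂ (S.muM 2 x t) z :=
  analyticAt_phase_smul 2 x t (ne_zero_of_im_ne hz.2.ne') (analyticAt_PhiM_two hF hS x t hz)

lemma colPlus_zero_D1 (x t : ℝ) {z : ℂ} (hz : z ∈ S.D1) :
    S.colPlus 0 x t z = (S.b22 z)⁻¹ • Complex.exp (-Complex.I * S.theta1 x t z) • S.chi1 x t z := by
  unfold colPlus; rw [Mplus_of_mem_D1 x t hz]; rfl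

lemma colPlus_one_D1 (x t : ℝ) {z : ℂ} (hz : z ∈ S.D1) :
    S.colPlus 1 x t z = Complex.exp (-Complex.I * S.theta2 x t z) • S.PhiP 1 x t z := by
  unfold colPlus; rw [Mplus_of_mem_D1 x t hz]; rfl

lemma colMinus_zero_D2 (x t : ℝ) {z : ℂ} (hz : z ∈ S.D2) :
    S.colMinus 0 x t z = (S.b33 z)⁻¹ • Complex.exp (-Complex.I * S.theta1 x t z) • S.chi2 x t z := by
  unfold colMinus; rw [Mminus_of_mem_D2 x t hz]; rfl

lemma colMinus_two_D2 (x t : ℝ) {z : ℂ} (hz : z ∈ S.D2) :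
    S.colMinus 2 x t z = Complex.exp (-Complex.I * -S.theta1 x t z) • S.PhiP 2 x t z := by
  unfold colMinus; rw [Mminus_of_mem_D2 x t hz]; rfl

lemma reflection_factor_ne (hS : S.IsSolution) {z : ℂ} (hz : z ≠ 0) : z / (Complex.I * S.q0) ≠ 0 :=
  div_ne_zero hz (mul_ne_zero Complex.I_ne_zero (by exact_mod_cast hS.q0_pos.ne'))

/-- The simple zero of `a₃₃` moves by symmetry to `b₃₃`, `b₁₁`, `a₁₁`, while `b₂₂` and `a₂₂` stay
nonzero at the four points. Hence exactly one column is singular at each point. The same constants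
serve at the reflected points because the reflection factor is written out in the residue. -/
lemma IsFirstType.poles (hF : S.IsFundamental F) (hS : S.IsSolution) {z : ℂ}
    (h : S.IsFirstType z) {e eHat : ℂ} (hne : eHat ≠ 0) (x t : ℝ)
    (h₁ : S.PhiM 2 x t z = e • S.chi1 x t z)
    (h₂ : S.chi2 x t (conj z) = eHat • S.PhiP 2 x t (conj z)) :
    HasSimplePole (S.Mplus x t) z
      (colMatrix 0 0 ((e * S.b22 z / deriv S.a33 z *
        Complex.exp (2 * Complex.I * S.theta1 x t z)) • S.colPlus 0 x t z)) ∧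
    HasSimplePole (S.Mminus x t) (conj z)
      (colMatrix ((eHat / deriv S.b33 (conj z) *
        Complex.exp (-2 * Complex.I * S.theta1 x t (conj z))) • S.colMinus 2 x t (conj z)) 0 0) ∧
    HasSimplePole (S.Mplus x t) (S.refl (conj z))
      (colMatrix 0 0 ((conj z / (Complex.I * S.q0) * (eHat / deriv S.b11 (S.refl (conj z))) *
        Complex.exp (2 * Complex.I * S.theta1 x t (S.refl (conj z)))) •
          S.colMinus 2 x t (conj z))) ∧
    HasSimplePole (S.Mminus x t) (S.refl z)
      (colMatrix ((z / (Complex.I * S.q0) * (e * S.b22 z / deriv S.a11 (S.refl z)) *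
        Complex.exp (-2 * Complex.I * S.theta1 x t (S.refl z))) • S.colPlus 0 x t z) 0 0) := by
  have hq := hS.q0_pos
  have hz := h.mem
  have hz2 := conj_mem_D2 hz
  have hz4 := refl_mem_D4 hq hz
  have hz3 := refl_mem_D3 hq hz2
  have h0 := ne_zero_of_im_ne hz.2.ne'
  have h0' := ne_zero_of_im_ne hz2.2.ne
  have hs : IsSimpleZero S.a33 z := ⟨analyticAt_a33 hz, h.a33_zero, h.a33_simple⟩
  have hs2 := isSimpleZero_b33 hF hS hz hs
  have hs4 := isSimpleZero_a11 hF hS hz hs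
  have hs3 := isSimpleZero_b11 hF hS hz4 hs4
  rw [← refl_conj] at hs3
  have hb := h.b22_ne
  have hb2 : S.a22 (conj z) ≠ 0 := by
    rw [a22_conj hF hS hz.2]; exact (map_ne_zero _).2 hb
  have hb4 : S.b22 (S.refl z) ≠ 0 := by rwa [b22_refl hF hS hz.2]
  have hb3 : S.a22 (S.refl (conj z)) ≠ 0 := by
    rw [refl_conj, a22_conj hF hS hz4.2]; exact (map_ne_zero _).2 hb4
  have hexp : ∀ y : ℂ, Complex.exp y ≠ 0 := Complex.exp_ne_zero
  have e1 : S.muM 2 x t z = Complex.exp (-Complex.I * -S.theta1 x t z) • e • S.chi1 x t z := by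
    rw [← h₁]; rfl
  have e2 : S.m2 x t (conj z) = Complex.exp (-Complex.I * S.theta1 x t (conj z)) •
      eHat • S.PhiP 2 x t (conj z) := by rw [← h₂]; rfl
  have e3 : S.m3 x t (S.refl (conj z)) = Complex.exp (Complex.I * S.theta1 x t (S.refl (conj z))) •
      (conj z / (Complex.I * S.q0)) • eHat • S.PhiP 2 x t (conj z) := by
    rw [← h₂, ← chi3_refl hF hS x t hz2]; rfl
  have e4 : S.muM 0 x t (S.refl z) = Complex.exp (-Complex.I * S.theta1 x t (S.refl z)) •
      (z / (Complex.I * S.q0)) • e • S.chi1 x t z := by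
    rw [← h₁, ← PhiM_zero_refl hF hS x t hz]; rfl
  have hP := PhiP_two_ne_zero hF hS x t hz2
  have hM := PhiM_two_ne_zero hF hS x t hz
  refine ⟨?_, ?_, ?_, ?_⟩
  · convert hasSimplePole_D1 hF hS x t hz
      (hasPrincipalPart_inv_smul (analyticAt_b22 hz.2) hb (analyticAt_m1 hF hS x t hz))
      (hs.hasPrincipalPart (analyticAt_muM_two hF hS x t hz))
      (Or.inr (smul_ne_zero (inv_ne_zero hs.deriv_ne) (smul_ne_zero (hexp _) hM))) using 2
    -- The first column of `M^+` is `χ₁` multiplied by `e^{-iθ₁}` and divided by `b₂₂`; expressing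
    -- `χ₁` through it produces the factors `b₂₂` and `e^{2iθ₁}`.
    rw [e1, colPlus_zero_D1 x t hz]
    simp only [smul_smul]
    congr 1
    rw [← exp_mul_exp_eq (show 2 * Complex.I * S.theta1 x t z + -Complex.I * S.theta1 x t z
      = -Complex.I * -S.theta1 x t z by ring)]
    field_simp
  · convert hasSimplePole_D2 hF hS x t hz2
      (hs2.hasPrincipalPart (analyticAt_m2 hF hS x t hz2))
      (hasPrincipalPart_inv_smul (analyticAt_a22 hz2.2) hb2 (analyticAt_muM_one hF hS x t hz2.2))
      (Or.inl (smul_ne_zero (inv_ne_zero hs2.deriv_ne)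
        (e2 ▸ smul_ne_zero (hexp _) (smul_ne_zero hne hP)))) using 2
    rw [e2, colMinus_two_D2 x t hz2]
    simp only [smul_smul]
    congr 1
    rw [← exp_mul_exp_eq (show -2 * Complex.I * S.theta1 x t (conj z) +
      -Complex.I * -S.theta1 x t (conj z) = -Complex.I * S.theta1 x t (conj z) by ring)]
    ring
  · convert hasSimplePole_D3 hF hS x t hz3
      (hasPrincipalPart_inv_smul (analyticAt_a22 hz3.2) hb3 (analyticAt_muM_one hF hS x t hz3.2))
      (hs3.hasPrincipalPart (analyticAt_m3 hF hS x t hz3))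
      (Or.inr (smul_ne_zero (inv_ne_zero hs3.deriv_ne)
        (e3 ▸ smul_ne_zero (hexp _) (smul_ne_zero (reflection_factor_ne hS h0')
          (smul_ne_zero hne hP))))) using 2
    rw [e3, colMinus_two_D2 x t hz2]
    simp only [smul_smul]
    congr 1
    rw [← exp_mul_exp_eq (show 2 * Complex.I * S.theta1 x t (S.refl (conj z)) +
      -Complex.I * -S.theta1 x t (conj z) = Complex.I * S.theta1 x t (S.refl (conj z)) by
        rw [theta1_refl hq.ne' h0']; ring)]
    ring
  · convert hasSimplePole_D4 hF hS x t hz4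
      (hs4.hasPrincipalPart (analyticAt_muM_zero hF hS x t hz4))
      (hasPrincipalPart_inv_smul (analyticAt_b22 hz4.2) hb4 (analyticAt_m4 hF hS x t hz4))
      (Or.inl (smul_ne_zero (inv_ne_zero hs4.deriv_ne)
        (e4 ▸ smul_ne_zero (hexp _) (smul_ne_zero (reflection_factor_ne hS h0) (h₁ ▸ hM))))) using 2
    rw [e4, colPlus_zero_D1 x t hz]
    simp only [smul_smul]
    congr 1
    rw [← exp_mul_exp_eq (show -2 * Complex.I * S.theta1 x t (S.refl z) +
      -Complex.I * S.theta1 x t z = -Complex.I * S.theta1 x t (S.refl z) by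
        rw [theta1_refl hq.ne' h0]; ring)]
    field_simp

/-- The roles are exchanged: the zero of `b₂₂` moves to `a₂₂` and to the reflected points. The
second Jost columns are invariant under reflection while `χ₃` and `χ₄` acquire a factor, which is
why `fChk` and `fTld` differ from `fHat` and `f`. -/
lemma IsSecondType.poles (hF : S.IsFundamental F) (hS : S.IsSolution) {z : ℂ}
    (h : S.IsSecondType z) {f fHat fChk fTld : ℂ} (hne : f ≠ 0)
    (hChk : fChk * (conj z / (Complex.I * S.q0)) = fHat)
    (hTld : fTld = f * (z / (Complex.I * S.q0))) (x t : ℝ)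
    (h₁ : S.chi1 x t z = f • S.PhiP 1 x t z)
    (h₂ : S.PhiM 1 x t (conj z) = fHat • S.chi2 x t (conj z)) :
    HasSimplePole (S.Mplus x t) z
      (colMatrix ((f / deriv S.b22 z *
        Complex.exp (Complex.I * (S.theta2 x t z - S.theta1 x t z))) • S.colPlus 1 x t z) 0 0) ∧
    HasSimplePole (S.Mminus x t) (conj z)
      (colMatrix 0 ((fHat * S.b33 (conj z) / deriv S.a22 (conj z) *
        Complex.exp (Complex.I * (S.theta1 x t (conj z) - S.theta2 x t (conj z)))) •
          S.colMinus 0 x t (conj z)) 0) ∧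
    HasSimplePole (S.Mplus x t) (S.refl (conj z))
      (colMatrix 0 ((conj z / (Complex.I * S.q0) *
        (fChk * S.b33 (conj z) / deriv S.a22 (S.refl (conj z))) *
        Complex.exp (-Complex.I * (S.theta1 x t (S.refl (conj z)) + S.theta2 x t (S.refl (conj z))))) •
          S.colMinus 0 x t (conj z)) 0) ∧
    HasSimplePole (S.Mminus x t) (S.refl z)
      (colMatrix 0 0 ((fTld / deriv S.b22 (S.refl z) *
        Complex.exp (Complex.I * (S.theta1 x t (S.refl z) + S.theta2 x t (S.refl z)))) •
          S.colPlus 1 x t z)) := by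
  have hq := hS.q0_pos
  have hz := h.mem
  have hz2 := conj_mem_D2 hz
  have hz4 := refl_mem_D4 hq hz
  have hz3 := refl_mem_D3 hq hz2
  have h0 := ne_zero_of_im_ne hz.2.ne'
  have h0' := ne_zero_of_im_ne hz2.2.ne
  have hs : IsSimpleZero S.b22 z := ⟨analyticAt_b22 hz.2, h.b22_zero, h.b22_simple⟩
  have hs2 := isSimpleZero_a22 hF hS hz.2 hs
  have hs4 := isSimpleZero_b22 hF hS hz.2 hs
  have hs3 := isSimpleZero_a22 hF hS hz4.2 hs4
  rw [← refl_conj] at hs3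
  have ha := h.a33_ne
  have ha2 : S.b33 (conj z) ≠ 0 := by
    rw [b33_conj hF hS hz]; exact (map_ne_zero _).2 ha
  have ha4 : S.a11 (S.refl z) ≠ 0 := by rwa [a11_refl hF hS hz]
  have ha3 : S.b11 (S.refl (conj z)) ≠ 0 := by
    rw [refl_conj, b11_conj hF hS hz4]; exact (map_ne_zero _).2 ha4
  have hexp : ∀ y : ℂ, Complex.exp y ≠ 0 := Complex.exp_ne_zero
  have e1 : S.m1 x t z = Complex.exp (-Complex.I * S.theta1 x t z) • f • S.PhiP 1 x t z := by
    rw [← h₁]; rfl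
  have e2 : S.muM 1 x t (conj z) = Complex.exp (-Complex.I * S.theta2 x t (conj z)) •
      fHat • S.chi2 x t (conj z) := by rw [← h₂]; rfl
  have e3 : S.muM 1 x t (S.refl (conj z)) =
      Complex.exp (-Complex.I * S.theta2 x t (S.refl (conj z))) • fHat • S.chi2 x t (conj z) := by
    rw [← h₂, ← PhiM_one_refl hF hS x t hz2]; rfl
  have e4 : S.m4 x t (S.refl z) = Complex.exp (Complex.I * S.theta1 x t (S.refl z)) •
      (z / (Complex.I * S.q0)) • f • S.PhiP 1 x t z := by
    rw [← h₁, ← chi4_refl hF hS x t hz]; rfl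
  have hP := PhiP_one_ne_zero hF hS x t hz.2
  have hM := PhiM_one_ne_zero hF hS x t hz2.2
  refine ⟨?_, ?_, ?_, ?_⟩
  · convert hasSimplePole_D1 hF hS x t hz
      (hs.hasPrincipalPart (analyticAt_m1 hF hS x t hz))
      (hasPrincipalPart_inv_smul (analyticAt_a33 hz) ha (analyticAt_muM_two hF hS x t hz))
      (Or.inl (smul_ne_zero (inv_ne_zero hs.deriv_ne)
        (e1 ▸ smul_ne_zero (hexp _) (smul_ne_zero hne hP)))) using 2
    rw [e1, colPlus_one_D1 x t hz]
    simp only [smul_smul]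
    congr 1
    rw [← exp_mul_exp_eq (show Complex.I * (S.theta2 x t z - S.theta1 x t z) +
      -Complex.I * S.theta2 x t z = -Complex.I * S.theta1 x t z by ring)]
    ring
  · convert hasSimplePole_D2 hF hS x t hz2
      (hasPrincipalPart_inv_smul (analyticAt_b33 hz2) ha2 (analyticAt_m2 hF hS x t hz2))
      (hs2.hasPrincipalPart (analyticAt_muM_one hF hS x t hz2.2))
      (Or.inr (smul_ne_zero (inv_ne_zero hs2.deriv_ne) (smul_ne_zero (hexp _) hM))) using 2
    rw [e2, colMinus_zero_D2 x t hz2]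
    simp only [smul_smul]
    congr 1
    rw [← exp_mul_exp_eq (show Complex.I * (S.theta1 x t (conj z) - S.theta2 x t (conj z)) +
      -Complex.I * S.theta1 x t (conj z) = -Complex.I * S.theta2 x t (conj z) by ring)]
    field_simp
  · convert hasSimplePole_D3 hF hS x t hz3
      (hs3.hasPrincipalPart (analyticAt_muM_one hF hS x t hz3.2))
      (hasPrincipalPart_inv_smul (analyticAt_b11 hz3) ha3 (analyticAt_m3 hF hS x t hz3))
      (Or.inl (smul_ne_zero (inv_ne_zero hs3.deriv_ne) (smul_ne_zero (hexp _)
        (PhiM_one_ne_zero hF hS x t hz3.2)))) using 2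
    rw [e3, colMinus_zero_D2 x t hz2, ← hChk]
    simp only [smul_smul]
    congr 1
    rw [← exp_mul_exp_eq (show -Complex.I *
      (S.theta1 x t (S.refl (conj z)) + S.theta2 x t (S.refl (conj z))) +
      -Complex.I * S.theta1 x t (conj z) = -Complex.I * S.theta2 x t (S.refl (conj z)) by
        rw [theta1_refl hq.ne' h0']; ring)]
    field_simp
  · convert hasSimplePole_D4 hF hS x t hz4
      (hasPrincipalPart_inv_smul (analyticAt_a11 hz4) ha4 (analyticAt_muM_zero hF hS x t hz4))
      (hs4.hasPrincipalPart (analyticAt_m4 hF hS x t hz4))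
      (Or.inr (smul_ne_zero (inv_ne_zero hs4.deriv_ne)
        (e4 ▸ smul_ne_zero (hexp _) (smul_ne_zero (reflection_factor_ne hS h0)
          (smul_ne_zero hne hP))))) using 2
    rw [e4, colPlus_one_D1 x t hz, hTld]
    simp only [smul_smul]
    congr 1
    rw [← exp_mul_exp_eq (show Complex.I * (S.theta1 x t (S.refl z) + S.theta2 x t (S.refl z)) +
      -Complex.I * S.theta2 x t z = Complex.I * S.theta1 x t (S.refl z) by
        rw [theta2_refl hq.ne' h0]; ring)]
    ring

/-- At each point two columns have a vanishing denominator. In the one built from an auxiliary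
eigenfunction the numerator vanishes too, by assumption or by reflection, so over a simple zero it
stays regular; only the Jost column has a pole. -/
lemma IsThirdType.poles (hF : S.IsFundamental F) (hS : S.IsSolution) {z : ℂ}
    (h : S.IsThirdType z) {g gHat gChk gTld : ℂ}
    (hChk : gChk * (conj z / (Complex.I * S.q0)) = gHat)
    (hTld : gTld = g * (z / (Complex.I * S.q0))) (x t : ℝ)
    (h₁ : S.PhiM 2 x t z = g • S.PhiP 1 x t z)
    (h₂ : S.PhiM 1 x t (conj z) = gHat • S.PhiP 2 x t (conj z)) :
    HasSimplePole (S.Mplus x t) z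
      (colMatrix 0 0 ((g / deriv S.a33 z *
        Complex.exp (Complex.I * (S.theta1 x t z + S.theta2 x t z))) • S.colPlus 1 x t z)) ∧
    HasSimplePole (S.Mminus x t) (conj z)
      (colMatrix 0 ((gHat / deriv S.a22 (conj z) *
        Complex.exp (-Complex.I * (S.theta2 x t (conj z) + S.theta1 x t (conj z)))) •
          S.colMinus 2 x t (conj z)) 0) ∧
    HasSimplePole (S.Mplus x t) (S.refl (conj z))
      (colMatrix 0 ((conj z / (Complex.I * S.q0) * (gChk / deriv S.a22 (S.refl (conj z))) *
        Complex.exp (Complex.I * (S.theta1 x t (S.refl (conj z)) - S.theta2 x t (S.refl (conj z))))) •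
          S.colMinus 2 x t (conj z)) 0) ∧
    HasSimplePole (S.Mminus x t) (S.refl z)
      (colMatrix ((gTld / deriv S.a11 (S.refl z) *
        Complex.exp (Complex.I * (S.theta2 x t (S.refl z) - S.theta1 x t (S.refl z)))) •
          S.colPlus 1 x t z) 0 0) := by
  have hq := hS.q0_pos
  have hz := h.mem
  have hz2 := conj_mem_D2 hz
  have hz4 := refl_mem_D4 hq hz
  have hz3 := refl_mem_D3 hq hz2
  have h0 := ne_zero_of_im_ne hz.2.ne'
  have h0' := ne_zero_of_im_ne hz2.2.ne
  have ha : IsSimpleZero S.a33 z := ⟨analyticAt_a33 hz, h.a33_zero, h.a33_simple⟩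
  have ha2 := isSimpleZero_b33 hF hS hz ha
  have ha4 := isSimpleZero_a11 hF hS hz ha
  have ha3 := isSimpleZero_b11 hF hS hz4 ha4
  have hb : IsSimpleZero S.b22 z := ⟨analyticAt_b22 hz.2, h.b22_zero, h.b22_simple⟩
  have hb2 := isSimpleZero_a22 hF hS hz.2 hb
  have hb4 := isSimpleZero_b22 hF hS hz.2 hb
  have hb3 := isSimpleZero_a22 hF hS hz4.2 hb4
  rw [← refl_conj] at ha3 hb3
  have hexp : ∀ y : ℂ, Complex.exp y ≠ 0 := Complex.exp_ne_zero
  have c1 : S.m1 x t z = 0 := by rw [m1, h.chi1_zero, smul_zero]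
  have c2 : S.m2 x t (conj z) = 0 := by rw [m2, h.chi2_zero, smul_zero]
  have c3 : S.m3 x t (S.refl (conj z)) = 0 := by
    rw [m3, chi3_refl hF hS x t hz2, h.chi2_zero, smul_zero, smul_zero]
  have c4 : S.m4 x t (S.refl z) = 0 := by
    rw [m4, chi4_refl hF hS x t hz, h.chi1_zero, smul_zero, smul_zero]
  have e1 : S.muM 2 x t z = Complex.exp (-Complex.I * -S.theta1 x t z) • g • S.PhiP 1 x t z := by
    rw [← h₁]; rfl
  have e2 : S.muM 1 x t (conj z) = Complex.exp (-Complex.I * S.theta2 x t (conj z)) •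
      gHat • S.PhiP 2 x t (conj z) := by rw [← h₂]; rfl
  have e3 : S.muM 1 x t (S.refl (conj z)) =
      Complex.exp (-Complex.I * S.theta2 x t (S.refl (conj z))) • gHat • S.PhiP 2 x t (conj z) := by
    rw [← h₂, ← PhiM_one_refl hF hS x t hz2]; rfl
  have e4 : S.muM 0 x t (S.refl z) = Complex.exp (-Complex.I * S.theta1 x t (S.refl z)) •
      (z / (Complex.I * S.q0)) • g • S.PhiP 1 x t z := by
    rw [← h₁, ← PhiM_zero_refl hF hS x t hz]; rfl
  have hM := PhiM_two_ne_zero hF hS x t hz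
  refine ⟨?_, ?_, ?_, ?_⟩
  · convert hasSimplePole_D1 hF hS x t hz
      (hb.hasPrincipalPart_zero (analyticAt_m1 hF hS x t hz) c1)
      (ha.hasPrincipalPart (analyticAt_muM_two hF hS x t hz))
      (Or.inr (smul_ne_zero (inv_ne_zero ha.deriv_ne) (smul_ne_zero (hexp _) hM))) using 2
    rw [e1, colPlus_one_D1 x t hz]
    simp only [smul_smul]
    congr 1
    rw [← exp_mul_exp_eq (show Complex.I * (S.theta1 x t z + S.theta2 x t z) +
      -Complex.I * S.theta2 x t z = -Complex.I * -S.theta1 x t z by ring)]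
    ring
  · convert hasSimplePole_D2 hF hS x t hz2
      (ha2.hasPrincipalPart_zero (analyticAt_m2 hF hS x t hz2) c2)
      (hb2.hasPrincipalPart (analyticAt_muM_one hF hS x t hz2.2))
      (Or.inr (smul_ne_zero (inv_ne_zero hb2.deriv_ne) (smul_ne_zero (hexp _)
        (PhiM_one_ne_zero hF hS x t hz2.2)))) using 2
    rw [e2, colMinus_two_D2 x t hz2]
    simp only [smul_smul]
    congr 1
    rw [← exp_mul_exp_eq (show -Complex.I * (S.theta2 x t (conj z) + S.theta1 x t (conj z)) +
      -Complex.I * -S.theta1 x t (conj z) = -Complex.I * S.theta2 x t (conj z) by ring)]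
    ring
  · convert hasSimplePole_D3 hF hS x t hz3
      (hb3.hasPrincipalPart (analyticAt_muM_one hF hS x t hz3.2))
      (ha3.hasPrincipalPart_zero (analyticAt_m3 hF hS x t hz3) c3)
      (Or.inl (smul_ne_zero (inv_ne_zero hb3.deriv_ne) (smul_ne_zero (hexp _)
        (PhiM_one_ne_zero hF hS x t hz3.2)))) using 2
    rw [e3, colMinus_two_D2 x t hz2, ← hChk]
    simp only [smul_smul]
    congr 1
    rw [← exp_mul_exp_eq (show Complex.I *
      (S.theta1 x t (S.refl (conj z)) - S.theta2 x t (S.refl (conj z))) +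
      -Complex.I * -S.theta1 x t (conj z) = -Complex.I * S.theta2 x t (S.refl (conj z)) by
        rw [theta1_refl hq.ne' h0']; ring)]
    ring
  · convert hasSimplePole_D4 hF hS x t hz4
      (ha4.hasPrincipalPart (analyticAt_muM_zero hF hS x t hz4))
      (hb4.hasPrincipalPart_zero (analyticAt_m4 hF hS x t hz4) c4)
      (Or.inl (smul_ne_zero (inv_ne_zero ha4.deriv_ne)
        (e4 ▸ smul_ne_zero (hexp _) (smul_ne_zero (reflection_factor_ne hS h0) (h₁ ▸ hM))))) using 2
    rw [e4, colPlus_one_D1 x t hz, hTld]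
    simp only [smul_smul]
    congr 1
    rw [← exp_mul_exp_eq (show Complex.I * (S.theta2 x t (S.refl z) - S.theta1 x t (S.refl z)) +
      -Complex.I * S.theta2 x t z = -Complex.I * S.theta1 x t (S.refl z) by
        rw [theta2_refl hq.ne' h0]; ring)]
    ring

end Potential

end

theorem mainTheorem8 (S : Potential) (hS : S.IsSolution) :
    -- first type
    (∀ z : ℂ, S.IsFirstType z → ∃ e eHat eChk eTld : ℂ,
      (∀ x t : ℝ,
        S.PhiM 2 x t z = e • S.chi1 x t z ∧
        S.chi2 x t (conj z) = eHat • S.PhiP 2 x t (conj z) ∧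
        S.chi3 x t (S.refl (conj z)) = eChk • S.PhiP 0 x t (S.refl (conj z)) ∧
        S.PhiM 0 x t (S.refl z) = eTld • S.chi4 x t (S.refl z)) ∧
      (∀ x t : ℝ,
        HasSimplePole (S.Mplus x t) z
          (colMatrix 0 0
            ((e * S.b22 z / deriv S.a33 z *
              Complex.exp (2 * Complex.I * S.theta1 x t z)) • S.colPlus 0 x t z)) ∧
        HasSimplePole (S.Mminus x t) (conj z)
          (colMatrix
            ((eHat / deriv S.b33 (conj z) *
              Complex.exp (-2 * Complex.I * S.theta1 x t (conj z))) • S.colMinus 2 x t (conj z))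
            0 0) ∧
        HasSimplePole (S.Mplus x t) (S.refl (conj z))
          (colMatrix 0 0
            ((conj z / (Complex.I * S.q0) * (eChk / deriv S.b11 (S.refl (conj z))) *
              Complex.exp (2 * Complex.I * S.theta1 x t (S.refl (conj z)))) •
                S.colMinus 2 x t (conj z))) ∧
        HasSimplePole (S.Mminus x t) (S.refl z)
          (colMatrix
            ((z / (Complex.I * S.q0) * (eTld * S.b22 z / deriv S.a11 (S.refl z)) *
              Complex.exp (-2 * Complex.I * S.theta1 x t (S.refl z))) • S.colPlus 0 x t z)
            0 0))) ∧
    -- second type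
    (∀ ζ : ℂ, S.IsSecondType ζ → ∃ f fHat fChk fTld : ℂ,
      (∀ x t : ℝ,
        S.chi1 x t ζ = f • S.PhiP 1 x t ζ ∧
        S.PhiM 1 x t (conj ζ) = fHat • S.chi2 x t (conj ζ) ∧
        S.PhiM 1 x t (S.refl (conj ζ)) = fChk • S.chi3 x t (S.refl (conj ζ)) ∧
        S.chi4 x t (S.refl ζ) = fTld • S.PhiP 1 x t (S.refl ζ)) ∧
      (∀ x t : ℝ,
        HasSimplePole (S.Mplus x t) ζ
          (colMatrix
            ((f / deriv S.b22 ζ *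
              Complex.exp (Complex.I * (S.theta2 x t ζ - S.theta1 x t ζ))) • S.colPlus 1 x t ζ)
            0 0) ∧
        HasSimplePole (S.Mminus x t) (conj ζ)
          (colMatrix 0
            ((fHat * S.b33 (conj ζ) / deriv S.a22 (conj ζ) *
              Complex.exp (Complex.I * (S.theta1 x t (conj ζ) - S.theta2 x t (conj ζ)))) •
                S.colMinus 0 x t (conj ζ))
            0) ∧
        HasSimplePole (S.Mplus x t) (S.refl (conj ζ))
          (colMatrix 0
            ((conj ζ / (Complex.I * S.q0) *
              (fChk * S.b33 (conj ζ) / deriv S.a22 (S.refl (conj ζ))) *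
              Complex.exp (-Complex.I *
                (S.theta1 x t (S.refl (conj ζ)) + S.theta2 x t (S.refl (conj ζ))))) •
                S.colMinus 0 x t (conj ζ))
            0) ∧
        HasSimplePole (S.Mminus x t) (S.refl ζ)
          (colMatrix 0 0
            ((fTld / deriv S.b22 (S.refl ζ) *
              Complex.exp (Complex.I *
                (S.theta1 x t (S.refl ζ) + S.theta2 x t (S.refl ζ)))) • S.colPlus 1 x t ζ)))) ∧
    -- third type
    (∀ ω : ℂ, S.IsThirdType ω → ∃ g gHat gChk gTld : ℂ,
      (∀ x t : ℝ,
        S.PhiM 2 x t ω = g • S.PhiP 1 x t ω ∧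
        S.PhiM 1 x t (conj ω) = gHat • S.PhiP 2 x t (conj ω) ∧
        S.PhiM 1 x t (S.refl (conj ω)) = gChk • S.PhiP 0 x t (S.refl (conj ω)) ∧
        S.PhiM 0 x t (S.refl ω) = gTld • S.PhiP 1 x t (S.refl ω)) ∧
      (∀ x t : ℝ,
        HasSimplePole (S.Mplus x t) ω
          (colMatrix 0 0
            ((g / deriv S.a33 ω *
              Complex.exp (Complex.I * (S.theta1 x t ω + S.theta2 x t ω))) •
                S.colPlus 1 x t ω)) ∧
        HasSimplePole (S.Mminus x t) (conj ω)
          (colMatrix 0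
            ((gHat / deriv S.a22 (conj ω) *
              Complex.exp (-Complex.I * (S.theta2 x t (conj ω) + S.theta1 x t (conj ω)))) •
                S.colMinus 2 x t (conj ω))
            0) ∧
        HasSimplePole (S.Mplus x t) (S.refl (conj ω))
          (colMatrix 0
            ((conj ω / (Complex.I * S.q0) * (gChk / deriv S.a22 (S.refl (conj ω))) *
              Complex.exp (Complex.I *
                (S.theta1 x t (S.refl (conj ω)) - S.theta2 x t (S.refl (conj ω))))) •
                S.colMinus 2 x t (conj ω))
            0) ∧
        HasSimplePole (S.Mminus x t) (S.refl ω)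
          (colMatrix
            ((gTld / deriv S.a11 (S.refl ω) *
              Complex.exp (Complex.I *
                (S.theta2 x t (S.refl ω) - S.theta1 x t (S.refl ω)))) • S.colPlus 1 x t ω)
            0 0))) := by
  obtain ⟨F, hF⟩ := Potential.exists_isFundamental hS
  refine ⟨fun z h => ?_, fun z h => ?_, fun z h => ?_⟩
  · obtain ⟨e, eHat, hne, hrel⟩ := h.proportional hF hS
    -- Both sides of each relation acquire the same factor under reflection, so the norming
    -- constants are unchanged.
    refine ⟨e, eHat, eHat, e, fun x t => ⟨(hrel x t).1, (hrel x t).2, ?_, ?_⟩, fun x t =>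
      h.poles hF hS hne x t (hrel x t).1 (hrel x t).2⟩
    · rw [Potential.chi3_refl hF hS x t (Potential.conj_mem_D2 h.mem), (hrel x t).2,
        Potential.PhiP_zero_refl hF hS x t (Potential.conj_mem_D2 h.mem), smul_comm]
    · rw [Potential.PhiM_zero_refl hF hS x t h.mem, (hrel x t).1,
        Potential.chi4_refl hF hS x t h.mem, smul_comm]
  · obtain ⟨f, fHat, hne, hrel⟩ := h.proportional hF hS
    have hr := Potential.reflection_factor_ne hS
      (Potential.ne_zero_of_im_ne (Potential.conj_mem_D2 h.mem).2.ne)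
    have hChk := div_mul_cancel₀ fHat hr
    refine ⟨f, fHat, fHat / (conj z / (Complex.I * S.q0)), f * (z / (Complex.I * S.q0)), fun x t =>
      ⟨(hrel x t).1, (hrel x t).2, ?_, ?_⟩, fun x t =>
      h.poles hF hS hne hChk rfl x t (hrel x t).1 (hrel x t).2⟩
    · rw [Potential.PhiM_one_refl hF hS x t (Potential.conj_mem_D2 h.mem), (hrel x t).2,
        Potential.chi3_refl hF hS x t (Potential.conj_mem_D2 h.mem), smul_smul, hChk]
    · rw [Potential.chi4_refl hF hS x t h.mem, (hrel x t).1,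
        Potential.PhiP_one_refl hF hS x t h.mem, smul_smul, mul_comm]
  · obtain ⟨g, gHat, hrel⟩ := h.proportional hF hS
    have hr := Potential.reflection_factor_ne hS
      (Potential.ne_zero_of_im_ne (Potential.conj_mem_D2 h.mem).2.ne)
    have hChk := div_mul_cancel₀ gHat hr
    -- `Φ_{∓,2}` is invariant under reflection and `Φ_{±,1}` equals `Φ_{±,3}` at the original point
    -- times the reflection factor, which therefore divides in the third constant and multiplies in
    -- the fourth.
    refine ⟨g, gHat, gHat / (conj z / (Complex.I * S.q0)), g * (z / (Complex.I * S.q0)), fun x t =>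
      ⟨(hrel x t).1, (hrel x t).2, ?_, ?_⟩, fun x t =>
      h.poles hF hS hChk rfl x t (hrel x t).1 (hrel x t).2⟩
    · rw [Potential.PhiM_one_refl hF hS x t (Potential.conj_mem_D2 h.mem), (hrel x t).2,
        Potential.PhiP_zero_refl hF hS x t (Potential.conj_mem_D2 h.mem), smul_smul, hChk]
    · rw [Potential.PhiM_zero_refl hF hS x t h.mem, (hrel x t).1,
        Potential.PhiP_one_refl hF hS x t h.mem, smul_smul, mul_comm]
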